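/- Let $K$ be a number field, let $d\ge 2$ and $n\ge 0$ be integers, let $s_1,\dots,s_{d-1},t$ be independent transcendentals over $K$, put $K_{s,t}=K(s_1,\dots,s_{d-1},t)$, and let $$f(x)=x^d+s_1x^{d-1}+\dots+s_{d-1}x+t\in K_{s,t}[x]$$ be the generic monic polynomial of degree $d$ over $K$. Write $f'$ for the derivative of $f$ and $f^k$ for the $k$-th iterate of $f$ ($f^0(x)=x$). For a group $H$ let $S_m[H]=H^m\rtimes S_m$ be the wreath product in which $S_m$ permutes the $m$ coordinates, and let $[S_d]^0=1$, $[S_d]^{k+1}=S_d[[S_d]^k]$ be the iterated wreath products of $S_d$. Fix an algebraic closure $\overline{K_{s,t}}$, and let $K_{s,t}\big((f'\circ f^n)^{-1}(0)\big)$ be the field generated over $K_{s,t}$ by the roots of $f'\circ f^n$ in it. Then $$\mathrm{Gal}\Big(K_{s,t}\big((f'\circ f^n)^{-1}(0)\big)/K_{s,t}\Big)\cong S_{d-1}\big[[S_d]^n\big].$$ Moreover, let $T_{n+1}$ be the rooted tree whose vertices, apart from the root, are the roots in $\overline{K_{s,t}}$ of $f'\circ f^k$ for $0\le k\le n$ (those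 for a given $k$ forming the $(k+1)$-st level), where the root is joined to every root of $f'$ and a vertex $v$ of level $k+2$ is joined to the vertex $f(v)$ of level $k+1$. Then the arboreal representation $\mathrm{Gal}(\overline{K_{s,t}}/K_{s,t})\to\mathrm{Aut}(T_{n+1})$, given by the Galois action on the vertices, is surjective, and it induces an isomorphism $\mathrm{Gal}\big(K_{s,t}((f'\circ f^n)^{-1}(0))/K_{s,t}\big)\cong\mathrm{Aut}(T_{n+1})$. -/

import Mathlib

open Polynomial

noncomputable section

/-- The permutational wreath product `S_m[H] = H^m ⋊ S_m`, where `S_m = Perm (Fin m)` acts on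
`H^m = (Fin m → H)` by permuting the coordinates: `(σ • h) i = h (σ⁻¹ i)`. -/
abbrev SymWreath (m : ℕ) (H : Type) [Group H] : Type :=
  (Fin m → H) ⋊[mulAutArrow (G := Equiv.Perm (Fin m)) (A := Fin m) (M := H)] Equiv.Perm (Fin m)

/-- The `n`-th iterated wreath product `[S_d]^n`, bundled with its group structure:
`[S_d]^0` is trivial and `[S_d]^(n+1) = S_d[[S_d]^n]`. -/
def iterSymWreathGrp (d : ℕ) : ℕ → GrpCat.{0}
  | 0 => GrpCat.of PUnit
  | n + 1 => GrpCat.of (SymWreath d (iterSymWreathGrp d n))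

/-- The group `[S_d]^n`. -/
abbrev IterSymWreath (d n : ℕ) : Type := iterSymWreathGrp d n

/-- The function field `K_{s,t}`: rational functions over `K` in `d` independent transcendentals
`a_0, …, a_{d-1}`, where `t = a_0` and `s_i = a_{d-i}` for `1 ≤ i ≤ d - 1`. -/
abbrev GenericField (K : Type*) [Field K] (d : ℕ) : Type _ :=
  FractionRing (MvPolynomial (Fin d) K)

/-- The generic monic polynomial `x^d + a_{d-1} x^{d-1} + ⋯ + a_1 x + a_0` over `K_{s,t}`. -/
def genericMonic (K : Type*) [Field K] (d : ℕ) : (GenericField K d)[X] :=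
  X ^ d + ∑ i : Fin d,
    C (algebraMap (MvPolynomial (Fin d) K) (GenericField K d) (MvPolynomial.X i)) * X ^ (i : ℕ)

section Tree

variable {F : Type*} [Field F]

/-- The polynomial `f' ∘ f^n`, where `f^n` is the `n`-fold composition of `f` (and `f^0 = X`). -/
def derivCompIter (f : F[X]) (n : ℕ) : F[X] :=
  (derivative f).comp (f.comp^[n] X)

/-- `(f' ∘ f^n)⁻¹(0)`, the set of roots of `f' ∘ f^n` in an algebraic closure of `F`. -/
def critPreimages (f : F[X]) (n : ℕ) : Set (AlgebraicClosure F) :=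
  {α | aeval α (derivCompIter f n) = 0}

/-- The field `F((f' ∘ f^n)⁻¹(0))`. -/
def critField (f : F[X]) (n : ℕ) : IntermediateField F (AlgebraicClosure F) :=
  IntermediateField.adjoin F (critPreimages f n)

/-- The automorphism group of the rooted tree of backward orbits of the critical points of `f`,
truncated after the roots of `f' ∘ f^n`. Apart from the root, its vertices come in levels
`k = 0, …, n`; those of level `k` are the elements of `(f' ∘ f^k)⁻¹(0)`. The root is joined to
every vertex of level `0`, and a vertex `v` of level `k + 1` is joined to the vertex `w` of level
`k` with `f v = w`. An automorphism of the rooted tree is thus a family of permutations of the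
levels that preserves and reflects these edges. -/
def treeAut (f : F[X]) (n : ℕ) :
    Subgroup ((k : Fin (n + 1)) → Equiv.Perm (critPreimages f (k : ℕ))) where
  carrier := {σ | ∀ (k : Fin n) (v : critPreimages f (k.succ : ℕ))
    (w : critPreimages f (k.castSucc : ℕ)),
      aeval (σ k.succ v : AlgebraicClosure F) f = (σ k.castSucc w : AlgebraicClosure F) ↔
        aeval (v : AlgebraicClosure F) f = (w : AlgebraicClosure F)}
  mul_mem' := by
    intro σ τ hσ hτ k v w
    exact (hσ k (τ k.succ v) (τ k.castSucc w)).trans (hτ k v w)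
  one_mem' := by
    intro k v w
    exact Iff.rfl
  inv_mem' := by
    intro σ hσ k v w
    have h := hσ k ((σ k.succ)⁻¹ v) ((σ k.castSucc)⁻¹ w)
    have hv : σ k.succ ((σ k.succ)⁻¹ v) = v := (σ k.succ).apply_symm_apply v
    have hw : σ k.castSucc ((σ k.castSucc)⁻¹ w) = w := (σ k.castSucc).apply_symm_apply w
    rw [hv, hw] at h
    exact h.symm

theorem apply_mem_critPreimages (f : F[X]) (n : ℕ)
    (σ : AlgebraicClosure F ≃ₐ[F] AlgebraicClosure F) {α : AlgebraicClosure F}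
    (hα : α ∈ critPreimages f n) : σ α ∈ critPreimages f n := by
  have h : aeval α (derivCompIter f n) = 0 := hα
  change aeval (σ α) (derivCompIter f n) = 0
  rw [aeval_algHom_apply, h, map_zero]

/-- The arboreal Galois representation: the action of the absolute Galois group of `F` on the
truncated tree of backward orbits of the critical points of `f`. -/
def arborealRep (f : F[X]) (n : ℕ) :
    (AlgebraicClosure F ≃ₐ[F] AlgebraicClosure F) →* treeAut f n where
  toFun σ :=
    ⟨fun k =>
      { toFun := fun v => ⟨σ v, apply_mem_critPreimages f k σ v.2⟩
        invFun := fun v => ⟨σ.symm v, apply_mem_critPreimages f k σ.symm v.2⟩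
        left_inv := fun v => Subtype.ext (σ.symm_apply_apply v)
        right_inv := fun v => Subtype.ext (σ.apply_symm_apply v) },
      by
        intro k v w
        change aeval (σ (v : AlgebraicClosure F)) f = σ (w : AlgebraicClosure F) ↔ _
        rw [aeval_algHom_apply]
        exact σ.injective.eq_iff⟩
  map_one' := rfl
  map_mul' _ _ := rfl

end Tree

end

/-! Write `f` for the generic polynomial. The heart of the matter is that the arboreal
representation is surjective (`arborealRep_surjective`), which goes by induction on the height of
the tree. The critical points can be permuted arbitrarily (`exists_gal_perm_critical_points`). In
the induction step, a tree automorphism is corrected by a Galois element until it fixes all levels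
but the last; what remains is a product of transpositions of siblings. All such transpositions lie
in the image by conjugation, given three facts: (a) some Galois element transposes two leaves and
fixes the others (`exists_gal_swap`); (b) Galois is transitive on the leaves (`exists_galMap_eq`);
(c) the stabilizer of a leaf is transitive on its other siblings (`exists_gal_fix_map_sibling`).

Apart from (b), which is Eisenstein's criterion at the origin of coefficient space, Galois elements
come from specialization. For a monic `p` of degree `d` over an algebraically closed extension `E`
of `K`, the integral closure of `K[s, t]` maps to `E` so that `f` goes to `p`; a `K`-endomorphism of
`E` fixing the coefficients of `p` is then induced on the roots by an element of a decomposition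
group (`IsSpecialization.exists_algEquiv`). It remains to choose `p`.

For the critical points, `p` has independent transcendentals as its critical points. For (c), with
`d = e + 2`, take `x ((x - a)^(e+1) - a^(e+2)) + t` over `K⟦a⟧`: the siblings of `0` are `a + a w`
with `w^(e+1) = a`, so they are conjugate, and `t` is chosen to make `0` a simple root of `f' ∘
f^(n+1)`. For (a), take `p` with `0` a critical point of exact period `n + 1`, the other critical
orbits never returning to the critical locus, and deform it to `p + u`. The double root `0` of `p' ∘
p^(n+1)` then splits into two roots conjugate over `L((u))`, while all other roots are simple and
stay rational. In degree two `p = x^2 + t` with `t` a root of a Gleason polynomial, simple because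
`-1/2` is not an algebraic integer; in higher degree `p` looks like that quadratic near `0`, and its
other critical points escape to infinity in a nonarchimedean sense.

Finally, the tree and the iterated wreath product are compared through their actions on words: both
are the group of permutations preserving the relations "the first `j` letters agree". -/

noncomputable section

/-! ### Iterates and the chain rule for `f' ∘ f^n` -/

section CritIter

variable {A B : Type*} [CommRing A] [CommRing B]

/-- The polynomial `f' ∘ f^n` over a commutative ring. -/
def critIter (f : A[X]) (n : ℕ) : A[X] :=
  (derivative f).comp (f.comp^[n] X)

theorem map_iterate_comp_X (φ : A →+* B) (f : A[X]) (n : ℕ) :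
    (f.comp^[n] X).map φ = (f.map φ).comp^[n] X := by
  induction n with
  | zero => simp
  | succ n ih => rw [Function.iterate_succ_apply', Function.iterate_succ_apply', ← ih,
      Polynomial.map_comp]

theorem map_critIter (φ : A →+* B) (f : A[X]) (n : ℕ) :
    (critIter f n).map φ = critIter (f.map φ) n := by
  rw [critIter, critIter, Polynomial.map_comp, map_iterate_comp_X, derivative_map]

theorem eval_critIter (f : A[X]) (n : ℕ) (x : A) :
    (critIter f n).eval x = (derivative f).eval ((fun y => f.eval y)^[n] x) := by
  rw [critIter, eval_comp, iterate_comp_eval, eval_X]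

theorem eval_critIter_succ (f : A[X]) (n : ℕ) (x : A) :
    (critIter f (n + 1)).eval x = (critIter f n).eval (f.eval x) := by
  rw [eval_critIter, eval_critIter, Function.iterate_succ_apply]

theorem derivative_iterate_comp_X (f : A[X]) (n : ℕ) :
    derivative (f.comp^[n] X) = ∏ k ∈ Finset.range n, critIter f k := by
  induction n with
  | zero => simp
  | succ n ih => rw [Function.iterate_succ_apply', derivative_comp, ih, Finset.prod_range_succ,
      critIter]

/-- Chain rule. Over a domain, a root of `f' ∘ f^n` is multiple only if its orbit meets the critical
locus before step `n` or reaches a degenerate critical point at step `n`. The later simplicity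
arguments for these roots rest on this factorization. -/
theorem derivative_critIter (f : A[X]) (n : ℕ) :
    derivative (critIter f n) = (∏ k ∈ Finset.range n, critIter f k) *
      (derivative (derivative f)).comp (f.comp^[n] X) := by
  rw [critIter, derivative_comp, derivative_iterate_comp_X]

theorem eval_derivative_critIter (f : A[X]) (n : ℕ) (x : A) :
    (derivative (critIter f n)).eval x = (∏ k ∈ Finset.range n, (critIter f k).eval x) *
      (derivative (derivative f)).eval ((fun y => f.eval y)^[n] x) := by
  rw [derivative_critIter, eval_mul, eval_prod, eval_comp, iterate_comp_eval, eval_X]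

variable [IsDomain A]

theorem natDegree_iterate_comp_X (f : A[X]) (n : ℕ) :
    (f.comp^[n] X).natDegree = f.natDegree ^ n := by
  rw [natDegree_iterate_comp, natDegree_X, mul_one]

theorem monic_iterate_comp_X {f : A[X]} (hf : f.Monic) (hd : f.natDegree ≠ 0) (n : ℕ) :
    (f.comp^[n] X).Monic := by
  induction n with
  | zero => exact monic_X
  | succ n ih =>
    rw [Function.iterate_succ_apply']
    refine hf.comp ih ?_
    rw [natDegree_iterate_comp, natDegree_X, mul_one]
    exact pow_ne_zero _ hd

variable [CharZero A]

theorem natDegree_critIter (f : A[X]) (n : ℕ) :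
    (critIter f n).natDegree = (f.natDegree - 1) * f.natDegree ^ n := by
  rw [critIter, natDegree_comp, natDegree_derivative, natDegree_iterate_comp_X]

theorem leadingCoeff_critIter {f : A[X]} (hf : f.Monic) (hd : f.natDegree ≠ 0) (n : ℕ) :
    (critIter f n).leadingCoeff = f.natDegree := by
  have h := monic_iterate_comp_X hf hd n
  rw [critIter, leadingCoeff_comp, h.leadingCoeff, one_pow, mul_one, leadingCoeff,
    natDegree_derivative, coeff_derivative]
  · have : f.natDegree - 1 + 1 = f.natDegree := by omega
    rw [this, hf.coeff_natDegree, one_mul]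
    exact_mod_cast congrArg (Nat.cast (R := A)) this
  · rw [natDegree_iterate_comp_X]
    exact pow_ne_zero _ hd

theorem critIter_ne_zero {f : A[X]} (hf : f.Monic) (hd : f.natDegree ≠ 0) (n : ℕ) :
    critIter f n ≠ 0 := by
  rw [← leadingCoeff_ne_zero, leadingCoeff_critIter hf hd]
  exact_mod_cast hd

end CritIter

/-! ### Hensel's lemma without monicity -/

section Hensel

/-- Newton's method in an adically complete ring, for polynomials that need not be monic. -/
theorem IsAdicComplete.exists_isRoot {R : Type*} [CommRing R] (I : Ideal R) [IsAdicComplete I R]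
    (f : R[X]) (a₀ : R) (h₁ : f.eval a₀ ∈ I)
    (h₂ : IsUnit (Ideal.Quotient.mk I (f.derivative.eval a₀))) :
    ∃ a : R, f.IsRoot a ∧ a - a₀ ∈ I := by
  classical
  let c : ℕ → R := fun n => Nat.recOn n a₀ fun _ b => b - f.eval b * Ring.inverse (f.derivative.eval b)
  have hc : ∀ n, c (n + 1) = c n - f.eval (c n) * Ring.inverse (f.derivative.eval (c n)) := fun n => rfl
  have hc_mod : ∀ n, c n ≡ a₀ [SMOD I] := by
    intro n
    induction n with
    | zero => rfl
    | succ n ih => ?_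
    rw [hc, sub_eq_add_neg, ← add_zero a₀]
    refine ih.add ?_
    rw [SModEq.zero, Ideal.neg_mem_iff]
    refine I.mul_mem_right _ ?_
    rw [← SModEq.zero] at h₁ ⊢
    exact (ih.eval f).trans h₁
  have hf'c : ∀ n, IsUnit (f.derivative.eval (c n)) := by
    intro n
    have := isLocalHom_of_le_jacobson_bot I (IsAdicComplete.le_jacobson_bot I)
    apply IsUnit.of_map (Ideal.Quotient.mk I)
    convert! h₂ using 1
    exact SModEq.def.mp ((hc_mod n).eval _)
  have hfcI : ∀ n, f.eval (c n) ∈ I ^ (n + 1) := by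
    intro n
    induction n with
    | zero => simpa only [Nat.rec_zero, zero_add, pow_one] using! h₁
    | succ n ih => ?_
    obtain ⟨e, he⟩ := f.binomExpansion (c n) (-(f.eval (c n) * Ring.inverse (f.derivative.eval (c n))))
    have hz : f.eval (c n) + (derivative f).eval (c n) *
        (-(f.eval (c n) * Ring.inverse (f.derivative.eval (c n)))) = 0 := by
      rw [mul_neg, mul_left_comm, Ring.mul_inverse_cancel _ (hf'c n), mul_one, add_neg_cancel]
    rw [hc, sub_eq_add_neg, he, hz, zero_add, neg_sq, mul_pow]
    refine Ideal.mul_mem_left _ _ (Ideal.mul_mem_right _ _ ?_)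
    -- Newton's method squares the error; gaining a single power of `I` per step is enough here.
    refine Ideal.pow_le_pow_right (show n + 1 + 1 ≤ (n + 1) * 2 by omega) ?_
    rw [pow_mul]
    exact Ideal.pow_mem_pow ih 2
  have aux : ∀ m n, m ≤ n → c m ≡ c n [SMOD (I ^ m • ⊤ : Ideal R)] := by
    intro m n hmn
    rw [← Ideal.one_eq_top, Ideal.smul_eq_mul, mul_one]
    obtain ⟨k, rfl⟩ := Nat.exists_eq_add_of_le hmn
    clear hmn
    induction k with
    | zero => rw [add_zero]
    | succ k ih => ?_
    rw [← add_assoc, hc, ← add_zero (c m), sub_eq_add_neg]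
    refine ih.add ?_
    symm
    rw [SModEq.zero, Ideal.neg_mem_iff]
    refine Ideal.mul_mem_right _ _ (Ideal.pow_le_pow_right ?_ (hfcI _))
    rw [add_assoc]
    exact le_self_add
  obtain ⟨a, ha⟩ := IsPrecomplete.prec' c (aux _ _)
  refine ⟨a, ?_, ?_⟩
  · change f.eval a = 0
    suffices ∀ n, f.eval a ≡ 0 [SMOD (I ^ n • ⊤ : Ideal R)] by exact IsHausdorff.haus' _ this
    intro n
    specialize ha n
    rw [← Ideal.one_eq_top, Ideal.smul_eq_mul, mul_one] at ha ⊢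
    refine (ha.symm.eval f).trans ?_
    rw [SModEq.zero]
    exact Ideal.pow_le_pow_right le_self_add (hfcI _)
  · specialize ha 1
    rw [pow_one, ← Ideal.one_eq_top, Ideal.smul_eq_mul, mul_one] at ha
    exact SModEq.sub_mem.1 (ha.symm.trans (hc_mod 1))

variable {k : Type*} [Field k]

/-- Monicity is avoided because this is applied to derivatives and to polynomials in the parameter
`t`, whose leading coefficient may vanish under reduction. -/
theorem exists_root_powerSeries_of_simple_root (f : (PowerSeries k)[X]) (a₀ : k)
    (h : (f.map (PowerSeries.constantCoeff (R := k))).eval a₀ = 0)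
    (h' : (derivative (f.map (PowerSeries.constantCoeff (R := k)))).eval a₀ ≠ 0) :
    ∃ a : PowerSeries k, f.eval a = 0 ∧ PowerSeries.constantCoeff a = a₀ := by
  have key : ∀ g : (PowerSeries k)[X], PowerSeries.constantCoeff (g.eval (PowerSeries.C a₀)) =
      (g.map (PowerSeries.constantCoeff (R := k))).eval a₀ := by
    intro g
    rw [← eval_map_apply, PowerSeries.constantCoeff_C]
  obtain ⟨a, ha, ha'⟩ := IsAdicComplete.exists_isRoot (Ideal.span {(PowerSeries.X : PowerSeries k)})
    f (PowerSeries.C a₀)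
    (by rw [Ideal.mem_span_singleton, PowerSeries.X_dvd_iff, key, h])
    (by
      refine IsUnit.map _ (PowerSeries.isUnit_iff_constantCoeff.2 (isUnit_iff_ne_zero.2 ?_))
      rwa [key, ← derivative_map])
  refine ⟨a, ha, ?_⟩
  rw [Ideal.mem_span_singleton, PowerSeries.X_dvd_iff, map_sub, PowerSeries.constantCoeff_C,
    sub_eq_zero] at ha'
  exact ha'

end Hensel

/-! ### Lifting automorphisms through decomposition groups -/

section Invariant

/-- Two ring homomorphisms to a domain which agree on the ring of invariants of a finite group
differ by an element of the group, on any given finite sequence of elements. -/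
theorem exists_smul_eq_of_agree_on_invariants {A B E G : Type*} [CommRing A] [CommRing B]
    [CommRing E] [IsDomain E] [Algebra A B] [Group G] [Finite G] [MulSemiringAction G B]
    [Algebra.IsInvariant A B G] (ψ₁ ψ₂ : B →+* E)
    (h : ψ₁.comp (algebraMap A B) = ψ₂.comp (algebraMap A B)) (m : ℕ) (x : ℕ → B) :
    ∃ g : G, ∀ i < m, ψ₁ (g • x i) = ψ₂ (x i) := by
  classical
  cases nonempty_fintype G
  -- Packing all the `x i` into one polynomial gives a single `g` for all of them: `ψ₂ b` is a root
  -- of `∏ (Y - ψ₁ (g • b))` over the domain `E[X]`.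
  let b : B[X] := ∑ i ∈ Finset.range m, C (x i) * X ^ i
  have hb : ∀ i < m, b.coeff i = x i := by
    intro i hi
    simp only [b, finsetSum_coeff, coeff_C_mul_X_pow]
    rw [Finset.sum_ite_eq, if_pos (Finset.mem_range.2 hi)]
  let c : B[X][X] := MulSemiringAction.charpoly G b
  have hc : c.map (mapRingHom ψ₁) = c.map (mapRingHom ψ₂) := by
    ext i j
    simp only [coeff_map, coe_mapRingHom]
    have hinv : ∀ g : G, g • (c.coeff i).coeff j = (c.coeff i).coeff j := by
      intro g
      rw [← coeff_smul, MulSemiringAction.smul_coeff_charpoly]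
    obtain ⟨a, ha⟩ := Algebra.IsInvariant.isInvariant (A := A) (G := G) _ hinv
    rw [← ha]
    exact congrArg (fun φ : A →+* E => φ a) h
  have h0 : (c.map (mapRingHom ψ₂)).eval (mapRingHom ψ₂ b) = 0 := by
    rw [eval_map_apply, MulSemiringAction.eval_charpoly, map_zero]
  rw [← hc, show c = _ from MulSemiringAction.charpoly_eq G b, Polynomial.map_prod, eval_prod,
    Finset.prod_eq_zero_iff] at h0
  obtain ⟨g, -, hg⟩ := h0
  simp only [Polynomial.map_sub, map_X, map_C, eval_sub, eval_X, eval_C, sub_eq_zero] at hg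
  refine ⟨g, fun i hi => ?_⟩
  have := congrArg (fun q : E[X] => q.coeff i) hg
  simp only [coe_mapRingHom, coeff_map, coeff_smul, hb i hi] at this
  exact this.symm

/-- A ring homomorphism to an algebraically closed field extends to any integral extension. -/
theorem exists_extension_of_isIntegral {R S E : Type*} [CommRing R] [CommRing S] [Algebra R S]
    [Algebra.IsIntegral R S] [FaithfulSMul R S] [Field E] [IsAlgClosed E] (φ : R →+* E) :
    ∃ ψ : S →+* E, ψ.comp (algebraMap R S) = φ := by
  have hP : (RingHom.ker φ).IsPrime := RingHom.ker_isPrime φ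
  -- Lying over: `S ⧸ Q` is then integral over `R ⧸ ker φ`, which embeds in `E`, so it maps to the
  -- algebraically closed `E`.
  obtain ⟨Q, -, hQ, hQP⟩ := Ideal.exists_ideal_over_prime_of_isIntegral (S := S) (RingHom.ker φ) ⊥
    (by
      rw [← RingHom.ker_eq_comap_bot, (RingHom.injective_iff_ker_eq_bot _).1
        (FaithfulSMul.algebraMap_injective R S)]
      exact bot_le)
  have : Q.LiesOver (RingHom.ker φ) := ⟨hQP.symm⟩
  let _ : Algebra (R ⧸ RingHom.ker φ) E := (RingHom.kerLift φ).toAlgebra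
  have : Module.IsTorsionFree (R ⧸ RingHom.ker φ) E :=
    Module.isTorsionFree_iff_algebraMap_injective.2 (RingHom.kerLift_injective φ)
  have : Module.IsTorsionFree (R ⧸ RingHom.ker φ) (S ⧸ Q) :=
    Module.isTorsionFree_iff_algebraMap_injective.2
      (Ideal.quotientMap_injective' hQP.le)
  have : Algebra.IsIntegral (R ⧸ RingHom.ker φ) (S ⧸ Q) := Algebra.IsIntegral.tower_top R
  let ψ : S ⧸ Q →ₐ[R ⧸ RingHom.ker φ] E := IsAlgClosed.lift
  refine ⟨ψ.toRingHom.comp (Ideal.Quotient.mk Q), ?_⟩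
  ext r
  exact ψ.commutes (Ideal.Quotient.mk _ r)

/-- An endomorphism of `E` fixing the image of `R` lifts, along a homomorphism from the integral
closure of `R` to `E`, to a Galois automorphism, on any given finite set. -/
theorem exists_algEquiv_of_specialization {R F L E : Type*} [CommRing R] [IsDomain R]
    [IsIntegrallyClosed R]
    [Field F] [Algebra R F] [IsFractionRing R F] [Field L] [Algebra F L] [Algebra R L]
    [IsScalarTower R F L] [IsGalois F L] [CommRing E] [IsDomain E]
    (ψ : integralClosure R L →+* E) (σ : E →+* E)
    (hσ : ∀ r : R, σ (ψ (algebraMap R _ r)) = ψ (algebraMap R _ r))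
    (s : Set (integralClosure R L)) (hs : s.Finite) :
    ∃ g : L ≃ₐ[F] L, ∀ x ∈ s, ∀ y : integralClosure R L, (y : L) = g x → ψ y = σ (ψ x) := by
  classical
  have hs' : Finite (Subtype.val '' s : Set L) := hs.image _
  -- The comparison of homomorphisms needs a finite group, hence the descent to a finite Galois
  -- layer containing `s`.
  let M' := FiniteGaloisIntermediateField.adjoin F (Subtype.val '' s : Set L)
  let M : IntermediateField F L := M'.toIntermediateField
  have hM : ∀ x ∈ s, (x : L) ∈ M := fun x hx =>
    FiniteGaloisIntermediateField.subset_adjoin F _ (Set.mem_image_of_mem _ hx)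
  have : FiniteDimensional F M := M'.finiteDimensional
  have : IsGalois F M := M'.isGalois
  let BM := integralClosure R M
  let _ : MulSemiringAction (M ≃ₐ[F] M) BM := IsIntegralClosure.MulSemiringAction R F M BM
  have : IsFractionRing BM M := IsIntegralClosure.isFractionRing_of_finite_extension R F M BM
  have : Algebra.IsInvariant R BM (M ≃ₐ[F] M) := Algebra.isInvariant_of_isGalois R F M BM
  have hsmul : ∀ (g : M ≃ₐ[F] M) (b : BM), ((g • b : BM) : M) = g b := fun g b =>
    algebraMap_galRestrictHom_apply R F M BM g b
  let ι : BM →ₐ[R] integralClosure R L := (M.val.restrictScalars R).mapIntegralClosure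
  have hι : ∀ b : BM, (ι b : L) = (b : M) := fun b => rfl
  have hlift : ∀ x ∈ s, ∃ b : BM, ι b = x := by
    intro x hx
    refine ⟨⟨⟨x, hM x hx⟩, ?_⟩, Subtype.ext rfl⟩
    exact (isIntegral_algHom_iff (M.val.restrictScalars R) Subtype.val_injective).1 x.2
  choose! b hb using hlift
  let l := hs.toFinset.toList
  obtain ⟨g, hg⟩ := exists_smul_eq_of_agree_on_invariants (A := R) (G := M ≃ₐ[F] M)
    (ψ.comp ι.toRingHom) (σ.comp (ψ.comp ι.toRingHom)) (by
      ext r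
      have : ι (algebraMap R BM r) = algebraMap R _ r := ι.commutes r
      simp only [RingHom.comp_apply, AlgHom.toRingHom_eq_coe, RingHom.coe_coe, this, hσ])
    l.length (fun i => b (l.getD i 0))
  refine ⟨g.liftNormal L, fun x hx y hy => ?_⟩
  obtain ⟨i, hi, hxi⟩ := List.mem_iff_getElem.1
    (show x ∈ l from Finset.mem_toList.2 (hs.mem_toFinset.2 hx))
  have h1 := hg i hi
  rw [List.getD_eq_getElem _ _ hi, hxi] at h1
  simp only [RingHom.comp_apply, AlgHom.toRingHom_eq_coe, RingHom.coe_coe, hb x hx] at h1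
  rw [← h1]
  congr 1
  apply Subtype.ext
  rw [hy, hι, hsmul]
  conv_lhs => rw [← hb x hx, hι]
  exact g.liftNormal_commutes L _

end Invariant

/-! ### The generic polynomial over `K[s, t]` and over its integral closure -/

section Generic

variable (K : Type*) [Field K] (d : ℕ)

/-- The generic monic polynomial over the polynomial ring in its coefficients. -/
def genericMonicInt : (MvPolynomial (Fin d) K)[X] :=
  X ^ d + ∑ i : Fin d, C (MvPolynomial.X i) * X ^ (i : ℕ)

/-- The integral closure of `K[s, t]` in the algebraic closure of `K(s, t)`. -/
abbrev GenericIntegers : Type _ :=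
  integralClosure (MvPolynomial (Fin d) K) (AlgebraicClosure (GenericField K d))

theorem map_genericMonicInt :
    (genericMonicInt K d).map (algebraMap _ (GenericField K d)) = genericMonic K d := by
  simp [genericMonicInt, genericMonic, Polynomial.map_sum]

theorem monic_genericMonicInt : (genericMonicInt K d).Monic :=
  monic_X_pow_add (degree_sum_fin_lt _)

theorem natDegree_genericMonicInt : (genericMonicInt K d).natDegree = d := by
  have h : (genericMonicInt K d).degree = d := by
    rw [genericMonicInt, degree_add_eq_left_of_degree_lt, degree_X_pow]
    rw [degree_X_pow]
    exact degree_sum_fin_lt _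
  exact natDegree_eq_of_degree_eq_some h

theorem coeff_genericMonicInt (i : Fin d) :
    (genericMonicInt K d).coeff i = MvPolynomial.X i := by
  simp only [genericMonicInt, coeff_add, coeff_X_pow, finsetSum_coeff, coeff_C_mul, mul_ite,
    mul_one, mul_zero, i.2.ne, if_false, zero_add, Fin.val_inj]
  simp

theorem monic_genericMonic : (genericMonic K d).Monic := by
  rw [← map_genericMonicInt]
  exact (monic_genericMonicInt K d).map _

theorem natDegree_genericMonic : (genericMonic K d).natDegree = d := by
  rw [← map_genericMonicInt, (monic_genericMonicInt K d).natDegree_map, natDegree_genericMonicInt]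

/-- The generic monic polynomial over the integral closure of `K[s, t]`. -/
def genericMonicClosure : (GenericIntegers K d)[X] :=
  (genericMonicInt K d).map (algebraMap _ _)

theorem monic_genericMonicClosure : (genericMonicClosure K d).Monic :=
  (monic_genericMonicInt K d).map _

theorem natDegree_genericMonicClosure : (genericMonicClosure K d).natDegree = d := by
  rw [genericMonicClosure, (monic_genericMonicInt K d).natDegree_map, natDegree_genericMonicInt]

theorem map_genericMonicClosure :
    (genericMonicClosure K d).map (algebraMap _ (AlgebraicClosure (GenericField K d))) =
      (genericMonic K d).map (algebraMap _ _) := by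
  rw [← map_genericMonicInt, genericMonicClosure, Polynomial.map_map, Polynomial.map_map,
    ← IsScalarTower.algebraMap_eq, ← IsScalarTower.algebraMap_eq]

variable [CharZero K]

instance charZero_genericField : CharZero (GenericField K d) :=
  charZero_of_injective_algebraMap (IsFractionRing.injective (MvPolynomial (Fin d) K) _)

instance charZero_mvPolynomial : CharZero (MvPolynomial (Fin d) K) :=
  charZero_of_injective_algebraMap (MvPolynomial.C_injective (Fin d) K)

end Generic

/-! ### Specialization of the roots and of the Galois action -/

section Specialization

variable {K : Type*} [Field K] {d : ℕ}

theorem mem_critPreimages_iff {n : ℕ} {x : AlgebraicClosure (GenericField K d)} :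
    x ∈ critPreimages (genericMonic K d) n ↔
      (critIter ((genericMonic K d).map (algebraMap _ _)) n).eval x = 0 := by
  rw [← map_critIter, eval_map_algebraMap]
  rfl

theorem coe_eval_genericIntegers (q : (GenericIntegers K d)[X]) (x : GenericIntegers K d) :
    ((q.eval x : GenericIntegers K d) : AlgebraicClosure (GenericField K d)) =
      (q.map (algebraMap _ (AlgebraicClosure (GenericField K d)))).eval
        (x : AlgebraicClosure (GenericField K d)) :=
  (eval_map_apply (algebraMap (GenericIntegers K d) (AlgebraicClosure (GenericField K d))) x).symm

theorem coe_eval_genericMonicClosure (x : GenericIntegers K d) :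
    (((genericMonicClosure K d).eval x : GenericIntegers K d) :
      AlgebraicClosure (GenericField K d)) =
      aeval (x : AlgebraicClosure (GenericField K d)) (genericMonic K d) := by
  rw [coe_eval_genericIntegers, map_genericMonicClosure, eval_map_algebraMap]

theorem coe_mem_critPreimages_iff {n : ℕ} {x : GenericIntegers K d} :
    (x : AlgebraicClosure (GenericField K d)) ∈ critPreimages (genericMonic K d) n ↔
      (critIter (genericMonicClosure K d) n).eval x = 0 := by
  rw [mem_critPreimages_iff, ← map_genericMonicClosure, ← map_critIter,
    ← coe_eval_genericIntegers]
  exact ZeroMemClass.coe_eq_zero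

theorem exists_coe_eq_of_monic {q : (GenericIntegers K d)[X]} (hq : q.Monic)
    {x : AlgebraicClosure (GenericField K d)} (hx : (q.map (algebraMap _ _)).eval x = 0) :
    ∃ y : GenericIntegers K d, (y : AlgebraicClosure (GenericField K d)) = x ∧ q.eval y = 0 := by
  have hint : IsIntegral (GenericIntegers K d) x := ⟨q, hq, by rwa [← eval_map]⟩
  refine ⟨⟨x, isIntegral_trans (R := MvPolynomial (Fin d) K) _ hint⟩, rfl, ?_⟩
  apply Subtype.ext
  rw [coe_eval_genericIntegers]
  exact hx

/-- A specialization of the generic monic polynomial to the polynomial `p`: a homomorphism from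
the integral closure of `K[s, t]` that takes the generic polynomial to `p`. -/
structure IsSpecialization {E : Type*} [Field E] [Algebra K E] (p : E[X])
    (ψ : GenericIntegers K d →+* E) : Prop where
  map_eq : (genericMonicClosure K d).map ψ = p
  map_algebraMap : ∀ c : K, ψ (algebraMap (MvPolynomial (Fin d) K) _ (MvPolynomial.C c)) =
    algebraMap K E c

variable {E : Type*} [Field E] [Algebra K E]

theorem exists_isSpecialization [IsAlgClosed E] {p : E[X]} (hp : p.Monic) (hd : p.natDegree = d) :
    ∃ ψ : GenericIntegers K d →+* E, IsSpecialization p ψ := by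
  let φ : MvPolynomial (Fin d) K →ₐ[K] E := MvPolynomial.aeval (fun i => p.coeff i)
  have : FaithfulSMul (MvPolynomial (Fin d) K) (AlgebraicClosure (GenericField K d)) := by
    rw [faithfulSMul_iff_algebraMap_injective, IsScalarTower.algebraMap_eq _ (GenericField K d) _]
    exact (algebraMap (GenericField K d) _).injective.comp
      (IsFractionRing.injective (MvPolynomial (Fin d) K) _)
  have : FaithfulSMul (MvPolynomial (Fin d) K) (GenericIntegers K d) := by
    rw [faithfulSMul_iff_algebraMap_injective]
    intro a b h
    exact FaithfulSMul.algebraMap_injective _ (AlgebraicClosure (GenericField K d))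
      (congrArg Subtype.val h)
  obtain ⟨ψ, hψ⟩ := exists_extension_of_isIntegral (S := GenericIntegers K d) φ.toRingHom
  refine ⟨ψ, ?_, fun c => ?_⟩
  · rw [genericMonicClosure, Polynomial.map_map, hψ]
    ext i
    rcases lt_trichotomy i d with h | rfl | h
    · have := coeff_genericMonicInt K d ⟨i, h⟩
      simp only at this
      rw [coeff_map, this]
      simp [φ]
    · have h1 := (monic_genericMonicInt K i).coeff_natDegree
      rw [natDegree_genericMonicInt] at h1
      have h2 := hp.coeff_natDegree
      rw [hd] at h2
      rw [coeff_map, h1, h2, map_one]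
    · rw [coeff_map, coeff_eq_zero_of_natDegree_lt, map_zero, coeff_eq_zero_of_natDegree_lt]
      · rwa [hd]
      · rwa [natDegree_genericMonicInt]
  · have := RingHom.congr_fun hψ (MvPolynomial.C c)
    simpa [φ] using this

variable {p : E[X]} {ψ : GenericIntegers K d →+* E}

theorem IsSpecialization.map_eval (h : IsSpecialization p ψ) (x : GenericIntegers K d) :
    ψ ((genericMonicClosure K d).eval x) = p.eval (ψ x) := by
  rw [← h.map_eq, eval_map_apply]

theorem IsSpecialization.map_critIter (h : IsSpecialization p ψ) (n : ℕ) :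
    (critIter (genericMonicClosure K d) n).map ψ = critIter p n := by
  rw [_root_.map_critIter, h.map_eq]

/-- `K[s, t]` is generated over `K` by the coefficients of `f`, whose images are coefficients of `p`
and hence fixed. -/
theorem IsSpecialization.apply_coeff (h : IsSpecialization p ψ) (σ : E →ₐ[K] E)
    (hσ : p.map σ = p) (r : MvPolynomial (Fin d) K) :
    σ (ψ (algebraMap _ _ r)) = ψ (algebraMap _ _ r) := by
  induction r using MvPolynomial.induction_on with
  | C c => rw [h.map_algebraMap, σ.commutes]
  | add q r hq hr => rw [map_add, map_add, map_add, hq, hr]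
  | mul_X q i hq =>
    rw [map_mul, map_mul, map_mul, hq]
    congr 1
    have h1 : ψ (algebraMap (MvPolynomial (Fin d) K) _ (MvPolynomial.X i)) = p.coeff i := by
      rw [← h.map_eq, coeff_map, genericMonicClosure, coeff_map, coeff_genericMonicInt]
    rw [h1]
    conv_rhs => rw [← hσ, coeff_map]
    rfl

/-- Every root of the specialization of a monic polynomial is the specialization of a root. -/
theorem exists_root_of_specialization {E' : Type*} [Field E'] (ψ : GenericIntegers K d →+* E')
    {e : E'} (m : ℕ) :
    ∀ q : (GenericIntegers K d)[X], q.Monic → q.natDegree = m → (q.map ψ).eval e = 0 →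
      ∃ x, q.eval x = 0 ∧ ψ x = e := by
  induction m with
  | zero =>
    intro q hq hm he
    rw [hq.natDegree_eq_zero.1 hm] at he
    simp at he
  | succ m ih =>
    intro q hq hm he
    obtain ⟨x, hx⟩ := IsAlgClosed.exists_root
      (q.map (algebraMap _ (AlgebraicClosure (GenericField K d)))) (by
        rw [hq.degree_map, degree_eq_natDegree hq.ne_zero, hm]
        exact_mod_cast Nat.succ_ne_zero m)
    obtain ⟨y, -, hy⟩ := exists_coe_eq_of_monic hq hx
    obtain ⟨r, rfl⟩ := dvd_iff_isRoot.2 (show IsRoot q y from hy)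
    have hr : r.Monic := (monic_X_sub_C y).of_mul_monic_left hq
    rw [(monic_X_sub_C y).natDegree_mul hr, natDegree_X_sub_C, add_comm] at hm
    rw [Polynomial.map_mul, eval_mul, Polynomial.map_sub, map_X, map_C, eval_sub, eval_X, eval_C,
      mul_eq_zero, sub_eq_zero] at he
    rcases he with he | he
    · exact ⟨y, by simp, he.symm⟩
    · obtain ⟨x, hx, hxe⟩ := ih r hr (Nat.succ_injective hm) he
      exact ⟨x, by rw [eval_mul, hx, mul_zero], hxe⟩

variable [CharZero K]

/-- The polynomial `f' ∘ f^n` of the generic polynomial, divided by its leading coefficient. -/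
theorem exists_monic_eq_critIter (hd : d ≠ 0) (n : ℕ) :
    ∃ q : (GenericIntegers K d)[X], q.Monic ∧
      C (d : GenericIntegers K d) * q = critIter (genericMonicClosure K d) n := by
  let u : GenericIntegers K d := algebraMap (MvPolynomial (Fin d) K) _ (MvPolynomial.C (d : K)⁻¹)
  have hu : u * d = 1 := by
    have : (d : GenericIntegers K d) = algebraMap (MvPolynomial (Fin d) K) _
      (MvPolynomial.C (d : K)) := by simp
    rw [this, ← map_mul, ← map_mul, inv_mul_cancel₀ (by exact_mod_cast hd), map_one, map_one]
  have : CharZero (GenericIntegers K d) := by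
    have : CharZero (AlgebraicClosure (GenericField K d)) :=
      charZero_of_injective_algebraMap (algebraMap (GenericField K d) _).injective
    exact ⟨fun a b h => Nat.cast_injective (R := AlgebraicClosure (GenericField K d))
      (by simpa using congrArg Subtype.val h)⟩
  have hl := leadingCoeff_critIter (monic_genericMonicClosure K d)
    (by rwa [natDegree_genericMonicClosure]) n
  rw [natDegree_genericMonicClosure] at hl
  refine ⟨C u * critIter (genericMonicClosure K d) n, ?_, ?_⟩
  · rw [Monic, leadingCoeff_mul, leadingCoeff_C, hl, hu]
  · rw [← mul_assoc, ← C_mul, mul_comm, mul_comm _ u, hu, C_1, mul_one]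

/-- Up to the factor `d`, a unit in characteristic zero, `f' ∘ f^n` is monic with integral
coefficients. -/
theorem exists_coe_eq_of_mem_critPreimages (hd : d ≠ 0) {n : ℕ}
    {x : AlgebraicClosure (GenericField K d)} (hx : x ∈ critPreimages (genericMonic K d) n) :
    ∃ y : GenericIntegers K d, (y : AlgebraicClosure (GenericField K d)) = x := by
  obtain ⟨q, hq, hqc⟩ := exists_monic_eq_critIter (K := K) hd n
  rw [mem_critPreimages_iff, ← map_genericMonicClosure, ← map_critIter, ← hqc, Polynomial.map_mul,
    eval_mul, map_C, eval_C, map_natCast, mul_eq_zero] at hx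
  have hdn : (d : AlgebraicClosure (GenericField K d)) ≠ 0 := by
    have : CharZero (AlgebraicClosure (GenericField K d)) :=
      charZero_of_injective_algebraMap (algebraMap (GenericField K d) _).injective
    exact_mod_cast hd
  obtain ⟨y, hy, -⟩ := exists_coe_eq_of_monic hq (hx.resolve_left hdn)
  exact ⟨y, hy⟩

theorem exists_critPreimage_of_specialization [CharZero E] (hd : d ≠ 0)
    (h : IsSpecialization p ψ) {n : ℕ} {e : E} (he : (critIter p n).eval e = 0) :
    ∃ x : GenericIntegers K d, (critIter (genericMonicClosure K d) n).eval x = 0 ∧ ψ x = e := by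
  obtain ⟨q, hq, hqc⟩ := exists_monic_eq_critIter (K := K) hd n
  rw [← h.map_critIter, ← hqc, Polynomial.map_mul, eval_mul, map_C, eval_C, map_natCast,
    mul_eq_zero] at he
  obtain ⟨x, hx, hxe⟩ := exists_root_of_specialization ψ _ q hq rfl
    (he.resolve_left (by exact_mod_cast hd))
  exact ⟨x, by rw [← hqc, eval_mul, hx, mul_zero], hxe⟩

theorem finite_critPreimages (hd : d ≠ 0) (n : ℕ) :
    (critPreimages (genericMonic K d) n).Finite := by
  have h : critIter (genericMonic K d) n ≠ 0 :=
    critIter_ne_zero (monic_genericMonic K d) (by rwa [natDegree_genericMonic]) n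
  refine (rootSet_finite (critIter (genericMonic K d) n)
    (AlgebraicClosure (GenericField K d))).subset fun x hx => ?_
  rw [mem_rootSet]
  exact ⟨h, hx⟩

/-- An automorphism over which a specialization `p` is defined lifts to a Galois automorphism over
`K(s, t)`, with a compatible action on the roots of `f' ∘ f^n`. -/
theorem IsSpecialization.exists_algEquiv (h : IsSpecialization p ψ) (hd : d ≠ 0) (n : ℕ)
    (σ : E →ₐ[K] E) (hσ : p.map σ = p) :
    ∃ g : AlgebraicClosure (GenericField K d) ≃ₐ[GenericField K d]
      AlgebraicClosure (GenericField K d),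
      ∀ x y : GenericIntegers K d, (critIter (genericMonicClosure K d) n).eval x = 0 →
        (y : AlgebraicClosure (GenericField K d)) = g x → ψ y = σ (ψ x) := by
  obtain ⟨g, hg⟩ := exists_algEquiv_of_specialization (F := GenericField K d) ψ σ.toRingHom
    (h.apply_coeff σ hσ) {x | (critIter (genericMonicClosure K d) n).eval x = 0}
    (((finite_critPreimages hd n).preimage Subtype.val_injective.injOn).subset
      fun x hx => coe_mem_critPreimages_iff.2 hx)
  exact ⟨g, fun x y hx hy => hg x hx y hy⟩

/-- The action of a Galois automorphism on the roots of `f' ∘ f^n`. -/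
def galMap {F : Type*} [Field F] {f : F[X]} {n : ℕ} (g : AlgebraicClosure F ≃ₐ[F] AlgebraicClosure F)
    (x : critPreimages f n) : critPreimages f n :=
  ⟨g x, apply_mem_critPreimages f n g x.2⟩

/-- Specialization of the roots of `f' ∘ f^n`. -/
structure IsRootSpecialization {E : Type*} [Field E] [Algebra K E] (p : E[X]) {n : ℕ}
    (θ : critPreimages (genericMonic K d) n → E) : Prop where
  eval_eq_zero : ∀ x, (critIter p n).eval (θ x) = 0
  exists_eq : ∀ e, (critIter p n).eval e = 0 → ∃ x, θ x = e
  derivative_eq_zero : ∀ x y, x ≠ y → θ x = θ y → (derivative (critIter p n)).eval (θ x) = 0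
  exists_gal : ∀ σ : E →ₐ[K] E, p.map σ = p → ∃ g : AlgebraicClosure (GenericField K d)
    ≃ₐ[GenericField K d] AlgebraicClosure (GenericField K d), ∀ x, θ (galMap g x) = σ (θ x)
  eval_eq : ∀ x y : critPreimages (genericMonic K d) n,
    aeval (x : AlgebraicClosure (GenericField K d)) (genericMonic K d) =
      aeval (y : AlgebraicClosure (GenericField K d)) (genericMonic K d) →
    p.eval (θ x) = p.eval (θ y)
  derivative_eq_zero_of_sibling : ∀ x y : critPreimages (genericMonic K d) n,
    aeval (x : AlgebraicClosure (GenericField K d)) (genericMonic K d) =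
      aeval (y : AlgebraicClosure (GenericField K d)) (genericMonic K d) →
    x ≠ y → θ x = θ y → (derivative p).eval (θ x) = 0

/-- Roots that collide produce a double root: `(X - x) (X - y)` divides `q` and becomes a square.
Used in the contrapositive, this makes specialization injective over simple roots. -/
theorem derivative_eval_eq_zero_of_map_eq {A E' : Type*} [CommRing A] [IsDomain A] [CommRing E']
    (ψ : A →+* E') {q : A[X]} {x y : A} (hx : q.eval x = 0) (hy : q.eval y = 0) (hxy : x ≠ y)
    (h : ψ x = ψ y) : (derivative (q.map ψ)).eval (ψ x) = 0 := by
  obtain ⟨r, rfl⟩ := dvd_iff_isRoot.2 (show IsRoot _ x from hx)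
  have hry : r.eval y = 0 := by
    rw [eval_mul, eval_sub, eval_X, eval_C] at hy
    exact (mul_eq_zero.1 hy).resolve_left (sub_ne_zero.2 hxy.symm)
  obtain ⟨s, rfl⟩ := dvd_iff_isRoot.2 (show IsRoot _ y from hry)
  simp [h]

theorem exists_isRootSpecialization [CharZero E] [IsAlgClosed E] (hd0 : d ≠ 0) (hp : p.Monic)
    (hd : p.natDegree = d) (n : ℕ) :
    ∃ θ : critPreimages (genericMonic K d) n → E, IsRootSpecialization p θ := by
  obtain ⟨ψ, h⟩ := exists_isSpecialization (K := K) hp hd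
  have hl : ∀ x : critPreimages (genericMonic K d) n, ∃ y : GenericIntegers K d,
      (y : AlgebraicClosure (GenericField K d)) = x :=
    fun x => exists_coe_eq_of_mem_critPreimages hd0 x.2
  choose l hl using hl
  have hl0 : ∀ x, (critIter (genericMonicClosure K d) n).eval (l x) = 0 := fun x =>
    coe_mem_critPreimages_iff.1 (by rw [hl]; exact x.2)
  have hinj : ∀ x y, x ≠ y → l x ≠ l y := fun x y hxy hlxy =>
    hxy (Subtype.ext (by rw [← hl, ← hl, hlxy]))
  refine ⟨fun x => ψ (l x), ⟨fun x => ?_, fun e he => ?_, fun x y hxy h' => ?_, fun σ hσ => ?_,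
    fun x y hxy => ?_, fun x y hs hxy h' => ?_⟩⟩
  · rw [← h.map_critIter, eval_map_apply, hl0, map_zero]
  · obtain ⟨x, hx, hxe⟩ := exists_critPreimage_of_specialization hd0 h he
    refine ⟨⟨x, coe_mem_critPreimages_iff.2 hx⟩, ?_⟩
    rw [← hxe]
    exact congrArg ψ (Subtype.ext (hl _))
  · rw [← h.map_critIter]
    exact derivative_eval_eq_zero_of_map_eq ψ (hl0 x) (hl0 y) (hinj x y hxy) h'
  · obtain ⟨g, hg⟩ := h.exists_algEquiv hd0 n σ hσ
    refine ⟨g, fun x => hg _ _ (hl0 x) ?_⟩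
    rw [hl, hl]
    rfl
  · rw [← h.map_eval, ← h.map_eval]
    refine congrArg ψ (Subtype.ext ?_)
    rw [coe_eval_genericMonicClosure, coe_eval_genericMonicClosure, hl, hl, hxy]
  · have hs' : (genericMonicClosure K d).eval (l y) = (genericMonicClosure K d).eval (l x) := by
      apply Subtype.ext
      rw [coe_eval_genericMonicClosure, coe_eval_genericMonicClosure, hl, hl, hs]
    -- Siblings are roots of `f - f(x)`, which has the same derivative as `f`.
    have := derivative_eval_eq_zero_of_map_eq ψ
      (q := genericMonicClosure K d - C ((genericMonicClosure K d).eval (l x)))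
      (x := l x) (y := l y) (by simp) (by simp [hs']) (hinj x y hxy) h'
    rw [Polynomial.map_sub, map_C, derivative_sub, derivative_C, sub_zero, h.map_eq] at this
    exact this

end Specialization

/-! ### Irreducibility of `f' ∘ f^n` and the size of the levels -/

section Irreducible

theorem critIter_X_pow {A : Type*} [CommRing A] (d n : ℕ) :
    critIter (X ^ d : A[X]) n = C (d : A) * X ^ (d ^ n * (d - 1)) := by
  have h : (X ^ d : A[X]).comp^[n] X = X ^ d ^ n := by
    induction n with
    | zero => simp
    | succ n ih => rw [Function.iterate_succ_apply', ih, X_pow_comp, ← pow_mul, pow_succ]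
  rw [critIter, h, derivative_X_pow, mul_comp, C_comp, X_pow_comp, ← pow_mul]

variable (K : Type*) [Field K] {d : ℕ}

theorem map_constantCoeff_genericMonicInt :
    (genericMonicInt K d).map (MvPolynomial.constantCoeff (R := K)) = X ^ d := by
  simp [genericMonicInt, Polynomial.map_sum]

/-- A map to the dual numbers kills the square of the ideal. Sending the coefficient of `x` to `ε`
and the other lower coefficients to `0` turns `f` into `x^d + ε x`, which fixes `0` and has
derivative `ε ≠ 0` there. -/
theorem coeff_zero_critIter_notMem (hd : 2 ≤ d) (n : ℕ) :
    (critIter (genericMonicInt K d) n).coeff 0 ∉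
      (RingHom.ker (MvPolynomial.constantCoeff (R := K) (σ := Fin d))) ^ 2 := by
  let χ : MvPolynomial (Fin d) K →ₐ[K] DualNumber K :=
    MvPolynomial.aeval (fun i => if (i : ℕ) = 1 then DualNumber.eps else 0)
  have hχ : ∀ r, (χ r).fst = MvPolynomial.constantCoeff r := by
    intro r
    induction r using MvPolynomial.induction_on with
    | C c => simp [χ, TrivSqZeroExt.algebraMap_eq_inl]
    | add q r hq hr => simp [hq, hr]
    | mul_X q i hq =>
      rw [map_mul, TrivSqZeroExt.fst_mul, map_mul, MvPolynomial.constantCoeff_X, mul_zero]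
      simp only [χ, MvPolynomial.aeval_X]
      split_ifs <;> simp
  have hker : (RingHom.ker (MvPolynomial.constantCoeff (R := K) (σ := Fin d))) ^ 2 ≤
      RingHom.ker χ := by
    rw [pow_two, Ideal.mul_le]
    intro r hr s hs
    rw [RingHom.mem_ker] at hr hs ⊢
    rw [map_mul]
    ext
    · simp [hχ, hr]
    · simp [hχ, hr, hs]
  intro hmem
  have h0 := RingHom.mem_ker.1 (hker hmem)
  have hmap : (genericMonicInt K d).map χ.toRingHom = X ^ d + C DualNumber.eps * X := by
    rw [genericMonicInt, Polynomial.map_add, Polynomial.map_pow, map_X, Polynomial.map_sum,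
      Finset.sum_eq_single (⟨1, by omega⟩ : Fin d)]
    · simp [χ]
    · intro i _ hi
      have hi' : (i : ℕ) ≠ 1 := fun h => hi (Fin.ext h)
      simp [χ, hi']
    · simp
  have hiter : ∀ m, (fun y => (X ^ d + C DualNumber.eps * X : (DualNumber K)[X]).eval y)^[m] 0
      = 0 := by
    intro m
    refine Function.iterate_fixed ?_ m
    have : d ≠ 0 := by omega
    simp [this]
  have h1 : χ ((critIter (genericMonicInt K d) n).coeff 0) = DualNumber.eps := by
    have hd' : d - 1 ≠ 0 := by omega
    calc χ ((critIter (genericMonicInt K d) n).coeff 0)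
        = ((critIter (genericMonicInt K d) n).map χ.toRingHom).eval 0 := by
          rw [← coeff_zero_eq_eval_zero, coeff_map]; rfl
      _ = DualNumber.eps := by
          rw [map_critIter, hmap, eval_critIter, hiter]
          simp [derivative_X_pow, hd']
  rw [h1] at h0
  have := congrArg TrivSqZeroExt.snd h0
  simp at this

variable [CharZero K]

/-- Eisenstein at the ideal of the origin: modulo it `f` becomes `x^d`, so `f' ∘ f^n` becomes a
monomial. Gauss's lemma passes to the fraction field. -/
theorem irreducible_critIter_genericMonic (hd : 2 ≤ d) (n : ℕ) :
    Irreducible (critIter (genericMonic K d) n) := by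
  have hd0 : (genericMonicInt K d).natDegree ≠ 0 := by rw [natDegree_genericMonicInt]; omega
  have hl := leadingCoeff_critIter (monic_genericMonicInt K d) hd0 n
  have hdeg := natDegree_critIter (genericMonicInt K d) n
  rw [natDegree_genericMonicInt] at hl hdeg
  have hdK : (d : K) ≠ 0 := by
    have : d ≠ 0 := by omega
    exact_mod_cast this
  have hprim : (critIter (genericMonicInt K d) n).IsPrimitive := by
    intro r hr
    have h1 : r ∣ (d : MvPolynomial (Fin d) K) := by
      rw [← hl, leadingCoeff]
      exact C_dvd_iff_dvd_coeff r _ |>.1 hr _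
    refine isUnit_of_dvd_unit h1 ?_
    rw [← map_natCast (MvPolynomial.C (σ := Fin d) (R := K))]
    exact (isUnit_iff_ne_zero.2 hdK).map _
  have hnd : 0 < (critIter (genericMonicInt K d) n).natDegree := by
    rw [hdeg]
    exact Nat.mul_pos (by omega) (pow_pos (by omega) n)
  have hirr : Irreducible (critIter (genericMonicInt K d) n) := by
    refine irreducible_of_eisenstein_criterion (RingHom.ker_isPrime
      (MvPolynomial.constantCoeff (R := K) (σ := Fin d))) ?_ ?_ ?_
      (coeff_zero_critIter_notMem K hd n) hprim
    · rw [hl, RingHom.mem_ker, map_natCast]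
      exact hdK
    · intro m hm
      rw [RingHom.mem_ker, ← coeff_map, map_critIter, map_constantCoeff_genericMonicInt,
        critIter_X_pow, coeff_C_mul_X_pow, if_neg]
      have hm' : m < (critIter (genericMonicInt K d) n).natDegree := by
        rw [degree_eq_natDegree (critIter_ne_zero (monic_genericMonicInt K d) hd0 n)] at hm
        exact_mod_cast hm
      rw [hdeg, mul_comm] at hm'
      exact hm'.ne
    · exact natDegree_pos_iff_degree_pos.1 hnd
  have := (hprim.irreducible_iff_irreducible_map_fraction_map (K := GenericField K d)).1 hirr
  rwa [map_critIter, map_genericMonicInt] at this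

variable {K}

theorem exists_galMap_eq (hd : 2 ≤ d) {n : ℕ} (x y : critPreimages (genericMonic K d) n) :
    ∃ g : AlgebraicClosure (GenericField K d) ≃ₐ[GenericField K d]
      AlgebraicClosure (GenericField K d), galMap g x = y := by
  have hirr := irreducible_critIter_genericMonic K hd n
  have h1 := minpoly.eq_of_irreducible hirr
    (show aeval (y : AlgebraicClosure (GenericField K d)) _ = 0 from y.2)
  obtain ⟨σ, hσ⟩ := minpoly.exists_algEquiv_of_root (K := GenericField K d)
    (x := (x : AlgebraicClosure (GenericField K d)))
    (y := (y : AlgebraicClosure (GenericField K d))) (Algebra.IsAlgebraic.isAlgebraic _) (by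
      rw [← h1, map_mul, show aeval (x : AlgebraicClosure (GenericField K d))
        (critIter (genericMonic K d) n) = 0 from x.2, zero_mul])
  exact ⟨σ, Subtype.ext hσ⟩

theorem ncard_critPreimages (hd : 2 ≤ d) (n : ℕ) :
    (critPreimages (genericMonic K d) n).ncard = (d - 1) * d ^ n := by
  have hirr := irreducible_critIter_genericMonic K hd n
  have h : critPreimages (genericMonic K d) n =
      (critIter (genericMonic K d) n).rootSet (AlgebraicClosure (GenericField K d)) := by
    ext x
    rw [mem_rootSet]
    exact ⟨fun hx => ⟨hirr.ne_zero, hx⟩, fun hx => hx.2⟩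
  rw [h, ← Nat.card_coe_set_eq, Nat.card_eq_fintype_card,
    card_rootSet_eq_natDegree hirr.separable (IsAlgClosed.splits _),
    natDegree_critIter, natDegree_genericMonic]

/-- By the chain rule `f'` is a factor of the derivative of `f' ∘ f^(n+1)`, and the latter
polynomial is separable. -/
theorem aeval_derivative_ne_zero_of_mem (hd : 2 ≤ d) {n : ℕ}
    (x : critPreimages (genericMonic K d) (n + 1)) :
    aeval (x : AlgebraicClosure (GenericField K d)) (derivative (genericMonic K d)) ≠ 0 := by
  have h := (irreducible_critIter_genericMonic K hd (n + 1)).separable.aeval_derivative_ne_zero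
    (show aeval (x : AlgebraicClosure (GenericField K d)) _ = 0 from x.2)
  rw [derivative_critIter, map_mul, map_prod, Finset.prod_range_succ', mul_assoc] at h
  have h' := left_ne_zero_of_mul (right_ne_zero_of_mul h)
  simpa [critIter] using h'

theorem aeval_mem_critPreimages_iff {F : Type*} [Field F] {f : F[X]} {n : ℕ}
    {x : AlgebraicClosure F} :
    aeval x f ∈ critPreimages f n ↔ x ∈ critPreimages f (n + 1) := by
  change aeval (aeval x f) (critIter f n) = 0 ↔ aeval x (critIter f (n + 1)) = 0
  rw [← eval_map_algebraMap, ← eval_map_algebraMap (critIter f (n + 1)), map_critIter,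
    map_critIter, eval_critIter_succ, eval_map_algebraMap]

/-- Every vertex of the tree above the last level has exactly `d` children. -/
theorem ncard_children (hd : 2 ≤ d) {n : ℕ} (β : critPreimages (genericMonic K d) n) :
    {x : critPreimages (genericMonic K d) (n + 1) |
      aeval (x : AlgebraicClosure (GenericField K d)) (genericMonic K d) = β}.ncard = d := by
  classical
  let L := AlgebraicClosure (GenericField K d)
  let q : L[X] := (genericMonic K d).map (algebraMap _ L) - C (β : L)
  have hqd : q.natDegree = d := by
    rw [natDegree_sub_C, natDegree_map, natDegree_genericMonic]
  have hq0 : q ≠ 0 := fun h => by rw [h, natDegree_zero] at hqd; omega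
  have hmem : ∀ x : L, q.eval x = 0 ↔ aeval x (genericMonic K d) = β := fun x => by
    rw [eval_sub, eval_C, eval_map_algebraMap, sub_eq_zero]
  have hnodup : q.roots.Nodup := by
    rw [Multiset.nodup_iff_count_le_one]
    intro x
    rw [count_roots]
    by_contra hlt
    obtain ⟨h1, h2⟩ := (one_lt_rootMultiplicity_iff_isRoot hq0).1 (not_le.1 hlt)
    have h3 := (hmem x).1 h1
    have h4 : x ∈ critPreimages (genericMonic K d) (n + 1) :=
      aeval_mem_critPreimages_iff.1 (by rw [h3]; exact β.2)
    refine aeval_derivative_ne_zero_of_mem hd ⟨x, h4⟩ ?_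
    rw [IsRoot.def, derivative_sub, derivative_C, sub_zero, derivative_map,
      eval_map_algebraMap] at h2
    exact h2
  have hcard : q.roots.toFinset.card = d := by
    rw [Multiset.toFinset_card_of_nodup hnodup]
    exact (IsAlgClosed.splits q).natDegree_eq_card_roots.symm.trans hqd
  refine Eq.trans ?_ hcard
  rw [← Set.ncard_coe_finset, ← Set.ncard_image_of_injective _ Subtype.val_injective]
  congr 1
  ext x
  simp only [Set.mem_image, Set.mem_ofPred_eq, Finset.mem_coe, Multiset.mem_toFinset,
    mem_roots hq0, IsRoot.def, hmem]
  constructor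
  · rintro ⟨y, hy, rfl⟩
    exact hy
  · intro hx
    exact ⟨⟨x, aeval_mem_critPreimages_iff.1 (by rw [hx]; exact β.2)⟩, hx, rfl⟩

end Irreducible

/-! ### The full symmetric group on the critical points -/

section CriticalPoints

theorem eq_of_derivative_eq {E : Type*} [Field E] [CharZero E] {p q : E[X]}
    (h : derivative p = derivative q) (h0 : p.coeff 0 = q.coeff 0) : p = q := by
  ext j
  rcases j with _ | j
  · exact h0
  · have := congrArg (fun r => coeff r j) h
    simp only [coeff_derivative] at this
    exact mul_right_cancel₀ (by exact_mod_cast Nat.succ_ne_zero j) this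

theorem exists_monic_derivative_eq {E : Type*} [Field E] [CharZero E] {d : ℕ} (hd : d ≠ 0)
    {q : E[X]} (hq : q.natDegree ≤ d - 1) (hc : q.coeff (d - 1) = d) :
    ∃ p : E[X], p.Monic ∧ p.natDegree = d ∧ derivative p = q ∧ p.coeff 0 = 0 := by
  let p : E[X] := ∑ i ∈ Finset.range d, C (q.coeff i / (i + 1)) * X ^ (i + 1)
  have hp : ∀ j, p.coeff (j + 1) = q.coeff j / (j + 1) := by
    intro j
    simp only [p, finsetSum_coeff, coeff_C_mul_X_pow, add_left_inj]
    rw [Finset.sum_ite_eq]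
    split_ifs with h
    · rfl
    · rw [coeff_eq_zero_of_natDegree_lt, zero_div]
      rw [Finset.mem_range] at h
      omega
  have hcast : ∀ j : ℕ, (j + 1 : E) ≠ 0 := fun j => by exact_mod_cast Nat.succ_ne_zero j
  have hdeg : p.natDegree ≤ d := by
    refine natDegree_sum_le_of_forall_le _ _ fun i hi => ?_
    refine (natDegree_C_mul_X_pow_le _ _).trans ?_
    have := Finset.mem_range.1 hi
    omega
  have hcd : p.coeff d = 1 := by
    obtain ⟨e, rfl⟩ := Nat.exists_eq_succ_of_ne_zero hd
    rw [Nat.succ_eq_add_one, hp]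
    simp only [Nat.succ_eq_add_one, Nat.add_sub_cancel, Nat.cast_add, Nat.cast_one] at hc
    rw [hc, div_self (hcast e)]
  refine ⟨p, monic_of_natDegree_le_of_coeff_eq_one d hdeg hcd,
    natDegree_eq_of_le_of_coeff_ne_zero hdeg (by rw [hcd]; exact one_ne_zero), ?_, ?_⟩
  · ext j
    rw [coeff_derivative, hp, div_mul_cancel₀ _ (hcast j)]
  · simp [p, finsetSum_coeff]

/-- Obtained by integration. The constant term is normalized to `0` so that `p` depends only on the
set of critical points, and an automorphism permuting these fixes `p`. -/
theorem exists_monic_critical_points {E : Type*} [Field E] [CharZero E] {d : ℕ} (hd : d ≠ 0)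
    {c : Fin (d - 1) → E} (hc : Function.Injective c) :
    ∃ p : E[X], p.Monic ∧ p.natDegree = d ∧ p.coeff 0 = 0 ∧
      derivative p = C (d : E) * ∏ i, (X - C (c i)) ∧
      (∀ e, (critIter p 0).eval e = 0 ↔ ∃ i, e = c i) ∧
      ∀ i, (derivative (critIter p 0)).eval (c i) ≠ 0 := by
  let r : E[X] := ∏ i, (X - C (c i))
  have hdE : (d : E) ≠ 0 := by exact_mod_cast hd
  have hr : r.Monic := monic_prod_of_monic _ _ fun i _ => monic_X_sub_C _
  have hrd : r.natDegree = d - 1 := by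
    simp only [r]
    rw [natDegree_prod_of_monic _ _ fun i _ => monic_X_sub_C _]
    simp
  obtain ⟨p, hp, hpd, hpq, hp0⟩ := exists_monic_derivative_eq (q := C (d : E) * r) hd
    ((natDegree_C_mul_le _ _).trans hrd.le)
    (by rw [coeff_C_mul, ← hrd, hr.coeff_natDegree, mul_one])
  have hcrit : critIter p 0 = C (d : E) * r := by simp [critIter, hpq]
  refine ⟨p, hp, hpd, hp0, hpq, fun e => ?_, fun i => ?_⟩
  · rw [hcrit]
    simp only [r, eval_mul, eval_C, mul_eq_zero, hdE, false_or, eval_prod,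
      Finset.prod_eq_zero_iff, Finset.mem_univ, true_and, eval_sub, eval_X, sub_eq_zero]
  · have hsep : r.Separable := separable_prod_X_sub_C_iff.2 hc
    have := hsep.eval₂_derivative_ne_zero (RingHom.id E) (x := c i) (by
      rw [eval₂_id, eval_prod]
      exact Finset.prod_eq_zero (Finset.mem_univ i) (by simp))
    rw [eval₂_id] at this
    rw [hcrit, derivative_mul, derivative_C, zero_mul, zero_add, eval_mul, eval_C]
    exact mul_ne_zero hdE this

variable {K : Type*} [Field K] [CharZero K]

/-- The `c i` are simple roots of `p'`, so specialization identifies the critical points of `f` with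
them, and permutations realized by endomorphisms of `E` lift. -/
theorem exists_gal_perm_of_exists_perm {d : ℕ} (hd : d ≠ 0) {E : Type*} [Field E] [CharZero E]
    [IsAlgClosed E] [Algebra K E] {c : Fin (d - 1) → E} (hc : Function.Injective c)
    (hperm : ∀ τ : Equiv.Perm (Fin (d - 1)), ∃ σ : E →ₐ[K] E, ∀ i, σ (c i) = c (τ i))
    (π : Equiv.Perm (critPreimages (genericMonic K d) 0)) :
    ∃ g : AlgebraicClosure (GenericField K d) ≃ₐ[GenericField K d]
      AlgebraicClosure (GenericField K d), ∀ x, galMap g x = π x := by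
  obtain ⟨p, hp, hpd, hp0, hpq, hroot, hsimple⟩ := exists_monic_critical_points hd hc
  obtain ⟨θ, hθ⟩ := exists_isRootSpecialization (K := K) hd hp hpd 0
  have hex : ∀ x, ∃ i, θ x = c i := fun x => (hroot _).1 (hθ.eval_eq_zero x)
  have hθinj : Function.Injective θ := by
    intro x y hxy
    by_contra hne
    have := hθ.derivative_eq_zero x y hne hxy
    obtain ⟨i, hi⟩ := hex x
    rw [hi] at this
    exact hsimple i this
  choose e he using hex
  have hebij : Function.Bijective e := by
    constructor
    · intro x y hxy
      exact hθinj (by rw [he, he, hxy])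
    · intro i
      obtain ⟨x, hx⟩ := hθ.exists_eq (c i) ((hroot _).2 ⟨i, rfl⟩)
      exact ⟨x, hc (by rw [← he, hx])⟩
  let eq := Equiv.ofBijective e hebij
  let τ : Equiv.Perm (Fin (d - 1)) := eq.symm.trans (π.trans eq)
  obtain ⟨σ, hσ⟩ := hperm τ
  have hpσ : p.map (σ : E →+* E) = p := by
    refine eq_of_derivative_eq ?_ ?_
    · rw [derivative_map, hpq, Polynomial.map_mul, map_C, map_natCast, Polynomial.map_prod,
        ← Equiv.prod_comp τ (fun i => X - C (c i))]
      congr 1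
      exact Finset.prod_congr rfl fun i _ => by simp [← hσ]
    · rw [coeff_map, hp0, map_zero]
  obtain ⟨g, hg⟩ := hθ.exists_gal σ hpσ
  refine ⟨g, fun x => hθinj ?_⟩
  rw [hg, he, hσ, he]
  congr 1
  change eq (π (eq.symm (eq x))) = eq (π x)
  rw [Equiv.symm_apply_apply]

/-- The Galois group of the generic polynomial acts on its critical points as the full symmetric
group. -/
theorem exists_gal_perm_critical_points {d : ℕ} (hd : 2 ≤ d)
    (π : Equiv.Perm (critPreimages (genericMonic K d) 0)) :
    ∃ g : AlgebraicClosure (GenericField K d) ≃ₐ[GenericField K d]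
      AlgebraicClosure (GenericField K d), ∀ x, galMap g x = π x := by
  let k := FractionRing (MvPolynomial (Fin (d - 1)) K)
  let E := AlgebraicClosure k
  have : CharZero k := charZero_of_injective_algebraMap
    (IsFractionRing.injective (MvPolynomial (Fin (d - 1)) K) k)
  have : CharZero E := charZero_of_injective_algebraMap (algebraMap k E).injective
  let c : Fin (d - 1) → E := fun i => algebraMap k E
    (algebraMap (MvPolynomial (Fin (d - 1)) K) k (MvPolynomial.X i))
  have hc : Function.Injective c := (algebraMap k E).injective.comp
    ((IsFractionRing.injective (MvPolynomial (Fin (d - 1)) K) k).comp (MvPolynomial.X_injective))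
  refine exists_gal_perm_of_exists_perm (by omega) hc (fun τ => ?_) π
  -- The critical points are independent variables: renaming them realizes any permutation.
  let σ₀ : k ≃ₐ[K] k := IsFractionRing.fieldEquivOfAlgEquiv K k k (MvPolynomial.renameEquiv K τ)
  let σ₁ : E ≃+* E := IsAlgClosure.equivOfEquiv E E σ₀.toRingEquiv
  have hσ₁ : ∀ z : k, σ₁ (algebraMap k E z) = algebraMap k E (σ₀ z) := fun z =>
    IsAlgClosure.equivOfEquiv_algebraMap E E σ₀.toRingEquiv z
  refine ⟨{ σ₁.toRingHom with
    commutes' := fun a => by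
      have := hσ₁ (algebraMap K k a)
      rw [σ₀.commutes, ← IsScalarTower.algebraMap_apply] at this
      exact this }, fun i => ?_⟩
  refine (hσ₁ _).trans ?_
  refine congrArg (algebraMap k E) ?_
  refine (IsFractionRing.fieldEquivOfAlgEquiv_algebraMap K k k _ _).trans ?_
  simp

end CriticalPoints

/-! ### A power series orbit ending at a critical point -/

section Orbit

variable {k : Type*} [Field k]

/-- The polynomial `x ((x - 1)^(e+1) - a)`. -/
def clusterPoly {A : Type*} [CommRing A] (e : ℕ) (a : A) : A[X] :=
  X * ((X - 1) ^ (e + 1) - C a)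

theorem map_clusterPoly {A B : Type*} [CommRing A] [CommRing B] (φ : A →+* B) (e : ℕ) (a : A) :
    (clusterPoly e a).map φ = clusterPoly e (φ a) := by
  simp [clusterPoly]

/-- This isolates the critical point `1 / (e + 2)` at `a = 0`. The orbit argument uses that it is
nondegenerate and that its critical value is nonzero. -/
theorem derivative_clusterPoly_zero (e : ℕ) :
    derivative (clusterPoly e (0 : k)) = (X - 1) ^ e * (C (e + 2 : k) * X - 1) := by
  simp only [clusterPoly, C_0, sub_zero, derivative_mul, derivative_X, derivative_pow,
    derivative_sub, derivative_one, map_add, Nat.add_sub_cancel, map_natCast, Nat.cast_add,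
    Nat.cast_one, map_one, C_ofNat]
  ring

variable [CharZero k]

theorem one_div_add_two_ne (e : ℕ) : (1 / (e + 2) : k) - 1 ≠ 0 := by
  have h2 : (e + 2 : k) ≠ 0 := by exact_mod_cast (show e + 2 ≠ 0 by omega)
  have h1 : (e + 1 : k) ≠ 0 := by exact_mod_cast (show e + 1 ≠ 0 by omega)
  intro h
  field_simp at h
  apply h1
  linear_combination -h

theorem eval_derivative_clusterPoly (e : ℕ) :
    (derivative (clusterPoly e (0 : k))).eval (1 / (e + 2) : k) = 0 := by
  have h2 : (e + 2 : k) ≠ 0 := by exact_mod_cast (show e + 2 ≠ 0 by omega)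
  rw [derivative_clusterPoly_zero]
  simp [h2]

theorem eval_second_derivative_clusterPoly (e : ℕ) :
    (derivative (derivative (clusterPoly e (0 : k)))).eval (1 / (e + 2) : k) ≠ 0 := by
  have h2 : (e + 2 : k) ≠ 0 := by exact_mod_cast (show e + 2 ≠ 0 by omega)
  have h : (derivative (derivative (clusterPoly e (0 : k)))).eval (1 / (e + 2) : k) =
      ((1 / (e + 2) : k) - 1) ^ e * (e + 2) := by
    rw [derivative_clusterPoly_zero, derivative_mul, eval_add, eval_mul, eval_mul]
    simp [h2]
  rw [h]
  exact mul_ne_zero (pow_ne_zero _ (one_div_add_two_ne e)) h2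

theorem eval_clusterPoly_ne_zero (e : ℕ) : (clusterPoly e (0 : k)).eval (1 / (e + 2) : k) ≠ 0 := by
  have h2 : (e + 2 : k) ≠ 0 := by exact_mod_cast (show e + 2 ≠ 0 by omega)
  simp only [clusterPoly, eval_mul, eval_X, C_0, sub_zero, eval_pow, eval_sub, eval_one]
  exact mul_ne_zero (one_div_ne_zero h2) (pow_ne_zero _ (one_div_add_two_ne e))

/-- If a polynomial over a domain takes the same value at a critical point `c` and another point
with the same image under `ψ`, then the image of `c` is a degenerate critical point. -/
theorem second_derivative_eq_zero_of_map_eq {A B : Type*} [CommRing A] [IsDomain A] [CommRing B]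
    (ψ : A →+* B) {q : A[X]} {x c : A} (hx : q.eval x = q.eval c) (hc : (derivative q).eval c = 0)
    (hxc : x ≠ c) (h : ψ x = ψ c) : (derivative (derivative (q.map ψ))).eval (ψ c) = 0 := by
  obtain ⟨r, hr⟩ := dvd_iff_isRoot.2 (show IsRoot (q - C (q.eval c)) c by simp)
  have hrc : r.eval c = 0 := by
    have := congrArg (fun s => (derivative s).eval c) hr
    simpa [hc] using this.symm
  obtain ⟨s, rfl⟩ := dvd_iff_isRoot.2 (show IsRoot _ c from hrc)
  have hsx : s.eval x = 0 := by
    have := congrArg (fun s => s.eval x) hr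
    simpa [hx, sub_eq_zero, hxc] using this.symm
  obtain ⟨t, rfl⟩ := dvd_iff_isRoot.2 (show IsRoot _ x from hsx)
  rw [show q = C (q.eval c) + (q - C (q.eval c)) by ring, hr]
  simp [h]

variable (k) in
/-- Orbits in the power series ring that reach the critical point of `clusterPoly` close to
`1 / (e + 2)` after exactly `n` steps. -/
theorem exists_orbit_clusterPoly (e n : ℕ) : ∃ z : ℕ → PowerSeries k,
    (∀ j, z (j + 1) = PowerSeries.X ^ (e + 1) *
      (clusterPoly e (PowerSeries.X : PowerSeries k)).eval (z j) + z 0) ∧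
    (derivative (clusterPoly e (PowerSeries.X : PowerSeries k))).eval (z n) = 0 ∧
    (derivative (derivative (clusterPoly e (PowerSeries.X : PowerSeries k)))).eval (z n) ≠ 0 ∧
    ∀ j < n, (derivative (clusterPoly e (PowerSeries.X : PowerSeries k))).eval (z j) ≠ 0 := by
  let a : PowerSeries k := PowerSeries.X
  let cc : PowerSeries k →+* k := PowerSeries.constantCoeff
  have hcca : cc a = 0 := PowerSeries.constantCoeff_X
  have ha0 : a ≠ 0 := PowerSeries.X_ne_zero
  let q := clusterPoly e a
  have hq : q.map cc = clusterPoly e 0 := by rw [map_clusterPoly, hcca]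
  -- `Z j` is the `j`-th orbit point as a polynomial in the unknown starting point. Modulo `a` it is
  -- the identity, so Hensel's lemma solves `q' (Z n) = 0` near `1 / (e + 2)`.
  let Z : ℕ → (PowerSeries k)[X] := fun j => (fun P => C (a ^ (e + 1)) * q.comp P + X)^[j] X
  have hZ : ∀ j, Z (j + 1) = C (a ^ (e + 1)) * q.comp (Z j) + X := fun j =>
    Function.iterate_succ_apply' _ _ _
  have hZmap : ∀ j, (Z j).map cc = X := by
    intro j
    cases j with
    | zero => exact map_X _
    | succ j => rw [hZ]; simp [hcca]
  obtain ⟨τ, hτ, hτ0⟩ := exists_root_powerSeries_of_simple_root ((derivative q).comp (Z n))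
    (1 / (e + 2))
    (by
      rw [Polynomial.map_comp]
      erw [hZmap]
      rw [comp_X, ← derivative_map]
      erw [hq]
      exact eval_derivative_clusterPoly e)
    (by
      rw [Polynomial.map_comp]
      erw [hZmap]
      rw [comp_X, ← derivative_map]
      erw [hq]
      exact eval_second_derivative_clusterPoly e)
  let z : ℕ → PowerSeries k := fun j => (Z j).eval τ
  have hz0 : z 0 = τ := eval_X
  have hz : ∀ j, z (j + 1) = a ^ (e + 1) * q.eval (z j) + z 0 := by
    intro j
    simp only [z]
    rw [hZ, show Z 0 = X from rfl]
    simp [eval_comp]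
  have hccz : ∀ j, cc (z j) = 1 / (e + 2) := by
    intro j
    cases j with
    | zero => rw [hz0]; exact hτ0
    | succ j => rw [hz, hz0, map_add, map_mul, map_pow, hcca, zero_pow (Nat.succ_ne_zero e),
        zero_mul, zero_add]; exact hτ0
  have hzn : (derivative q).eval (z n) = 0 := by rw [← eval_comp]; exact hτ
  have hq2 : ∀ j, (derivative (derivative q)).eval (z j) ≠ 0 := by
    intro j h
    have := congrArg cc h
    rw [← eval_map_apply, ← derivative_map, ← derivative_map, hq, hccz, map_zero] at this
    exact eval_second_derivative_clusterPoly e this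
  -- All orbit points have the same reduction, a nondegenerate critical point, above which `q` has
  -- at most one critical point.
  have huniq : ∀ i j, (derivative q).eval (z i) = 0 → (derivative q).eval (z j) = 0 →
      z i = z j := by
    intro i j hi hj
    by_contra hne
    have := derivative_eval_eq_zero_of_map_eq cc hi hj hne (by rw [hccz, hccz])
    rw [← derivative_map, hq, hccz] at this
    exact eval_second_derivative_clusterPoly e this
  -- No orbit point is both fixed and critical. Such a point shares its value under `q` with its
  -- predecessor; were they distinct, their collision modulo `a` would be too degenerate. So the
  -- orbit is constant back to `z 0`, and `q (z 0) = 0` contradicts the nonzero critical value.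
  have hfix : ∀ j, z (j + 1) = z j → (derivative q).eval (z j) ≠ 0 := by
    intro j
    induction j with
    | zero =>
      intro h _
      rw [hz, add_eq_right, mul_eq_zero] at h
      have h1 := congrArg cc (h.resolve_left (pow_ne_zero _ ha0))
      rw [← eval_map_apply, hq, hccz, map_zero] at h1
      exact eval_clusterPoly_ne_zero e h1
    | succ j ih =>
      intro h hc
      have h1 : q.eval (z j) = q.eval (z (j + 1)) := by
        rw [hz (j + 1)] at h
        conv_rhs at h => rw [hz j]
        exact (mul_left_cancel₀ (pow_ne_zero (e + 1) ha0) (add_right_cancel h)).symm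
      have h2 : z j = z (j + 1) := by
        by_contra hne
        have := second_derivative_eq_zero_of_map_eq cc h1 hc hne (by rw [hccz, hccz])
        rw [hq, hccz] at this
        exact eval_second_derivative_clusterPoly e this
      exact ih h2.symm (by rw [h2]; exact hc)
  -- The map is an `a`-adic contraction, so an orbit can return to `z j` only if `z j` is already
  -- fixed. An earlier critical point would equal `z n`, hence be fixed, which `hfix` excludes.
  have hdvd : ∀ j, a * (z (j + 1) - z j) ∣ z (j + 2) - z (j + 1) := by
    intro j
    obtain ⟨w, hw⟩ := sub_dvd_eval_sub (z (j + 1)) (z j) q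
    refine ⟨a ^ e * w, ?_⟩
    linear_combination hz (j + 1) - hz j + a ^ (e + 1) * hw
  have hdvd' : ∀ j m, a * (z (j + 1) - z j) ∣ z (j + 1 + m) - z (j + 1) := by
    have hstep : ∀ j m, a * (z (j + 1) - z j) ∣ z (j + m + 2) - z (j + m + 1) := by
      intro j m
      induction m with
      | zero => exact hdvd j
      | succ m ih => exact ih.trans ((Dvd.intro_left a rfl).trans (hdvd (j + m + 1)))
    intro j m
    induction m with
    | zero => simp
    | succ m ih =>
      have := dvd_add (hstep j m) ih
      rwa [show j + m + 1 = j + 1 + m by ring, show j + m + 2 = j + 1 + (m + 1) by ring,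
        sub_add_sub_cancel] at this
  refine ⟨z, hz, hzn, hq2 n, fun j hj hcj => ?_⟩
  have hjn : z j = z n := huniq j n hcj hzn
  refine hfix j ?_ hcj
  obtain ⟨m, rfl⟩ : ∃ m, n = j + 1 + m := ⟨n - (j + 1), by omega⟩
  obtain ⟨w, hw⟩ := hdvd' j m
  rw [← hjn] at hw
  have h1 : (z (j + 1) - z j) * (1 + a * w) = 0 := by linear_combination -hw
  rcases mul_eq_zero.1 h1 with h | h
  · exact sub_eq_zero.1 h
  · have := congrArg cc h
    rw [map_add, map_mul, hcca, zero_mul, add_zero, map_one, map_zero] at this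
    exact absurd this one_ne_zero

end Orbit

/-! ### The stabilizer of a leaf is transitive on its siblings -/

section Siblings

/-- The polynomial `x ((x - a)^(e+1) - a^(e+2)) + t`. -/
def siblingPoly {A : Type*} [CommRing A] (e : ℕ) (a t : A) : A[X] :=
  X * ((X - C a) ^ (e + 1) - C (a ^ (e + 2))) + C t

section Ring

variable {A B : Type*} [CommRing A] [CommRing B]

theorem map_siblingPoly (φ : A →+* B) (e : ℕ) (a t : A) :
    (siblingPoly e a t).map φ = siblingPoly e (φ a) (φ t) := by
  simp [siblingPoly]

/-- In the coordinate `x = a z` the polynomial becomes `clusterPoly`, whose coefficients reduce well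
modulo `a`. With `t = a z₀` the map is `z ↦ a^(e+1) * clusterPoly z + z₀`. -/
theorem siblingPoly_comp (e : ℕ) (a t : A) :
    (siblingPoly e a t).comp (C a * X) = C (a ^ (e + 2)) * clusterPoly e a + C t := by
  have h : (C a * X - C a : A[X]) = C a * (X - 1) := by ring
  simp only [siblingPoly, clusterPoly, add_comp, mul_comp, X_comp, sub_comp, pow_comp, C_comp, h,
    mul_pow, map_pow]
  ring

theorem eval_siblingPoly (e : ℕ) (a t z : A) :
    (siblingPoly e a t).eval (a * z) = a ^ (e + 2) * (clusterPoly e a).eval z + t := by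
  have := congrArg (fun r => r.eval z) (siblingPoly_comp e a t)
  simpa [eval_comp] using this

theorem eval_derivative_siblingPoly (e : ℕ) (a t z : A) :
    a * (derivative (siblingPoly e a t)).eval (a * z) =
      a ^ (e + 2) * (derivative (clusterPoly e a)).eval z := by
  have := congrArg (fun r => (derivative r).eval z) (siblingPoly_comp e a t)
  simpa [eval_comp, derivative_comp, derivative_pow] using this

theorem eval_second_derivative_siblingPoly (e : ℕ) (a t z : A) :
    a * (a * (derivative (derivative (siblingPoly e a t))).eval (a * z)) =
      a ^ (e + 2) * (derivative (derivative (clusterPoly e a))).eval z := by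
  have := congrArg (fun r => (derivative (derivative r)).eval z) (siblingPoly_comp e a t)
  simpa [eval_comp, derivative_comp, derivative_mul, derivative_pow] using this

theorem eval_zero_siblingPoly (e : ℕ) (a t : A) : (siblingPoly e a t).eval 0 = t := by
  simp [siblingPoly]

theorem eval_zero_derivative_siblingPoly (e : ℕ) (a t : A) :
    (derivative (siblingPoly e a t)).eval 0 = (-a) ^ (e + 1) - a ^ (e + 2) := by
  simp [siblingPoly, derivative_mul]

theorem iterate_siblingPoly {e : ℕ} {a : A} {z : ℕ → A}
    (hz : ∀ j, z (j + 1) = a ^ (e + 1) * (clusterPoly e a).eval (z j) + z 0) (j : ℕ) :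
    (fun y => (siblingPoly e a (a * z 0)).eval y)^[j + 1] 0 = a * z j := by
  induction j with
  | zero => exact eval_zero_siblingPoly e a _
  | succ j ih =>
    rw [Function.iterate_succ_apply', ih, eval_siblingPoly, hz j]
    ring

theorem monic_siblingPoly [Nontrivial A] (e : ℕ) (a t : A) :
    (siblingPoly e a t).Monic ∧ (siblingPoly e a t).natDegree = e + 2 := by
  have h1 : ((X - C a) ^ (e + 1) : A[X]).Monic := (monic_X_sub_C a).pow _
  have h1d : ((X - C a) ^ (e + 1) : A[X]).natDegree = e + 1 := by
    rw [(monic_X_sub_C a).natDegree_pow, natDegree_X_sub_C, mul_one]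
  have h2 : ((X - C a) ^ (e + 1) - C (a ^ (e + 2)) : A[X]).Monic := by
    refine h1.sub_of_left (degree_C_le.trans_lt ?_)
    rw [degree_eq_natDegree h1.ne_zero, h1d]
    exact_mod_cast Nat.succ_pos e
  have h2d : ((X - C a) ^ (e + 1) - C (a ^ (e + 2)) : A[X]).natDegree = e + 1 := by
    rw [natDegree_sub_C, h1d]
  have h3 : (X * ((X - C a) ^ (e + 1) - C (a ^ (e + 2))) : A[X]).Monic := monic_X.mul h2
  have h3d : (X * ((X - C a) ^ (e + 1) - C (a ^ (e + 2))) : A[X]).natDegree = e + 2 := by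
    rw [monic_X.natDegree_mul h2, natDegree_X, h2d]
    ring
  refine ⟨h3.add_of_left (degree_C_le.trans_lt ?_), by rw [siblingPoly, natDegree_add_C, h3d]⟩
  rw [degree_eq_natDegree h3.ne_zero, h3d]
  exact_mod_cast Nat.succ_pos _

end Ring

variable (K : Type*) [Field K]

theorem irreducible_X_pow_sub_C_powerSeries (e : ℕ) :
    Irreducible (X ^ (e + 1) - C (algebraMap (PowerSeries K) (FractionRing (PowerSeries K))
      PowerSeries.X)) := by
  have hm : (X ^ (e + 1) - C (PowerSeries.X : PowerSeries K)).Monic :=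
    monic_X_pow_sub_C _ (Nat.succ_ne_zero e)
  have hnd : (X ^ (e + 1) - C (PowerSeries.X : PowerSeries K)).natDegree = e + 1 :=
    natDegree_X_pow_sub_C
  have hp : Prime (PowerSeries.X : PowerSeries K) := PowerSeries.X_prime
  have hirr : Irreducible (X ^ (e + 1) - C (PowerSeries.X : PowerSeries K)) := by
    refine irreducible_of_eisenstein_criterion
      (P := Ideal.span {(PowerSeries.X : PowerSeries K)})
      ((Ideal.span_singleton_prime hp.ne_zero).2 hp) ?_ ?_ ?_ ?_ hm.isPrimitive
    · rw [hm.leadingCoeff, Ideal.mem_span_singleton]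
      exact fun h => hp.not_isUnit (isUnit_of_dvd_one h)
    · intro m hmd
      rw [degree_eq_natDegree hm.ne_zero, hnd] at hmd
      have hmd' : m < e + 1 := by exact_mod_cast hmd
      rw [Ideal.mem_span_singleton, coeff_sub, coeff_X_pow, if_neg hmd'.ne, coeff_C, zero_sub,
        dvd_neg]
      split_ifs
      · exact dvd_rfl
      · exact dvd_zero _
    · rw [degree_eq_natDegree hm.ne_zero, hnd]
      exact_mod_cast Nat.succ_pos e
    · rw [Ideal.span_singleton_pow, Ideal.mem_span_singleton, coeff_sub, coeff_X_pow,
        if_neg (Nat.succ_ne_zero e).symm, coeff_C_zero, zero_sub, dvd_neg]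
      intro h
      have h2 : (PowerSeries.X : PowerSeries K) * PowerSeries.X ∣ PowerSeries.X * 1 := by
        rwa [← pow_two, mul_one]
      exact hp.not_isUnit (isUnit_of_dvd_one ((mul_dvd_mul_iff_left hp.ne_zero).1 h2))
  have := (hm.irreducible_iff_irreducible_map_fraction_map
    (K := FractionRing (PowerSeries K))).1 hirr
  simpa using this

variable [CharZero K]

/-- With `t = a * z 0` the orbit of `0` is `0, a * z 0, a * z 1, …`. It first meets the critical
locus at `a * z n`, which is nondegenerate, so the chain rule gives a simple root. -/
theorem exists_root_critIter_siblingPoly (e n : ℕ) : ∃ t : PowerSeries K,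
    (critIter (siblingPoly e PowerSeries.X t) (n + 1)).eval 0 = 0 ∧
      (derivative (critIter (siblingPoly e PowerSeries.X t) (n + 1))).eval 0 ≠ 0 := by
  obtain ⟨z, hz, hzn, hzn', hzj⟩ := exists_orbit_clusterPoly K e n
  have ha : (PowerSeries.X : PowerSeries K) ≠ 0 := PowerSeries.X_ne_zero
  refine ⟨PowerSeries.X * z 0, ?_, ?_⟩
  · rw [eval_critIter, iterate_siblingPoly hz]
    have := eval_derivative_siblingPoly e PowerSeries.X (PowerSeries.X * z 0) (z n)
    rw [hzn, mul_zero] at this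
    exact (mul_eq_zero.1 this).resolve_left ha
  · rw [eval_derivative_critIter, iterate_siblingPoly hz]
    refine mul_ne_zero (Finset.prod_ne_zero_iff.2 fun j hj => ?_) fun h => ?_
    · rw [eval_critIter]
      rcases j with _ | j
      · rw [Function.iterate_zero_apply, eval_zero_derivative_siblingPoly]
        intro h
        have h1 : (PowerSeries.X : PowerSeries K) ^ (e + 1) * ((-1) ^ (e + 1) - PowerSeries.X)
            = 0 := by
          rw [← h, neg_pow (PowerSeries.X : PowerSeries K)]
          ring
        have h2 := congrArg (PowerSeries.constantCoeff (R := K))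
          ((mul_eq_zero.1 h1).resolve_left (pow_ne_zero _ ha))
        simp at h2
      · rw [iterate_siblingPoly hz]
        intro h
        have := eval_derivative_siblingPoly e PowerSeries.X (PowerSeries.X * z 0) (z j)
        rw [h, mul_zero] at this
        exact hzj j (by simpa using hj)
          ((mul_eq_zero.1 this.symm).resolve_left (pow_ne_zero _ ha))
    · have := eval_second_derivative_siblingPoly e PowerSeries.X (PowerSeries.X * z 0) (z n)
      rw [h, mul_zero, mul_zero] at this
      exact hzn' ((mul_eq_zero.1 this.symm).resolve_left (pow_ne_zero _ ha))

variable {K}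

/-- Siblings that specialize to distinct conjugate points are conjugate under the stabilizer of a
root that specializes to a simple fixed one. -/
theorem exists_gal_fix_of_specialization {e n : ℕ} {k E : Type*} [Field k] [Field E] [CharZero E]
    [IsAlgClosed E] [Algebra k E] [Normal k E] [Algebra K k]
    [Algebra K E] [IsScalarTower K k E] {a t : k} (ha : a ≠ 0)
    (hirr : Irreducible (X ^ (e + 1) - C a))
    (h0 : (critIter (siblingPoly e (algebraMap k E a) (algebraMap k E t)) (n + 1)).eval 0 = 0)
    (h1 : (derivative
      (critIter (siblingPoly e (algebraMap k E a) (algebraMap k E t)) (n + 1))).eval 0 ≠ 0) :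
    ∃ x : critPreimages (genericMonic K (e + 2)) (n + 1),
    ∀ y y' : critPreimages (genericMonic K (e + 2)) (n + 1), y ≠ x → y' ≠ x →
      aeval (y : AlgebraicClosure (GenericField K (e + 2))) (genericMonic K (e + 2)) =
        aeval (x : AlgebraicClosure (GenericField K (e + 2))) (genericMonic K (e + 2)) →
      aeval (y' : AlgebraicClosure (GenericField K (e + 2))) (genericMonic K (e + 2)) =
        aeval (x : AlgebraicClosure (GenericField K (e + 2))) (genericMonic K (e + 2)) →
      ∃ g : AlgebraicClosure (GenericField K (e + 2)) ≃ₐ[GenericField K (e + 2)]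
        AlgebraicClosure (GenericField K (e + 2)), galMap g x = x ∧ galMap g y = y' := by
  set α := algebraMap k E a with hα
  set p : E[X] := siblingPoly e α (algebraMap k E t) with hp
  have hα0 : α ≠ 0 := (_root_.map_ne_zero _).2 ha
  obtain ⟨θ, hθ⟩ := exists_isRootSpecialization (K := K) (by omega)
    (monic_siblingPoly e α (algebraMap k E t)).1 (monic_siblingPoly e α (algebraMap k E t)).2
    (n + 1)
  obtain ⟨x, hx⟩ := hθ.exists_eq 0 h0
  have huniq : ∀ y, θ y = 0 → y = x := by
    intro y hy
    by_contra hne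
    have := hθ.derivative_eq_zero y x hne (by rw [hy, hx])
    rw [hy] at this
    exact h1 this
  have hsib : ∀ y : critPreimages (genericMonic K (e + 2)) (n + 1), y ≠ x →
      aeval (y : AlgebraicClosure (GenericField K (e + 2))) (genericMonic K (e + 2)) =
        aeval (x : AlgebraicClosure (GenericField K (e + 2))) (genericMonic K (e + 2)) →
      ∃ w : E, w ^ (e + 1) = α ∧ θ y = α + α * w := by
    intro y hy hyx
    have h2 := hθ.eval_eq y x hyx
    rw [hx, eval_zero_siblingPoly] at h2
    have h3 : θ y * ((θ y - α) ^ (e + 1) - α ^ (e + 2)) = 0 := by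
      simpa [siblingPoly] using h2
    have h4 := (mul_eq_zero.1 h3).resolve_left fun h => hy (huniq y h)
    -- A sibling other than `0` satisfies `(θ y - α)^(e+1) = α^(e+2)`; division by `α^(e+1)` leaves
    -- an `(e+1)`-th root of `α`.
    refine ⟨(θ y - α) / α, ?_, by field_simp; ring⟩
    rw [div_pow, sub_eq_zero.1 h4, pow_succ α (e + 1), mul_div_cancel_left₀ _ (pow_ne_zero _ hα0)]
  refine ⟨x, fun y y' hy hy' hyx hy'x => ?_⟩
  obtain ⟨w, hw, hyw⟩ := hsib y hy hyx
  obtain ⟨w', hw', hyw'⟩ := hsib y' hy' hy'x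
  have hmin : ∀ v : E, v ^ (e + 1) = α → minpoly k v = X ^ (e + 1) - C a := by
    intro v hv
    exact (minpoly.eq_of_irreducible_of_monic hirr (by simp [hv, hα])
      (monic_X_pow_sub_C _ (Nat.succ_ne_zero e))).symm
  obtain ⟨σ, hσ⟩ := minpoly.exists_algEquiv_of_root (K := k) (x := w) (y := w')
    (Algebra.IsAlgebraic.isAlgebraic _) (by rw [hmin w' hw']; simp [hw, hα])
  have hσp : p.map (σ.toAlgHom.restrictScalars K : E →+* E) = p := by
    rw [hp, map_siblingPoly]
    congr 1
    · exact σ.commutes a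
    · exact σ.commutes t
  obtain ⟨g, hg⟩ := hθ.exists_gal (σ.toAlgHom.restrictScalars K) hσp
  have hgx : galMap g x = x := huniq _ (by rw [hg, hx, map_zero])
  refine ⟨g, hgx, ?_⟩
  -- `galMap g y` and `y'` are siblings with the same specialization. If distinct, they would make
  -- it a critical point of `p`, but the derivative there is `θ y' * (e + 1) * (α w')^e ≠ 0`.
  by_contra hne
  have hgy : θ (galMap g y) = θ y' := by
    rw [hg, hyw, hyw', ← hσ]
    change σ (α + α * w) = _
    rw [map_add, map_mul, show σ α = α from σ.commutes a]
  have hgs : aeval (galMap g y : AlgebraicClosure (GenericField K (e + 2)))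
      (genericMonic K (e + 2)) =
      aeval (y' : AlgebraicClosure (GenericField K (e + 2))) (genericMonic K (e + 2)) := by
    rw [hy'x, ← hgx]
    change aeval (g y) _ = aeval (g x) _
    rw [aeval_algHom_apply, aeval_algHom_apply, hyx]
  have h5 := hθ.derivative_eq_zero_of_sibling _ _ hgs hne hgy
  have hw0 : w' ≠ 0 := fun h => by
    rw [h, zero_pow (Nat.succ_ne_zero e)] at hw'
    exact hα0 hw'.symm
  have h6 : (α * w') ^ (e + 1) = α ^ (e + 2) := by rw [mul_pow, hw', pow_succ α (e + 1)]
  have hy'0 : θ y' ≠ 0 := fun h => hy' (huniq _ h)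
  have h7 : θ y' * ((e + 1) * (α * w') ^ e) = 0 := by
    rw [hgy, hyw'] at h5
    rw [hyw']
    have h8 : α + α * w' - α = α * w' := by ring
    simpa [siblingPoly, derivative_mul, derivative_pow, h6, h8] using h5
  refine mul_ne_zero hy'0 (mul_ne_zero ?_ (pow_ne_zero _ (mul_ne_zero hα0 hw0))) h7
  exact_mod_cast Nat.succ_ne_zero e

/-- The stabilizer of a vertex of the tree acts transitively on its siblings. -/
theorem exists_gal_fix_map_sibling {d : ℕ} (hd : 2 ≤ d) {n : ℕ}
    (x y y' : critPreimages (genericMonic K d) (n + 1)) (hy : y ≠ x) (hy' : y' ≠ x)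
    (hyx : aeval (y : AlgebraicClosure (GenericField K d)) (genericMonic K d) =
      aeval (x : AlgebraicClosure (GenericField K d)) (genericMonic K d))
    (hy'x : aeval (y' : AlgebraicClosure (GenericField K d)) (genericMonic K d) =
      aeval (x : AlgebraicClosure (GenericField K d)) (genericMonic K d)) :
    ∃ g : AlgebraicClosure (GenericField K d) ≃ₐ[GenericField K d]
      AlgebraicClosure (GenericField K d), galMap g x = x ∧ galMap g y = y' := by
  obtain ⟨e, rfl⟩ : ∃ e, d = e + 2 := ⟨d - 2, by omega⟩
  let k := FractionRing (PowerSeries K)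
  let E := AlgebraicClosure k
  have : CharZero (PowerSeries K) := charZero_of_injective_algebraMap
    (PowerSeries.C_injective (R := K))
  have : CharZero k := charZero_of_injective_algebraMap
    (IsFractionRing.injective (PowerSeries K) k)
  have : CharZero E := charZero_of_injective_algebraMap (algebraMap k E).injective
  obtain ⟨t, ht0, ht1⟩ := exists_root_critIter_siblingPoly K e n
  let j : PowerSeries K →+* E := (algebraMap k E).comp (algebraMap _ k)
  have hj : Function.Injective j := (algebraMap k E).injective.comp
    (IsFractionRing.injective (PowerSeries K) k)
  obtain ⟨x₀, hx₀⟩ := exists_gal_fix_of_specialization (K := K) (e := e) (n := n) (k := k) (E := E)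
    (a := algebraMap _ k PowerSeries.X) (t := algebraMap _ k t)
    ((map_ne_zero_iff _ (IsFractionRing.injective (PowerSeries K) k)).2 PowerSeries.X_ne_zero)
    (irreducible_X_pow_sub_C_powerSeries K e)
    (by
      have := congrArg j ht0
      rw [← eval_map_apply, map_critIter, map_siblingPoly, map_zero] at this
      exact this)
    (by
      intro h
      apply ht1
      apply hj
      rw [← eval_map_apply, ← derivative_map, map_critIter, map_siblingPoly, map_zero]
      exact h)
  -- The specialization controls the siblings of one leaf only; transitivity on leaves carries the
  -- result to `x` by conjugation.
  obtain ⟨h, hh⟩ := exists_galMap_eq hd x₀ x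
  have hinv : ∀ v : critPreimages (genericMonic K (e + 2)) (n + 1),
      galMap h (galMap h.symm v) = v := fun v => Subtype.ext (h.apply_symm_apply _)
  have hsib : ∀ v : critPreimages (genericMonic K (e + 2)) (n + 1),
      aeval (v : AlgebraicClosure (GenericField K (e + 2))) (genericMonic K (e + 2)) =
      aeval (x : AlgebraicClosure (GenericField K (e + 2))) (genericMonic K (e + 2)) →
      aeval (galMap h.symm v : AlgebraicClosure (GenericField K (e + 2)))
        (genericMonic K (e + 2)) =
      aeval (x₀ : AlgebraicClosure (GenericField K (e + 2))) (genericMonic K (e + 2)) := by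
    intro v hv
    apply h.injective
    rw [← aeval_algHom_apply, ← aeval_algHom_apply]
    change aeval (galMap h (galMap h.symm v) : AlgebraicClosure (GenericField K (e + 2))) _ =
      aeval (galMap h x₀ : AlgebraicClosure (GenericField K (e + 2))) _
    rw [hinv, hh, hv]
  have hne : ∀ v, v ≠ x → galMap h.symm v ≠ x₀ := by
    rintro v hv rfl
    exact hv (by rw [← hh, hinv])
  obtain ⟨g, hgx, hgy⟩ := hx₀ _ _ (hne y hy) (hne y' hy') (hsib y hyx) (hsib y' hy'x)
  refine ⟨h * g * h.symm, ?_, ?_⟩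
  · change galMap h (galMap g (galMap h.symm x)) = x
    have : galMap h.symm x = x₀ := by
      rw [← hh]
      exact Subtype.ext (h.symm_apply_apply _)
    rw [this, hgx, hh]
  · change galMap h (galMap g (galMap h.symm y)) = y'
    rw [hgy, hinv]

end Siblings

/-! ### Splitting of a double root into a conjugate pair -/

section DoubleRoot

variable {L : Type*} [Field L]

/-- A polynomial over a power series ring with no roots in it, of degree two and with constant
leading coefficient, is irreducible over the fraction field. -/
theorem irreducible_map_of_natDegree_two {Q : (PowerSeries L)[X]} (hQ : Q.natDegree = 2)
    (hlead : IsUnit Q.leadingCoeff) (hroot : ∀ r, Q.eval r ≠ 0) (k : Type*) [Field k]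
    [Algebra (PowerSeries L) k] [IsFractionRing (PowerSeries L) k] :
    Irreducible (Q.map (algebraMap (PowerSeries L) k)) := by
  have hinj := IsFractionRing.injective (PowerSeries L) k
  have hdeg : (Q.map (algebraMap (PowerSeries L) k)).natDegree = 2 := by
    rw [natDegree_map_eq_of_injective hinj, hQ]
  refine irreducible_of_degree_le_three_of_not_isRoot (by rw [hdeg]; simp) fun x hx => ?_
  obtain ⟨u, hu⟩ := hlead
  have hint : IsIntegral (PowerSeries L) x := by
    refine ⟨C (↑u⁻¹ : PowerSeries L) * Q, ?_, ?_⟩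
    · rw [Monic, leadingCoeff_mul, leadingCoeff_C, ← hu, Units.inv_mul]
    · rw [eval₂_mul, ← eval_map (algebraMap (PowerSeries L) k) (p := Q), hx.eq_zero, mul_zero]
  obtain ⟨r, rfl⟩ := IsIntegrallyClosed.isIntegral_iff.1 hint
  refine hroot r (hinj ?_)
  rw [← eval_map_apply, hx.eq_zero, map_zero]

variable [CharZero L] [IsAlgClosed L]

/-- The number of roots of a polynomial whose only multiple root is a double root at zero. -/
theorem card_nonzero_roots_add_two [DecidableEq L] {Ψ v : L[X]} (hΨ : Ψ ≠ 0) (h0 : Ψ.eval 0 = 0)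
    (hv : derivative Ψ = X * v) (hv0 : v.eval 0 ≠ 0)
    (hsimple : ∀ x ≠ 0, Ψ.eval x = 0 → (derivative Ψ).eval x ≠ 0) :
    (Ψ.roots.toFinset.erase 0).card + 2 = Ψ.natDegree := by
  have hvne : v ≠ 0 := fun h => hv0 (by rw [h, eval_zero])
  -- In characteristic zero differentiation lowers the multiplicity of a root by exactly one, and `X
  -- * v` vanishes to order one at `0`.
  have hmul0 : Ψ.rootMultiplicity 0 = 2 := by
    have h1 := derivative_rootMultiplicity_of_root (show Ψ.IsRoot 0 from h0)
    have h2 : (derivative Ψ).rootMultiplicity 0 = 1 := by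
      rw [hv, rootMultiplicity_mul (mul_ne_zero X_ne_zero hvne),
        rootMultiplicity_eq_zero (show ¬ v.IsRoot 0 from hv0)]
      simpa using rootMultiplicity_X_sub_C_self (x := (0 : L))
    have h3 := (rootMultiplicity_pos hΨ).2 (show Ψ.IsRoot 0 from h0)
    omega
  have hmul : ∀ x ≠ 0, Ψ.eval x = 0 → Ψ.rootMultiplicity x = 1 := by
    intro x hx hx0
    have h1 := derivative_rootMultiplicity_of_root (show Ψ.IsRoot x from hx0)
    have h2 := rootMultiplicity_eq_zero (show ¬ (derivative Ψ).IsRoot x from hsimple x hx hx0)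
    have h3 := (rootMultiplicity_pos hΨ).2 (show Ψ.IsRoot x from hx0)
    omega
  rw [(IsAlgClosed.splits Ψ).natDegree_eq_card_roots, ← Multiset.toFinset_sum_count_eq Ψ.roots]
  have hmem : (0 : L) ∈ Ψ.roots.toFinset := by
    rw [Multiset.mem_toFinset, mem_roots hΨ]
    exact h0
  rw [← Finset.sum_erase_add _ _ hmem, count_roots, hmul0, Finset.card_eq_sum_ones]
  congr 1
  refine Finset.sum_congr rfl fun x hx => ?_
  rw [Finset.mem_erase, Multiset.mem_toFinset, mem_roots hΨ] at hx
  rw [count_roots, hmul x hx.1 hx.2]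

/-- A polynomial over `L⟦u⟧` whose reduction has a single double root, which does not lift to a
root in `L⟦u⟧`: its roots are all distinct, and some automorphism interchanges two of them and
fixes the others. -/
theorem exists_swap_roots {Ψ : (PowerSeries L)[X]} {v : L[X]}
    (hlead : IsUnit Ψ.leadingCoeff)
    (h0 : (Ψ.map (PowerSeries.constantCoeff (R := L))).eval 0 = 0)
    (hv : derivative (Ψ.map (PowerSeries.constantCoeff (R := L))) = X * v) (hv0 : v.eval 0 ≠ 0)
    (hsimple : ∀ x ≠ 0, (Ψ.map (PowerSeries.constantCoeff (R := L))).eval x = 0 →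
      (derivative (Ψ.map (PowerSeries.constantCoeff (R := L)))).eval x ≠ 0)
    (hnoroot : ∀ r, PowerSeries.constantCoeff r = 0 → Ψ.eval r ≠ 0)
    {k E : Type*} [Field k] [Field E] [IsAlgClosed E] [Algebra k E] [Normal k E]
    [Algebra (PowerSeries L) k] [IsFractionRing (PowerSeries L) k] [CharZero k] :
    ∃ (T : Finset E) (ρ₁ ρ₂ : E) (σ : E ≃ₐ[k] E), T.card = Ψ.natDegree ∧
      (∀ t ∈ T, (Ψ.map ((algebraMap k E).comp (algebraMap (PowerSeries L) k))).eval t = 0) ∧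
      ρ₁ ∈ T ∧ ρ₂ ∈ T ∧ ρ₁ ≠ ρ₂ ∧ σ ρ₁ = ρ₂ ∧ σ ρ₂ = ρ₁ ∧
      ∀ t ∈ T, t ≠ ρ₁ → t ≠ ρ₂ → σ t = t := by
  classical
  let cc : PowerSeries L →+* L := PowerSeries.constantCoeff
  have hinj : Function.Injective (algebraMap (PowerSeries L) k) := IsFractionRing.injective _ k
  let j : PowerSeries L →+* E := (algebraMap k E).comp (algebraMap (PowerSeries L) k)
  have hj : Function.Injective j := (algebraMap k E).injective.comp hinj
  have hΨ0 : Ψ ≠ 0 := fun h => by simp [h] at hlead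
  have hccl : cc Ψ.leadingCoeff ≠ 0 := (hlead.map cc).ne_zero
  have hdeg : (Ψ.map cc).natDegree = Ψ.natDegree := natDegree_map_of_leadingCoeff_ne_zero _ hccl
  have hΨ0' : Ψ.map cc ≠ 0 := fun h => hccl (by
    have := congrArg (fun q => coeff q Ψ.natDegree) h
    simpa using this)
  let S : Finset L := (Ψ.map cc).roots.toFinset.erase 0
  have hScard : S.card + 2 = Ψ.natDegree := by
    rw [← hdeg]
    exact card_nonzero_roots_add_two hΨ0' h0 hv hv0 hsimple
  have hS : ∀ s ∈ S, s ≠ 0 ∧ (Ψ.map cc).eval s = 0 := by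
    intro s hs
    rw [Finset.mem_erase, Multiset.mem_toFinset, mem_roots hΨ0'] at hs
    exact hs
  have hlift : ∀ s ∈ S, ∃ r, Ψ.eval r = 0 ∧ cc r = s := fun s hs =>
    exists_root_powerSeries_of_simple_root Ψ s (hS s hs).2 (hsimple s (hS s hs).1 (hS s hs).2)
  choose! r hr hrs using hlift
  have hrinj : Set.InjOn r S := fun s hs s' hs' h => by rw [← hrs s hs, ← hrs s' hs', h]
  -- `M` collects the rational roots lifted from the simple ones; its cofactor `Q` is quadratic and
  -- carries the two roots that merge at `0`.
  let M : (PowerSeries L)[X] := ∏ s ∈ S, (X - C (r s))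
  have hM : M.Monic := monic_prod_of_monic _ _ fun i _ => monic_X_sub_C _
  have hMd : M.natDegree = S.card := by
    simp only [M]
    rw [natDegree_prod_of_monic _ _ fun i _ => monic_X_sub_C _]
    simp
  have hdvd : M ∣ Ψ := by
    have hMm : M = ((S.val.map r).map fun a => X - C a).prod := by
      rw [Multiset.map_map]
      rfl
    rw [hMm, Multiset.prod_X_sub_C_dvd_iff_le_roots hΨ0, Multiset.le_iff_subset]
    · intro a ha
      obtain ⟨s, hs, rfl⟩ := Multiset.mem_map.1 ha
      rw [mem_roots hΨ0]
      exact hr s hs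
    · exact Multiset.Nodup.map_on (fun s hs s' hs' h => hrinj hs hs' h) S.nodup
  obtain ⟨Q, hQ⟩ := hdvd
  have hQ0 : Q ≠ 0 := fun h => hΨ0 (by rw [hQ, h, mul_zero])
  have hQd : Q.natDegree = 2 := by
    have := congrArg natDegree hQ
    rw [natDegree_mul hM.ne_zero hQ0, hMd] at this
    omega
  have hQl : IsUnit Q.leadingCoeff := by
    rwa [hQ, leadingCoeff_mul, hM.leadingCoeff, one_mul] at hlead
  -- A root of `Q` reducing to `0` is excluded by `hnoroot`; one reducing elsewhere would double a
  -- lifted root and contradict simplicity.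
  have hQroot : ∀ x, Q.eval x ≠ 0 := by
    intro x hx
    have hx1 : Ψ.eval x = 0 := by rw [hQ, eval_mul, hx, mul_zero]
    have hne : cc x ≠ 0 := fun h => hnoroot x h hx1
    have hx2 : (Ψ.map cc).eval (cc x) = 0 := by rw [eval_map_apply, hx1, map_zero]
    have hxS : cc x ∈ S := by
      rw [Finset.mem_erase, Multiset.mem_toFinset, mem_roots hΨ0']
      exact ⟨hne, hx2⟩
    refine hsimple _ hne hx2 ?_
    have h1 : (M.map cc).eval (cc x) = 0 := by
      rw [Polynomial.map_prod, eval_prod]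
      exact Finset.prod_eq_zero hxS (by simp [hrs _ hxS])
    have h2 : (Q.map cc).eval (cc x) = 0 := by rw [eval_map_apply, hx, map_zero]
    have h3 : Ψ.map cc = M.map cc * Q.map cc := by rw [hQ, Polynomial.map_mul]
    change (derivative (Ψ.map cc)).eval (cc x) = 0
    rw [h3, derivative_mul, eval_add, eval_mul, eval_mul, h1, h2, mul_zero, zero_mul, add_zero]
  have hirr := irreducible_map_of_natDegree_two hQd hQl hQroot k
  have hQk : (Q.map (algebraMap (PowerSeries L) k)).natDegree = 2 := by
    rw [natDegree_map_eq_of_injective hinj, hQd]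
  have hcard : ((Q.map (algebraMap (PowerSeries L) k)).rootSet E).ncard = 2 := by
    rw [← Nat.card_coe_set_eq, Nat.card_eq_fintype_card,
      card_rootSet_eq_natDegree hirr.separable (IsAlgClosed.splits _), hQk]
  obtain ⟨ρ₁, ρ₂, h₁₂, hρ⟩ := Set.ncard_eq_two.1 hcard
  have hmem : ∀ z : E, aeval z (Q.map (algebraMap (PowerSeries L) k)) = 0 ↔ z = ρ₁ ∨ z = ρ₂ := by
    intro z
    have : z ∈ (Q.map (algebraMap (PowerSeries L) k)).rootSet E ↔ z ∈ ({ρ₁, ρ₂} : Set E) := by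
      rw [hρ]
    rw [mem_rootSet] at this
    simpa [hirr.ne_zero] using this
  have hmemj : ∀ z : E, (Q.map j).eval z = 0 ↔ z = ρ₁ ∨ z = ρ₂ := by
    intro z
    rw [← hmem, ← eval_map_algebraMap, Polynomial.map_map]
  have hmin := minpoly.eq_of_irreducible hirr ((hmem ρ₂).2 (Or.inr rfl))
  obtain ⟨σ, hσ⟩ := minpoly.exists_algEquiv_of_root (K := k) (x := ρ₁) (y := ρ₂)
    (Algebra.IsAlgebraic.isAlgebraic _) (by
      rw [← hmin, map_mul, (hmem ρ₁).2 (Or.inl rfl), zero_mul])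
  have hσ₂ : σ ρ₂ = ρ₁ := by
    have h3 : aeval (σ ρ₂) (Q.map (algebraMap (PowerSeries L) k)) = 0 := by
      rw [aeval_algHom_apply, (hmem ρ₂).2 (Or.inr rfl), map_zero]
    refine ((hmem _).1 h3).resolve_right fun h => h₁₂ (σ.injective ?_)
    rw [hσ, h]
  have hjr : ∀ x, j x ≠ ρ₁ ∧ j x ≠ ρ₂ := by
    intro x
    rw [← not_or, ← hmemj, eval_map_apply, map_eq_zero_iff j hj]
    exact hQroot x
  let T₀ : Finset E := S.image (fun s => j (r s))
  have hT₀ : T₀.card = S.card := Finset.card_image_of_injOn (hj.comp_injOn hrinj)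
  have hdisj : Disjoint T₀ {ρ₁, ρ₂} := by
    rw [Finset.disjoint_left]
    intro t ht ht'
    obtain ⟨s, -, rfl⟩ := Finset.mem_image.1 ht
    simp only [Finset.mem_insert, Finset.mem_singleton] at ht'
    exact ht'.elim (hjr _).1 (hjr _).2
  have hΨj : Ψ.map j = M.map j * Q.map j := by rw [hQ, Polynomial.map_mul]
  refine ⟨T₀ ∪ {ρ₁, ρ₂}, ρ₁, ρ₂, σ, ?_, ?_, by simp, by simp, h₁₂, hσ, hσ₂, ?_⟩
  · rw [Finset.card_union_of_disjoint hdisj, hT₀, Finset.card_pair h₁₂, hScard]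
  · intro t ht
    rcases Finset.mem_union.1 ht with ht | ht
    · obtain ⟨s, hs, rfl⟩ := Finset.mem_image.1 ht
      change (Ψ.map j).eval (j (r s)) = 0
      rw [eval_map_apply, hr s hs, map_zero]
    · simp only [Finset.mem_insert, Finset.mem_singleton] at ht
      change (Ψ.map j).eval t = 0
      rw [hΨj, eval_mul, (hmemj t).2 ht, mul_zero]
  · intro t ht h₁ h₂
    rcases Finset.mem_union.1 ht with ht | ht
    · obtain ⟨s, hs, rfl⟩ := Finset.mem_image.1 ht
      exact σ.commutes _
    · simp only [Finset.mem_insert, Finset.mem_singleton] at ht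
      exact absurd ht (not_or.2 ⟨h₁, h₂⟩)

end DoubleRoot

/-! ### The family `p + u` to first order in `u` -/

section Deformation

variable {L : Type*} [Field L]

/-- The deformation `p + u` of a polynomial `p` over the power series ring in `u`. -/
def deform (p : L[X]) : (PowerSeries L)[X] :=
  p.map PowerSeries.C + C PowerSeries.X

theorem derivative_deform (p : L[X]) :
    derivative (deform p) = (derivative p).map PowerSeries.C := by
  rw [deform, derivative_add, derivative_C, add_zero, derivative_map]

theorem map_constantCoeff_deform (p : L[X]) :
    (deform p).map (PowerSeries.constantCoeff (R := L)) = p := by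
  have : (PowerSeries.constantCoeff (R := L)).comp PowerSeries.C = RingHom.id L := by
    ext x
    simp
  rw [deform, Polynomial.map_add, Polynomial.map_map, this, Polynomial.map_id, map_C,
    PowerSeries.constantCoeff_X, C_0, add_zero]

theorem monic_deform {p : L[X]} (hp : p.Monic) (hd : p.natDegree ≠ 0) :
    (deform p).Monic ∧ (deform p).natDegree = p.natDegree := by
  have h : (p.map (PowerSeries.C (R := L))).natDegree = p.natDegree := hp.natDegree_map _
  refine ⟨(hp.map _).add_of_left (degree_C_le.trans_lt ?_), ?_⟩
  · rw [degree_eq_natDegree (hp.map _).ne_zero, h]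
    exact_mod_cast Nat.pos_of_ne_zero hd
  · rw [deform, natDegree_add_C, h]

/-- The derivative at `u = 0` of the `m`-th iterate of `p + u` at `0`. -/
def orbitDeriv (p : L[X]) : ℕ → L
  | 0 => 0
  | m + 1 => (derivative p).eval ((fun y => p.eval y)^[m] 0) * orbitDeriv p m + 1

/-- Since `0` is critical, a starting point divisible by `u` changes `p` only by `O(u^2)`. Thus,
after at least one step, the orbit modulo `u^2` does not depend on `x`. -/
theorem iterate_deform {p : L[X]} (hp : (derivative p).eval 0 = 0) {x : PowerSeries L}
    (hx : PowerSeries.constantCoeff x = 0) (m : ℕ) : ∃ r : PowerSeries L,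
    (fun y => (deform p).eval y)^[m + 1] x = PowerSeries.C ((fun y => p.eval y)^[m + 1] 0) +
      PowerSeries.C (orbitDeriv p (m + 1)) * PowerSeries.X + PowerSeries.X ^ 2 * r := by
  have key : ∀ (b : L) (h : PowerSeries L), ∃ s : PowerSeries L,
      (deform p).eval (PowerSeries.C b + h) = PowerSeries.C (p.eval b) +
        PowerSeries.C ((derivative p).eval b) * h + s * h ^ 2 + PowerSeries.X := by
    intro b h
    obtain ⟨s, hs⟩ := (p.map PowerSeries.C).binomExpansion (PowerSeries.C b) h
    refine ⟨s, ?_⟩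
    rw [deform, eval_add, eval_C, hs, eval_map_apply, derivative_map, eval_map_apply]
  induction m with
  | zero =>
    obtain ⟨y, rfl⟩ := PowerSeries.X_dvd_iff.2 hx
    obtain ⟨s, hs⟩ := key 0 (PowerSeries.X * y)
    refine ⟨s * y ^ 2, ?_⟩
    rw [map_zero, zero_add] at hs
    simp only [zero_add, Function.iterate_one, orbitDeriv, mul_zero, map_one]
    rw [hs, hp, map_zero]
    ring
  | succ m ih =>
    obtain ⟨r, hr⟩ := ih
    rw [Function.iterate_succ_apply', hr, add_assoc]
    obtain ⟨s, hs⟩ := key ((fun y => p.eval y)^[m + 1] 0)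
      (PowerSeries.C (orbitDeriv p (m + 1)) * PowerSeries.X + PowerSeries.X ^ 2 * r)
    have hO : orbitDeriv p (m + 1 + 1) = (derivative p).eval ((fun y => p.eval y)^[m + 1] 0) *
      orbitDeriv p (m + 1) + 1 := rfl
    rw [hs, Function.iterate_succ_apply' _ (m + 1), hO, map_add, map_mul, map_one]
    refine ⟨PowerSeries.C ((derivative p).eval ((fun y => p.eval y)^[m + 1] 0)) * r +
      s * (PowerSeries.C (orbitDeriv p (m + 1)) + PowerSeries.X * r) ^ 2, ?_⟩
    ring

/-- By periodicity and transversality the orbit point has order exactly one in `u`. It is nonzero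
but close to `0`, where `0` is the only critical point. -/
theorem eval_critIter_deform_ne_zero {p w : L[X]} (hp : derivative p = X * w)
    (hw : w.eval 0 ≠ 0) {n : ℕ} (hn : (fun y => p.eval y)^[n + 1] 0 = 0)
    (hD : orbitDeriv p (n + 1) ≠ 0) {x : PowerSeries L}
    (hx : PowerSeries.constantCoeff x = 0) : (critIter (deform p) (n + 1)).eval x ≠ 0 := by
  obtain ⟨r, hr⟩ := iterate_deform (p := p) (by rw [hp]; simp) hx n
  rw [eval_critIter, hr, hn, derivative_deform, hp, map_zero, zero_add]
  intro h
  rw [Polynomial.map_mul, map_X, eval_mul, eval_X, mul_eq_zero] at h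
  rcases h with h | h
  · have h1 : PowerSeries.X * (PowerSeries.C (orbitDeriv p (n + 1)) + PowerSeries.X * r) = 0 := by
      rw [← h]
      ring
    have h2 := congrArg (PowerSeries.constantCoeff (R := L))
      ((mul_eq_zero.1 h1).resolve_left PowerSeries.X_ne_zero)
    simp at h2
    exact hD h2
  · have h2 := congrArg (PowerSeries.constantCoeff (R := L)) h
    have h3 : (PowerSeries.constantCoeff (R := L)).comp PowerSeries.C = RingHom.id L := by
      ext x
      simp
    rw [← eval_map_apply, Polynomial.map_map, h3, Polynomial.map_id] at h2
    simp at h2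
    exact hw h2

end Deformation

/-! ### From a periodic critical point to a Galois transposition -/

section SwapCriterion

/-- A polynomial `p` with a critical point at `0` of exact period `n + 1`, all of whose critical
points are simple and whose other critical points never return to the critical locus, and for
which the period relation is transverse to the family `p + u`. -/
structure IsTransversePeriodic {L : Type*} [Field L] (p w : L[X]) (n : ℕ) : Prop where
  derivative_eq : derivative p = X * w
  eval_zero_ne : w.eval 0 ≠ 0
  simple : ∀ c, (derivative p).eval c = 0 → (derivative (derivative p)).eval c ≠ 0
  escape : ∀ c, w.eval c = 0 → ∀ m, (derivative p).eval ((fun y => p.eval y)^[m + 1] c) ≠ 0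
  not_crit : ∀ m < n, (derivative p).eval ((fun y => p.eval y)^[m + 1] 0) ≠ 0
  periodic : (fun y => p.eval y)^[n + 1] 0 = 0
  transverse : orbitDeriv p (n + 1) ≠ 0

variable {L : Type*} [Field L] {p w : L[X]} {n : ℕ}

/-- In the chain rule product only the factor `p' = X * w` at time `0` vanishes at `0`, so the root
`0` is exactly double. -/
theorem IsTransversePeriodic.exists_derivative_critIter_eq (h : IsTransversePeriodic p w n) :
    ∃ v : L[X], derivative (critIter p (n + 1)) = X * v ∧ v.eval 0 ≠ 0 := by
  refine ⟨w * (∏ k ∈ Finset.range n, critIter p (k + 1)) *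
    (derivative (derivative p)).comp (p.comp^[n + 1] X), ?_, ?_⟩
  · have h0 : critIter p 0 = X * w := by simp [critIter, h.derivative_eq]
    rw [derivative_critIter, Finset.prod_range_succ', h0]
    ring
  · rw [eval_mul, eval_mul, eval_prod, eval_comp, iterate_comp_eval, eval_X, h.periodic]
    refine mul_ne_zero (mul_ne_zero h.eval_zero_ne (Finset.prod_ne_zero_iff.2 fun k hk => ?_)) ?_
    · rw [eval_critIter]
      exact h.not_crit k (Finset.mem_range.1 hk)
    · exact h.simple 0 (by simp [h.derivative_eq])

/-- A multiple root would have an orbit meeting the critical locus twice. The first meeting cannot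
be followed by the second: from `0` this happens too early in the period, and the other critical
points never return. -/
theorem IsTransversePeriodic.eval_derivative_critIter_ne_zero (h : IsTransversePeriodic p w n)
    {x : L} (hx : x ≠ 0) (hx0 : (critIter p (n + 1)).eval x = 0) :
    (derivative (critIter p (n + 1))).eval x ≠ 0 := by
  rw [eval_critIter] at hx0
  rw [eval_derivative_critIter]
  refine mul_ne_zero (Finset.prod_ne_zero_iff.2 fun k hk hk0 => ?_) (h.simple _ hx0)
  have hk' := Finset.mem_range.1 hk
  obtain ⟨m, hm⟩ : ∃ m, n + 1 = m + 1 + k := ⟨n - k, by omega⟩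
  rw [hm, Function.iterate_add_apply] at hx0
  rw [eval_critIter, h.derivative_eq, eval_mul, eval_X, mul_eq_zero] at hk0
  rcases hk0 with hk0 | hk0
  · rcases Nat.eq_zero_or_pos k with rfl | hkpos
    · exact hx hk0
    · rw [hk0] at hx0
      exact h.not_crit m (by omega) hx0
  · exact h.escape _ hk0 m hx0

variable {K : Type*} [Field K] [CharZero K] {d : ℕ}

/-- `T` has as many elements as the tree has leaves, so specialization is a bijection onto `T` and
transports the action of `σ`. -/
theorem exists_gal_swap_of_roots (hd : 2 ≤ d) {E : Type*} [Field E] [Algebra K E] [CharZero E]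
    [IsAlgClosed E] {p : E[X]} (hp : p.Monic) (hpd : p.natDegree = d) {n : ℕ} {T : Finset E}
    (hT : T.card = (critIter p n).natDegree) (hroot : ∀ t ∈ T, (critIter p n).eval t = 0)
    {ρ₁ ρ₂ : E} (h₁ : ρ₁ ∈ T) (h₂ : ρ₂ ∈ T) (h₁₂ : ρ₁ ≠ ρ₂) (σ : E →ₐ[K] E) (hσ : p.map σ = p)
    (hσ₁ : σ ρ₁ = ρ₂) (hσ₂ : σ ρ₂ = ρ₁) (hσT : ∀ t ∈ T, t ≠ ρ₁ → t ≠ ρ₂ → σ t = t) :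
    ∃ (a b : critPreimages (genericMonic K d) n) (g : AlgebraicClosure (GenericField K d)
      ≃ₐ[GenericField K d] AlgebraicClosure (GenericField K d)), a ≠ b ∧ galMap g a = b ∧
      galMap g b = a ∧ ∀ x, x ≠ a → x ≠ b → galMap g x = x := by
  classical
  obtain ⟨θ, hθ⟩ := exists_isRootSpecialization (K := K) (d := d) (by omega) hp hpd n
  have hfin := finite_critPreimages (K := K) (d := d) (by omega) n
  have : Fintype (critPreimages (genericMonic K d) n) := hfin.fintype
  have hcard : (Finset.univ : Finset (critPreimages (genericMonic K d) n)).card = T.card := by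
    rw [hT, natDegree_critIter, hpd, ← ncard_critPreimages (K := K) hd n, Finset.card_univ,
      ← Nat.card_eq_fintype_card, Nat.card_coe_set_eq]
  have hsub : T ⊆ Finset.univ.image θ := fun t ht => by
    obtain ⟨x, hx⟩ := hθ.exists_eq t (hroot t ht)
    exact Finset.mem_image.2 ⟨x, Finset.mem_univ _, hx⟩
  have himg : T = Finset.univ.image θ :=
    Finset.eq_of_subset_of_card_le hsub (Finset.card_image_le.trans hcard.le)
  have hinj : Function.Injective θ := by
    rw [← Set.injOn_univ, ← Finset.coe_univ, ← Finset.card_image_iff, ← himg, hcard]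
  have hmem : ∀ x, θ x ∈ T := fun x => by
    rw [himg]
    exact Finset.mem_image_of_mem _ (Finset.mem_univ _)
  obtain ⟨a, ha⟩ := hθ.exists_eq ρ₁ (hroot _ h₁)
  obtain ⟨b, hb⟩ := hθ.exists_eq ρ₂ (hroot _ h₂)
  obtain ⟨g, hg⟩ := hθ.exists_gal σ hσ
  refine ⟨a, b, g, ?_, hinj ?_, hinj ?_, fun x hxa hxb => hinj ?_⟩
  · rintro rfl
    exact h₁₂ (ha.symm.trans hb)
  · rw [hg, ha, hb, hσ₁]
  · rw [hg, ha, hb, hσ₂]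
  · rw [hg]
    refine hσT _ (hmem x) (fun h => hxa (hinj (h.trans ha.symm)))
      (fun h => hxb (hinj (h.trans hb.symm)))

theorem IsTransversePeriodic.exists_gal_swap_of_closure [CharZero L] [IsAlgClosed L]
    (h : IsTransversePeriodic p w n) (hd : 2 ≤ d) (hp : p.Monic) (hpd : p.natDegree = d)
    (k E : Type*) [Field k] [Field E] [IsAlgClosed E] [Algebra k E] [Normal k E]
    [Algebra (PowerSeries L) k] [IsFractionRing (PowerSeries L) k] [CharZero k] [CharZero E]
    [Algebra K k] [Algebra K E] [IsScalarTower K k E] :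
    ∃ (a b : critPreimages (genericMonic K d) (n + 1)) (g : AlgebraicClosure (GenericField K d)
      ≃ₐ[GenericField K d] AlgebraicClosure (GenericField K d)), a ≠ b ∧ galMap g a = b ∧
      galMap g b = a ∧ ∀ x, x ≠ a → x ≠ b → galMap g x = x := by
  have : CharZero (PowerSeries L) := charZero_of_injective_algebraMap
    (PowerSeries.C_injective (R := L))
  obtain ⟨hdm, hdd⟩ := monic_deform hp (by omega)
  obtain ⟨v, hv, hv0⟩ := h.exists_derivative_critIter_eq
  have hred : (critIter (deform p) (n + 1)).map (PowerSeries.constantCoeff (R := L)) =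
      critIter p (n + 1) := by
    rw [map_critIter, map_constantCoeff_deform]
  obtain ⟨T, ρ₁, ρ₂, σ, hT, hroot, h₁, h₂, h₁₂, hσ₁, hσ₂, hσT⟩ := exists_swap_roots
    (Ψ := critIter (deform p) (n + 1)) (v := v) (k := k) (E := E)
    (by
      rw [leadingCoeff_critIter hdm (by omega), hdd, hpd, PowerSeries.isUnit_iff_constantCoeff,
        map_natCast, isUnit_iff_ne_zero, Nat.cast_ne_zero]
      omega)
    (by
      rw [hred, eval_critIter, h.periodic, h.derivative_eq]
      simp)
    (by rw [hred, hv]) hv0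
    (fun x hx hx0 => by
      rw [hred] at hx0 ⊢
      exact h.eval_derivative_critIter_ne_zero hx hx0)
    (fun r hr => eval_critIter_deform_ne_zero h.derivative_eq h.eval_zero_ne h.periodic
      h.transverse hr)
  let j : PowerSeries L →+* E := (algebraMap k E).comp (algebraMap (PowerSeries L) k)
  have hjm : ((deform p).map j).natDegree = d := by rw [hdm.natDegree_map, hdd, hpd]
  refine exists_gal_swap_of_roots (K := K) hd (hdm.map j) hjm (T := T) ?_ ?_ h₁ h₂ h₁₂
    ((σ.restrictScalars K : E ≃ₐ[K] E) : E →ₐ[K] E) ?_ hσ₁ hσ₂ hσT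
  · rw [hT, natDegree_critIter, natDegree_critIter, hjm, hdd, hpd]
  · intro t ht
    rw [← map_critIter]
    exact hroot t ht
  · rw [Polynomial.map_map]
    congr 1
    ext x
    exact σ.commutes _

theorem IsTransversePeriodic.exists_gal_swap [Algebra K L] [CharZero L] [IsAlgClosed L]
    (h : IsTransversePeriodic p w n) (hd : 2 ≤ d) (hp : p.Monic) (hpd : p.natDegree = d) :
    ∃ (a b : critPreimages (genericMonic K d) (n + 1)) (g : AlgebraicClosure (GenericField K d)
      ≃ₐ[GenericField K d] AlgebraicClosure (GenericField K d)), a ≠ b ∧ galMap g a = b ∧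
      galMap g b = a ∧ ∀ x, x ≠ a → x ≠ b → galMap g x = x := by
  have : CharZero (PowerSeries L) := charZero_of_injective_algebraMap
    (PowerSeries.C_injective (R := L))
  have h1 : CharZero (FractionRing (PowerSeries L)) := charZero_of_injective_algebraMap
    (IsFractionRing.injective (PowerSeries L) _)
  have : CharZero (AlgebraicClosure (FractionRing (PowerSeries L))) :=
    charZero_of_injective_algebraMap (algebraMap (FractionRing (PowerSeries L)) _).injective
  exact h.exists_gal_swap_of_closure hd hp hpd (FractionRing (PowerSeries L))
    (AlgebraicClosure (FractionRing (PowerSeries L)))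

end SwapCriterion

/-! ### Gleason polynomials and periodic quadratic critical points -/

section Gleason

/-- The polynomial in `T` that gives the `m`-th iterate of `0` under `x ^ 2 + T`. -/
def gleason (R : Type*) [CommRing R] : ℕ → R[X]
  | 0 => 0
  | m + 1 => gleason R m ^ 2 + X

theorem map_gleason {R S : Type*} [CommRing R] [CommRing S] (φ : R →+* S) (m : ℕ) :
    (gleason R m).map φ = gleason S m := by
  induction m with
  | zero => simp [gleason]
  | succ m ih => simp [gleason, ih]

theorem monic_gleason (R : Type*) [CommRing R] [Nontrivial R] (m : ℕ) :
    (gleason R (m + 1)).Monic ∧ (gleason R (m + 1)).natDegree = 2 ^ m := by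
  induction m with
  | zero => simp [gleason, monic_X]
  | succ m ih =>
    have h1 : (gleason R (m + 1) ^ 2).natDegree = 2 ^ (m + 1) := by
      rw [ih.1.natDegree_pow, ih.2]
      ring
    have h2 : (X : R[X]).natDegree < (gleason R (m + 1) ^ 2).natDegree := by
      rw [h1, natDegree_X]
      exact Nat.one_lt_two_pow (Nat.succ_ne_zero m)
    rw [gleason]
    exact ⟨(ih.1.pow 2).add_of_left (degree_lt_degree h2),
      by rw [natDegree_add_eq_left_of_natDegree_lt h2, h1]⟩

theorem derivative_gleason (R : Type*) [CommRing R] (m : ℕ) :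
    derivative (gleason R (m + 1)) = 2 * gleason R m * derivative (gleason R m) + 1 := by
  rw [gleason, derivative_add, derivative_pow, derivative_X]
  simp only [Nat.cast_ofNat, Nat.add_one_sub_one, pow_one]
  rfl

variable {L : Type*} [Field L] [CharZero L]

/-- The root `t` is an algebraic integer. At a double root the recursion for the derivative would
make `-1/2` a polynomial in `t` over `ℤ`, hence integral. -/
theorem eval_derivative_gleason_ne_zero {m : ℕ} {t : L} (ht : (gleason L (m + 1)).eval t = 0) :
    (derivative (gleason L (m + 1))).eval t ≠ 0 := by
  have htint : IsIntegral ℤ t := by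
    refine ⟨gleason ℤ (m + 1), (monic_gleason ℤ m).1, ?_⟩
    rw [← eval_map, map_gleason, ht]
  have hint : ∀ q : ℤ[X], IsIntegral ℤ ((q.map (algebraMap ℤ L)).eval t) := by
    intro q
    rw [eval_map_algebraMap]
    have := (aeval (⟨t, htint⟩ : integralClosure ℤ L) q).2
    rwa [← Subalgebra.aeval_coe] at this
  intro h
  have h1 := hint (gleason ℤ m * derivative (gleason ℤ m))
  rw [Polynomial.map_mul, ← derivative_map, map_gleason, eval_mul] at h1
  rw [derivative_gleason, eval_add, eval_mul, eval_mul, eval_one] at h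
  have h2 : (gleason L m).eval t * (derivative (gleason L m)).eval t =
      algebraMap ℚ L (-1 / 2) := by
    rw [eval_ofNat] at h
    rw [map_div₀, map_neg, map_one, map_ofNat]
    field_simp
    linear_combination h
  rw [h2] at h1
  have h4 : IsIntegral ℤ (-1 / 2 : ℚ) :=
    (isIntegral_algebraMap_iff (algebraMap ℚ L).injective).1 h1
  obtain ⟨z, hz⟩ := IsIntegrallyClosed.isIntegral_iff.1 h4
  have h5 : (2 * z : ℚ) = -1 := by
    rw [eq_intCast] at hz
    rw [hz]
    norm_num
  have h6 : 2 * z = -1 := by exact_mod_cast h5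
  omega

/-- Counting: the polynomial has `2^n` distinct roots, while the earlier ones have at most `1 + 2 +
⋯ + 2^(n-1) = 2^n - 1` together. -/
theorem exists_gleason_root [IsAlgClosed L] (n : ℕ) : ∃ t : L, (gleason L (n + 1)).eval t = 0 ∧
    ∀ m < n, (gleason L (m + 1)).eval t ≠ 0 := by
  classical
  by_contra! hcon
  let Q : L[X] := ∏ m ∈ Finset.range n, gleason L (m + 1)
  have hQ : Q.Monic := monic_prod_of_monic _ _ fun m _ => (monic_gleason L m).1
  have hQd : Q.natDegree = 2 ^ n - 1 := by
    rw [natDegree_prod_of_monic _ _ fun m _ => (monic_gleason L m).1,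
      Finset.sum_congr rfl fun m _ => (monic_gleason L m).2, Nat.geomSum_eq le_rfl]
    simp
  have hne := (monic_gleason L n).1.ne_zero
  have hnodup : (gleason L (n + 1)).roots.Nodup := by
    rw [Multiset.nodup_iff_count_le_one]
    intro t
    rw [count_roots]
    by_cases ht : (gleason L (n + 1)).IsRoot t
    · have h1 := derivative_rootMultiplicity_of_root ht
      rw [rootMultiplicity_eq_zero (show ¬ (derivative (gleason L (n + 1))).IsRoot t from
        eval_derivative_gleason_ne_zero ht)] at h1
      omega
    · rw [rootMultiplicity_eq_zero ht]
      exact Nat.zero_le 1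
  have hsub : (gleason L (n + 1)).roots ≤ Q.roots := by
    rw [Multiset.le_iff_subset hnodup]
    intro t ht
    rw [mem_roots hne] at ht
    obtain ⟨m, hm, hm0⟩ := hcon t ht
    rw [mem_roots hQ.ne_zero, IsRoot, eval_prod]
    exact Finset.prod_eq_zero (Finset.mem_range.2 hm) hm0
  have h1 := (Multiset.card_le_card hsub).trans (card_roots' Q)
  rw [← (IsAlgClosed.splits _).natDegree_eq_card_roots, (monic_gleason L n).2, hQd] at h1
  have := Nat.one_le_two_pow (n := n)
  omega


/-- A quadratic polynomial whose critical point is periodic. -/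
theorem exists_isTransversePeriodic_quadratic [IsAlgClosed L] (n : ℕ) :
    ∃ p w : L[X], p.Monic ∧ p.natDegree = 2 ∧ IsTransversePeriodic p w n := by
  obtain ⟨t, ht, htn⟩ := exists_gleason_root (L := L) n
  have hder : derivative (X ^ 2 + C t : L[X]) = X * C 2 := by
    rw [derivative_add, derivative_C, derivative_X_pow, add_zero]
    simp only [Nat.cast_ofNat, Nat.add_one_sub_one, pow_one]
    exact mul_comm _ _
  have hiter : ∀ m, (fun y => (X ^ 2 + C t : L[X]).eval y)^[m] 0 = (gleason L m).eval t := by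
    intro m
    induction m with
    | zero => simp [gleason]
    | succ m ih =>
      rw [Function.iterate_succ_apply', ih, gleason]
      simp
  have horb : ∀ m, orbitDeriv (X ^ 2 + C t : L[X]) m = (derivative (gleason L m)).eval t := by
    intro m
    induction m with
    | zero => simp [gleason, orbitDeriv]
    | succ m ih =>
      rw [orbitDeriv, hiter, ih, derivative_gleason, hder]
      simp only [eval_mul, eval_X, eval_C, eval_add, eval_one, eval_ofNat]
      ring
  refine ⟨X ^ 2 + C t, C 2, monic_X_pow_add_C t two_ne_zero, natDegree_X_pow_add_C, hder, by simp,
    fun c _ => by rw [hder]; simp, fun c hc => by simp at hc, fun m hm => ?_, ?_, ?_⟩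
  · rw [hiter, hder]
    simpa using htn m hm
  · rw [hiter, ht]
  · rw [horb]
    exact eval_derivative_gleason_ne_zero ht

end Gleason

/-! ### Higher degree: perturbed quadratics with escaping critical points -/

section Escape

variable {L₀ : Type*} [Field L₀]

/-- The polynomial in `T` that gives the `m`-th iterate of `0` under
`x ^ 2 + ε ^ (e * (e + 1)) * x ^ (e + 2) + T`. -/
def gleasonDeform (L₀ : Type*) [Field L₀] (e : ℕ) : ℕ → (PowerSeries L₀)[X]
  | 0 => 0
  | m + 1 => gleasonDeform L₀ e m ^ 2 +
      C (PowerSeries.X ^ (e * (e + 1))) * gleasonDeform L₀ e m ^ (e + 2) + X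

theorem map_constantCoeff_gleasonDeform {e : ℕ} (he : e ≠ 0) (m : ℕ) :
    (gleasonDeform L₀ e m).map (PowerSeries.constantCoeff (R := L₀)) = gleason L₀ m := by
  induction m with
  | zero => simp [gleason, gleasonDeform]
  | succ m ih => simp [gleason, gleasonDeform, ih, he]

/-- The polynomial `x ^ (e + 2) + ε ^ (-e) * x ^ 2 + ε ^ e * t`. -/
def escapePoly {L : Type*} [Field L] (e : ℕ) (ε t : L) : L[X] :=
  X ^ (e + 2) + C (ε ^ e)⁻¹ * X ^ 2 + C (ε ^ e * t)

section

variable {L : Type*} [Field L] (e : ℕ) (ε t : L)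

theorem monic_escapePoly (he : e ≠ 0) : (escapePoly e ε t).Monic := by
  rw [escapePoly, add_assoc]
  refine monic_X_pow_add (lt_of_le_of_lt (b := (2 : WithBot ℕ)) ?_ (by exact_mod_cast by omega))
  compute_degree

theorem natDegree_escapePoly (he : e ≠ 0) : (escapePoly e ε t).natDegree = e + 2 := by
  rw [escapePoly, add_assoc, natDegree_add_eq_left_of_natDegree_lt, natDegree_X_pow]
  rw [natDegree_X_pow]
  refine lt_of_le_of_lt (b := 2) ?_ (by omega)
  compute_degree

theorem eval_escapePoly (x : L) : (escapePoly e ε t).eval x =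
    x ^ (e + 2) + (ε ^ e)⁻¹ * x ^ 2 + ε ^ e * t := by
  simp [escapePoly]

theorem derivative_escapePoly : derivative (escapePoly e ε t) =
    X * (C ((e : L) + 2) * X ^ e + C (2 * (ε ^ e)⁻¹)) := by
  rw [escapePoly, derivative_add, derivative_add, derivative_C, derivative_X_pow,
    derivative_C_mul, derivative_X_pow]
  simp
  ring

theorem eval_derivative_derivative_escapePoly (x : L) :
    (derivative (derivative (escapePoly e ε t))).eval x =
      ((e : L) + 2) * (e + 1) * x ^ e + 2 * (ε ^ e)⁻¹ := by
  rw [derivative_escapePoly]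
  rcases e with _ | e
  · simp
  · simp
    ring

end

variable {L : Type*} [Field L] {j : PowerSeries L₀ →+* L} {e : ℕ}

/-- In the coordinate `x = ε^e z` the map is `z ↦ z^2 + ε^(e(e+1)) z^(e+2) + t`, a small
perturbation of the quadratic `z^2 + t`. -/
theorem iterate_escapePoly_zero (hj : Function.Injective j) (t : PowerSeries L₀) (m : ℕ) :
    (fun y => (escapePoly e (j PowerSeries.X) (j t)).eval y)^[m] 0 =
      j PowerSeries.X ^ e * j ((gleasonDeform L₀ e m).eval t) := by
  have hε : j PowerSeries.X ≠ 0 := (map_ne_zero_iff j hj).2 PowerSeries.X_ne_zero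
  induction m with
  | zero => simp [gleasonDeform]
  | succ m ih =>
    rw [Function.iterate_succ_apply', ih, eval_escapePoly, gleasonDeform]
    simp only [eval_add, eval_mul, eval_pow, eval_C, eval_X, map_add, map_mul, map_pow]
    field_simp
    ring

theorem eval_derivative_escapePoly (hj : Function.Injective j) (t z : PowerSeries L₀) :
    (derivative (escapePoly e (j PowerSeries.X) (j t))).eval (j PowerSeries.X ^ e * j z) =
      j (z * (((e : PowerSeries L₀) + 2) * PowerSeries.X ^ (e * (e + 1)) * z ^ e + 2)) := by
  have hε : j PowerSeries.X ≠ 0 := (map_ne_zero_iff j hj).2 PowerSeries.X_ne_zero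
  rw [derivative_escapePoly]
  simp only [eval_add, eval_mul, eval_pow, eval_C, eval_X]
  simp only [map_add, map_mul, map_pow, map_natCast, map_ofNat]
  field_simp
  ring

/-- Modulo `ε` the recursion for `orbitDeriv` is that for the derivative of the Gleason polynomial,
so transversality follows from simplicity of the Gleason root. -/
theorem exists_orbitDeriv_escapePoly (hj : Function.Injective j) (he : e ≠ 0)
    (t : PowerSeries L₀) (m : ℕ) : ∃ D : PowerSeries L₀,
    orbitDeriv (escapePoly e (j PowerSeries.X) (j t)) m = j D ∧ PowerSeries.constantCoeff D =
      (derivative (gleason L₀ m)).eval (PowerSeries.constantCoeff t) := by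
  induction m with
  | zero => exact ⟨0, by simp [orbitDeriv, gleason]⟩
  | succ m ih =>
    obtain ⟨D, hD, hD0⟩ := ih
    rw [orbitDeriv, iterate_escapePoly_zero hj, eval_derivative_escapePoly hj, hD, ← map_mul,
      ← map_one j, ← map_add]
    refine ⟨_, rfl, ?_⟩
    have h : PowerSeries.constantCoeff ((gleasonDeform L₀ e m).eval t) =
        (gleason L₀ m).eval (PowerSeries.constantCoeff t) := by
      rw [← eval_map_apply, map_constantCoeff_gleasonDeform he]
    rw [derivative_gleason, eval_add, eval_mul, eval_mul, eval_one, eval_ofNat, ← hD0, ← h]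
    simp only [map_add, map_mul, map_pow, map_natCast, map_ofNat, map_one,
      PowerSeries.constantCoeff_X, zero_pow (mul_ne_zero he (Nat.succ_ne_zero e))]
    ring

/-- The critical points of `escapePoly` other than `0` are multiples of `ε⁻¹`. -/
theorem exists_eq_of_critical [CharZero L₀] [IsAlgClosed L₀] (hj : Function.Injective j)
    (he : e ≠ 0) {c : L}
    (hc : ((e : L) + 2) * c ^ e + 2 * (j PowerSeries.X ^ e)⁻¹ = 0) :
    ∃ γ : L₀, γ ≠ 0 ∧ c * j PowerSeries.X = j (PowerSeries.C γ) := by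
  have hε : j PowerSeries.X ≠ 0 := (map_ne_zero_iff j hj).2 PowerSeries.X_ne_zero
  let i : L₀ →+* L := j.comp PowerSeries.C
  have he2 : ((e : L₀) + 2) ≠ 0 := by exact_mod_cast Nat.succ_ne_zero (e + 1)
  let q : L₀[X] := C ((e : L₀) + 2) * X ^ e + C 2
  have hq0 : q.eval 0 = 2 := by simp [q, he]
  have hq : q ≠ 0 := fun h => by
    rw [h, eval_zero] at hq0
    exact two_ne_zero hq0.symm
  have hroot : (q.map i).IsRoot (c * j PowerSeries.X) := by
    rw [IsRoot, Polynomial.map_add, Polynomial.map_mul, Polynomial.map_pow, map_X, map_C, map_C,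
      map_add, map_natCast, map_ofNat]
    simp only [eval_add, eval_mul, eval_pow, eval_C, eval_X, mul_pow]
    field_simp at hc
    linear_combination hc
  obtain ⟨γ, hγ⟩ := (IsAlgClosed.splits q).mem_range_of_isRoot hq hroot
  refine ⟨γ, ?_, hγ.symm⟩
  rintro rfl
  rw [← hγ, IsRoot, eval_map_apply, hq0, map_ofNat] at hroot
  have : CharZero L := charZero_of_injective_ringHom (f := i) i.injective
  exact two_ne_zero hroot

/-- The pole order in `ε` along the critical orbit grows. At order `r + 2` the leading term
`x^(e+2)` beats `ε^(-e) x^2` by `(r + 1) e > 0`, so `y` keeps a nonzero constant term. -/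
theorem exists_iterate_escapePoly_critical [CharZero L₀] [IsAlgClosed L₀]
    (hj : Function.Injective j) (he : e ≠ 0) (t : PowerSeries L₀) {c : L}
    (hc : ((e : L) + 2) * c ^ e + 2 * (j PowerSeries.X ^ e)⁻¹ = 0) (m : ℕ) :
    ∃ (r : ℕ) (y : PowerSeries L₀), PowerSeries.constantCoeff y ≠ 0 ∧
      (fun y => (escapePoly e (j PowerSeries.X) (j t)).eval y)^[m + 1] c *
        j PowerSeries.X ^ (r + 2) = j y := by
  have hε : j PowerSeries.X ≠ 0 := (map_ne_zero_iff j hj).2 PowerSeries.X_ne_zero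
  have he2 : (e : L₀) + 2 ≠ 0 := by exact_mod_cast Nat.succ_ne_zero (e + 1)
  have hcz : CharZero L :=
    charZero_of_injective_ringHom (f := j.comp PowerSeries.C) (j.comp PowerSeries.C).injective
  have he2' : (e : L) + 2 ≠ 0 := by exact_mod_cast Nat.succ_ne_zero (e + 1)
  induction m with
  | zero =>
    obtain ⟨γ, hγ0, hγ⟩ := exists_eq_of_critical hj he hc
    -- At `c = γ / ε` both leading terms have order `e + 2`. Their sum is `γ^2 (γ^e + 1)` with `γ^e
    -- = -2 / (e + 2)`, which does not cancel because `e ≠ 0`.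
    refine ⟨e, PowerSeries.C (γ ^ 2 * (e / (e + 2))) + PowerSeries.X ^ (2 * e + 2) * t, ?_, ?_⟩
    · simpa using ⟨hγ0, he, he2⟩
    · have h1 : j (PowerSeries.C ((e : L₀) / (e + 2))) = e / (e + 2) := by
        change (j.comp PowerSeries.C) _ = _
        rw [map_div₀, map_add, map_natCast, map_ofNat]
      rw [zero_add, Function.iterate_one, eval_escapePoly]
      simp only [map_add, map_mul, map_pow]
      rw [h1, ← hγ]
      field_simp at hc ⊢
      linear_combination (c ^ 2 * j PowerSeries.X ^ 2 * j PowerSeries.X ^ e) * hc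
  | succ m ih =>
    obtain ⟨r, y, hy0, hy⟩ := ih
    rw [Function.iterate_succ_apply']
    set x := (fun y => (escapePoly e (j PowerSeries.X) (j t)).eval y)^[m + 1] c
    refine ⟨(r + 2) * (e + 1) + r, y ^ (e + 2) + PowerSeries.X ^ ((r + 1) * e) * y ^ 2 +
      PowerSeries.X ^ (e + (r + 2) * (e + 2)) * t, ?_, ?_⟩
    · have h1 : (r + 1) * e ≠ 0 := mul_ne_zero (Nat.succ_ne_zero r) he
      simpa [he] using hy0
    · simp only [eval_escapePoly, map_add, map_mul, map_pow]
      rw [← hy]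
      field_simp
      ring

theorem eval_derivative_iterate_escapePoly_ne_zero [CharZero L₀] [IsAlgClosed L₀]
    (hj : Function.Injective j) (he : e ≠ 0) (t : PowerSeries L₀) {c : L}
    (hc : ((e : L) + 2) * c ^ e + 2 * (j PowerSeries.X ^ e)⁻¹ = 0) (m : ℕ) :
    (derivative (escapePoly e (j PowerSeries.X) (j t))).eval
      ((fun y => (escapePoly e (j PowerSeries.X) (j t)).eval y)^[m + 1] c) ≠ 0 := by
  obtain ⟨r, y, hy0, hy⟩ := exists_iterate_escapePoly_critical hj he t hc m
  have hε : j PowerSeries.X ≠ 0 := (map_ne_zero_iff j hj).2 PowerSeries.X_ne_zero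
  have he2 : (e : L₀) + 2 ≠ 0 := by exact_mod_cast Nat.succ_ne_zero (e + 1)
  set x := (fun y => (escapePoly e (j PowerSeries.X) (j t)).eval y)^[m + 1] c
  have hx : x ≠ 0 := by
    intro hx
    rw [hx, zero_mul, eq_comm, map_eq_zero_iff j hj] at hy
    exact hy0 (by rw [hy, map_zero])
  rw [derivative_escapePoly]
  simp only [eval_add, eval_mul, eval_pow, eval_C, eval_X]
  refine mul_ne_zero hx fun h => ?_
  have h1 : j (((e : PowerSeries L₀) + 2) * y ^ e + 2 * PowerSeries.X ^ ((r + 1) * e)) = 0 := by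
    simp only [map_add, map_mul, map_pow, map_natCast, map_ofNat]
    rw [← hy]
    field_simp at h
    linear_combination (j PowerSeries.X ^ ((r + 1) * e)) * h
  rw [map_eq_zero_iff j hj] at h1
  have h2 := congrArg (PowerSeries.constantCoeff (R := L₀)) h1
  have h3 : (r + 1) * e ≠ 0 := mul_ne_zero (Nat.succ_ne_zero r) he
  simp only [map_add, map_mul, map_pow, map_natCast, map_ofNat, PowerSeries.constantCoeff_X,
    zero_pow h3, mul_zero, add_zero, map_zero] at h2
  exact mul_ne_zero he2 (pow_ne_zero _ hy0) h2

/-- The parameter `t` is the Hensel lift of a simple Gleason root. Exact period and transversality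
are read off modulo `ε`; the other critical points escape. -/
theorem exists_isTransversePeriodic_escapePoly [CharZero L₀] [IsAlgClosed L₀]
    (hj : Function.Injective j) (he : e ≠ 0) (n : ℕ) :
    ∃ p w : L[X], p.Monic ∧ p.natDegree = e + 2 ∧ IsTransversePeriodic p w n := by
  have hε : j PowerSeries.X ≠ 0 := (map_ne_zero_iff j hj).2 PowerSeries.X_ne_zero
  have hcz : CharZero L :=
    charZero_of_injective_ringHom (f := j.comp PowerSeries.C) (j.comp PowerSeries.C).injective
  obtain ⟨t₀, ht₀, ht₀n⟩ := exists_gleason_root (L := L₀) n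
  obtain ⟨t, ht, rfl⟩ := exists_root_powerSeries_of_simple_root (gleasonDeform L₀ e (n + 1)) t₀
    (by rw [map_constantCoeff_gleasonDeform he, ht₀])
    (by
      rw [map_constantCoeff_gleasonDeform he]
      exact eval_derivative_gleason_ne_zero ht₀)
  refine ⟨escapePoly e (j PowerSeries.X) (j t),
    C ((e : L) + 2) * X ^ e + C (2 * (j PowerSeries.X ^ e)⁻¹), monic_escapePoly _ _ _ he,
    natDegree_escapePoly _ _ _ he, derivative_escapePoly _ _ _, ?_, fun c hc => ?_,
    fun c hc m => eval_derivative_iterate_escapePoly_ne_zero hj he t (by simpa using hc) m,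
    fun m hm h => ?_, ?_, ?_⟩
  · simp [he, hε]
  · rw [derivative_escapePoly] at hc
    rw [eval_derivative_derivative_escapePoly]
    simp only [eval_add, eval_mul, eval_pow, eval_C, eval_X, mul_eq_zero] at hc
    rcases hc with rfl | hc
    · simp [he, hε]
    · have h1 : ((e : L) + 2) * (e + 1) * c ^ e + 2 * (j PowerSeries.X ^ e)⁻¹ =
          -(2 * e * (j PowerSeries.X ^ e)⁻¹) := by
        linear_combination ((e : L) + 1) * hc
      rw [h1]
      simp [he, hε]
  · rw [iterate_escapePoly_zero hj, eval_derivative_escapePoly hj, map_eq_zero_iff j hj] at h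
    have h2 := congrArg (PowerSeries.constantCoeff (R := L₀)) h
    simp only [map_add, map_mul, map_pow, map_natCast, map_ofNat, map_zero,
      PowerSeries.constantCoeff_X, zero_pow (mul_ne_zero he (Nat.succ_ne_zero e)), mul_zero,
      zero_mul, zero_add] at h2
    rw [← eval_map_apply, map_constantCoeff_gleasonDeform he] at h2
    exact mul_ne_zero (ht₀n m hm) two_ne_zero h2
  · rw [iterate_escapePoly_zero hj, ht, map_zero, mul_zero]
  · obtain ⟨D, hD, hD0⟩ := exists_orbitDeriv_escapePoly (e := e) hj he t (n + 1)
    rw [hD, Ne, map_eq_zero_iff j hj]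
    rintro rfl
    rw [map_zero] at hD0
    exact eval_derivative_gleason_ne_zero ht₀ hD0.symm

end Escape

/-- Some Galois automorphism interchanges two leaves of the tree and fixes all the others. -/
theorem exists_gal_swap {K : Type*} [Field K] [CharZero K] {d : ℕ} (hd : 2 ≤ d) (n : ℕ) :
    ∃ (a b : critPreimages (genericMonic K d) (n + 1)) (g : AlgebraicClosure (GenericField K d)
      ≃ₐ[GenericField K d] AlgebraicClosure (GenericField K d)), a ≠ b ∧ galMap g a = b ∧
      galMap g b = a ∧ ∀ x, x ≠ a → x ≠ b → galMap g x = x := by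
  have h0 : CharZero (AlgebraicClosure K) :=
    charZero_of_injective_algebraMap (algebraMap K _).injective
  obtain ⟨e, rfl⟩ : ∃ e, d = e + 2 := ⟨d - 2, by omega⟩
  rcases eq_or_ne e 0 with rfl | he
  -- In degree two `0` is the only critical point, and no escape argument is needed.
  · obtain ⟨p, w, hp, hpd, h⟩ := exists_isTransversePeriodic_quadratic (L := AlgebraicClosure K) n
    exact h.exists_gal_swap hd hp hpd
  · have h1 : CharZero (PowerSeries (AlgebraicClosure K)) := charZero_of_injective_algebraMap
      (PowerSeries.C_injective (R := AlgebraicClosure K))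
    have h2 : CharZero (FractionRing (PowerSeries (AlgebraicClosure K))) :=
      charZero_of_injective_algebraMap
        (IsFractionRing.injective (PowerSeries (AlgebraicClosure K)) _)
    have h3 : CharZero (AlgebraicClosure (FractionRing (PowerSeries (AlgebraicClosure K)))) :=
      charZero_of_injective_algebraMap
        (algebraMap (FractionRing (PowerSeries (AlgebraicClosure K))) _).injective
    obtain ⟨p, w, hp, hpd, h⟩ := exists_isTransversePeriodic_escapePoly
      (j := (algebraMap (FractionRing (PowerSeries (AlgebraicClosure K)))
        (AlgebraicClosure (FractionRing (PowerSeries (AlgebraicClosure K))))).comp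
          (algebraMap (PowerSeries (AlgebraicClosure K)) _))
      ((algebraMap (FractionRing (PowerSeries (AlgebraicClosure K))) _).injective.comp
        (IsFractionRing.injective (PowerSeries (AlgebraicClosure K)) _)) he n
    exact h.exists_gal_swap hd hp hpd

/-! ### Tree automorphisms and the Galois group of the critical field -/

section TreeAut

variable {F : Type*} [Field F] {f : F[X]}

/-- The action of the absolute Galois group on the roots of `f' ∘ f^n`. -/
def galPerm (f : F[X]) (n : ℕ) :
    (AlgebraicClosure F ≃ₐ[F] AlgebraicClosure F) →* Equiv.Perm (critPreimages f n) where
  toFun g :=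
    { toFun := galMap g
      invFun := galMap g.symm
      left_inv := fun v => Subtype.ext (g.symm_apply_apply v)
      right_inv := fun v => Subtype.ext (g.apply_symm_apply v) }
  map_one' := rfl
  map_mul' _ _ := rfl

theorem aeval_galMap {n : ℕ} (g : AlgebraicClosure F ≃ₐ[F] AlgebraicClosure F)
    (x : critPreimages f n) : aeval (galMap g x : AlgebraicClosure F) f =
      g (aeval (x : AlgebraicClosure F) f) :=
  aeval_algHom_apply g (x : AlgebraicClosure F) f

/-- A tree automorphism is determined by its action on the leaves. -/
theorem treeAut_ext (hchild : ∀ (k : ℕ) (w : critPreimages f k), ∃ v : critPreimages f (k + 1),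
    aeval (v : AlgebraicClosure F) f = w) {n : ℕ} {σ τ : treeAut f n}
    (h : σ.1 (Fin.last n) = τ.1 (Fin.last n)) : σ = τ := by
  refine Subtype.ext (funext fun k => ?_)
  induction k using Fin.reverseInduction with
  | last => exact h
  | cast i ih =>
    ext w
    obtain ⟨v, hv⟩ := hchild i w
    rw [← (σ.2 i v w).2 hv, ← (τ.2 i v w).2 hv, ih]

theorem normal_critField (n : ℕ) : Normal F (critField f n) := by
  rw [IntermediateField.normal_iff_forall_map_le']
  intro σ
  rw [critField, IntermediateField.adjoin_map]
  refine IntermediateField.adjoin.mono _ _ _ ?_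
  rintro _ ⟨x, hx, rfl⟩
  exact apply_mem_critPreimages f n σ hx

theorem arborealRep_eq_one_iff (hchild : ∀ (k : ℕ) (w : critPreimages f k),
    ∃ v : critPreimages f (k + 1), aeval (v : AlgebraicClosure F) f = w) {n : ℕ}
    (g : AlgebraicClosure F ≃ₐ[F] AlgebraicClosure F) :
    arborealRep f n g = 1 ↔ ∀ x ∈ critField f n, g x = x := by
  constructor
  · intro h x hx
    induction hx using IntermediateField.adjoin_induction with
    | mem x hx =>
      have h1 : galPerm f n g = 1 := congrArg (fun σ => σ.1 (Fin.last n)) h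
      exact congrArg (fun π => ((π ⟨x, hx⟩ : critPreimages f n) : AlgebraicClosure F)) h1
    | algebraMap x => exact g.commutes x
    | add x y _ _ hx hy => rw [map_add, hx, hy]
    | inv x _ hx => rw [map_inv₀, hx]
    | mul x y _ _ hx hy => rw [map_mul, hx, hy]
  · intro h
    refine treeAut_ext hchild ?_
    ext x
    exact h x (IntermediateField.subset_adjoin _ _ x.2)

/-- Two surjective homomorphisms with the same kernel have isomorphic targets. -/
theorem exists_mulEquiv_of_ker_eq {G G₁ G₂ : Type*} [Group G] [Group G₁] [Group G₂]
    (φ₁ : G →* G₁) (φ₂ : G →* G₂) (h₁ : Function.Surjective φ₁) (h₂ : Function.Surjective φ₂)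
    (h : φ₁.ker = φ₂.ker) : ∃ φ : G₁ ≃* G₂, ∀ g, φ (φ₁ g) = φ₂ g := by
  refine ⟨(QuotientGroup.quotientKerEquivOfSurjective φ₁ h₁).symm.trans
    ((QuotientGroup.quotientMulEquivOfEq h).trans
      (QuotientGroup.quotientKerEquivOfSurjective φ₂ h₂)), fun g => ?_⟩
  have : (QuotientGroup.quotientKerEquivOfSurjective φ₁ h₁).symm (φ₁ g) = (g : G ⧸ φ₁.ker) :=
    (MulEquiv.symm_apply_eq _).2 rfl
  rw [MulEquiv.trans_apply, this]
  rfl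

/-- Restriction to the normal extension `critField` and the arboreal representation are both
surjective, with the same kernel: a tree automorphism is determined by the leaves, which generate
the field. -/
theorem exists_mulEquiv_treeAut (hchild : ∀ (k : ℕ) (w : critPreimages f k),
    ∃ v : critPreimages f (k + 1), aeval (v : AlgebraicClosure F) f = w) {n : ℕ}
    (hsurj : Function.Surjective (arborealRep f n)) :
    ∃ φ : Gal(critField f n / F) ≃* treeAut f n,
      ∀ (σ : Gal(critField f n / F)) (τ : Gal(AlgebraicClosure F / F)),
        (∀ x : critField f n, τ (x : AlgebraicClosure F) = (σ x : AlgebraicClosure _)) →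
        φ σ = arborealRep f n τ := by
  have := normal_critField (f := f) n
  have hres : ∀ (τ : Gal(AlgebraicClosure F / F)) (x : critField f n),
      (AlgEquiv.restrictNormalHom (critField f n) τ x : AlgebraicClosure F) = τ x :=
    fun τ x => AlgEquiv.restrictNormal_commutes τ (critField f n) x
  obtain ⟨φ, hφ⟩ := exists_mulEquiv_of_ker_eq
    (AlgEquiv.restrictNormalHom (critField f n) :
      Gal(AlgebraicClosure F / F) →* Gal(critField f n / F)) (arborealRep f n)
    (AlgEquiv.restrictNormalHom_surjective _) hsurj (by
      ext τ
      rw [MonoidHom.mem_ker, MonoidHom.mem_ker, arborealRep_eq_one_iff hchild]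
      constructor
      · intro h x hx
        rw [← hres τ ⟨x, hx⟩, h]
        rfl
      · intro h
        ext x
        rw [hres, h x x.2]
        rfl)
  refine ⟨φ, fun σ τ h => ?_⟩
  have : AlgEquiv.restrictNormalHom (critField f n) τ = σ := by
    ext x
    rw [hres, h]
  rw [← this, hφ]

end TreeAut

/-! ### Surjectivity of the arboreal representation -/

section Surjectivity

variable {K : Type*} [Field K] [CharZero K] {d : ℕ}

theorem exists_child (hd : 2 ≤ d) (k : ℕ) (w : critPreimages (genericMonic K d) k) :
    ∃ v : critPreimages (genericMonic K d) (k + 1),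
      aeval (v : AlgebraicClosure (GenericField K d)) (genericMonic K d) = w := by
  have h := ncard_children hd w
  obtain ⟨v, hv⟩ := Set.nonempty_of_ncard_ne_zero (by rw [h]; omega :
    {x : critPreimages (genericMonic K d) (k + 1) |
      aeval (x : AlgebraicClosure (GenericField K d)) (genericMonic K d) = w}.ncard ≠ 0)
  exact ⟨v, hv⟩

open Classical in
theorem swap_mem_range_galPerm (hd : 2 ≤ d) {n : ℕ}
    (x y : critPreimages (genericMonic K d) (n + 1)) (hxy : x ≠ y)
    (hs : aeval (y : AlgebraicClosure (GenericField K d)) (genericMonic K d) =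
      aeval (x : AlgebraicClosure (GenericField K d)) (genericMonic K d)) :
    Equiv.swap x y ∈ (galPerm (genericMonic K d) (n + 1)).range := by
  obtain ⟨a, b, g, hab, hga, hgb, hg⟩ := exists_gal_swap (K := K) hd n
  have hga' : aeval (b : AlgebraicClosure (GenericField K d)) (genericMonic K d) =
      g (aeval (a : AlgebraicClosure (GenericField K d)) (genericMonic K d)) := by
    rw [← hga, aeval_galMap]
  have hsib : aeval (b : AlgebraicClosure (GenericField K d)) (genericMonic K d) =
      aeval (a : AlgebraicClosure (GenericField K d)) (genericMonic K d) := by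
    -- If `a` and `b` were not siblings, another sibling `v` of `a` would be fixed. Then so would
    -- the common parent of `v` and `a`, yet `g` moves it to the parent of `b`.
    by_contra hne
    have hcard := ncard_children hd (n := n)
      ⟨aeval (a : AlgebraicClosure (GenericField K d)) (genericMonic K d),
        aeval_mem_critPreimages_iff.2 a.2⟩
    obtain ⟨v, hv, hva⟩ := Set.exists_ne_of_one_lt_ncard (by rw [hcard]; omega) a
    have hv' : aeval (v : AlgebraicClosure (GenericField K d)) (genericMonic K d) =
      aeval (a : AlgebraicClosure (GenericField K d)) (genericMonic K d) := hv
    have hvb : v ≠ b := by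
      rintro rfl
      exact hne hv'
    apply hne
    rw [hga', ← hv', ← aeval_galMap, hg v hva hvb]
  have hgp : galPerm (genericMonic K d) (n + 1) g = Equiv.swap a b := by
    ext1 v
    change galMap g v = _
    by_cases hva : v = a
    · rw [hva, Equiv.swap_apply_left, hga]
    · by_cases hvb : v = b
      · rw [hvb, Equiv.swap_apply_right, hgb]
      · rw [Equiv.swap_apply_of_ne_of_ne hva hvb, hg v hva hvb]
  obtain ⟨h₁, hh₁⟩ := exists_galMap_eq hd a x
  have hb : galMap h₁ b ≠ x := by
    rw [← hh₁]
    exact fun h => hab ((galPerm (genericMonic K d) (n + 1) h₁).injective h).symm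
  -- Transitivity moves `a` to `x`; then the stabilizer of `x` moves the image of `b` to `y`.
  -- Conjugation turns the swap of `a, b` into that of `x, y`.
  obtain ⟨h₂, hx₂, hy₂⟩ := exists_gal_fix_map_sibling hd x (galMap h₁ b) y hb hxy.symm (by
    rw [← hh₁, aeval_galMap, aeval_galMap, hsib]) hs
  refine ⟨(h₂ * h₁) * g * (h₂ * h₁)⁻¹, ?_⟩
  rw [map_mul, map_mul, map_inv, hgp, ← Equiv.swap_apply_apply]
  congr 1
  · change galMap h₂ (galMap h₁ a) = x
    rw [hh₁, hx₂]

/-- A permutation preserving every set of siblings lies in the group generated by transpositions of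
siblings: it keeps each point in its orbit under that group. -/
theorem mem_range_galPerm (hd : 2 ≤ d) {n : ℕ}
    (π : Equiv.Perm (critPreimages (genericMonic K d) (n + 1)))
    (hπ : ∀ x, aeval (π x : AlgebraicClosure (GenericField K d)) (genericMonic K d) =
      aeval (x : AlgebraicClosure (GenericField K d)) (genericMonic K d)) :
    π ∈ (galPerm (genericMonic K d) (n + 1)).range := by
  classical
  have : Finite (critPreimages (genericMonic K d) (n + 1)) :=
    finite_critPreimages (by omega) (n + 1)
  let S : Set (Equiv.Perm (critPreimages (genericMonic K d) (n + 1))) :=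
    {τ | ∃ x y : critPreimages (genericMonic K d) (n + 1), x ≠ y ∧
      aeval (y : AlgebraicClosure (GenericField K d)) (genericMonic K d) =
        aeval (x : AlgebraicClosure (GenericField K d)) (genericMonic K d) ∧ τ = Equiv.swap x y}
  have hS : Subgroup.closure S ≤ (galPerm (genericMonic K d) (n + 1)).range := by
    rw [Subgroup.closure_le]
    rintro _ ⟨x, y, hxy, hs, rfl⟩
    exact swap_mem_range_galPerm hd x y hxy hs
  refine hS ((mem_closure_isSwap ?_).2 ⟨Set.toFinite _, fun x => ?_⟩)
  · rintro _ ⟨x, y, hxy, -, rfl⟩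
    exact ⟨x, y, hxy, rfl⟩
  · by_cases hx : x = π x
    · rw [← hx]
      exact MulAction.mem_orbit_self x
    · exact ⟨⟨Equiv.swap x (π x), Subgroup.subset_closure ⟨x, π x, hx, hπ x, rfl⟩⟩,
        Equiv.swap_apply_left x (π x)⟩

theorem arborealRep_surjective (hd : 2 ≤ d) (n : ℕ) :
    Function.Surjective (arborealRep (genericMonic K d) n) := by
  induction n with
  | zero =>
    intro σ
    obtain ⟨g, hg⟩ := exists_gal_perm_critical_points (K := K) hd (σ.1 (Fin.last 0))
    exact ⟨g, treeAut_ext (exists_child hd) (Equiv.ext hg)⟩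
  | succ n ih =>
    intro σ
    obtain ⟨g, hg⟩ := ih ⟨fun k => σ.1 k.castSucc, fun k => σ.2 k.castSucc⟩
    have hgn : galPerm (genericMonic K d) n g = σ.1 (Fin.last n).castSucc :=
      congrArg (fun τ => τ.1 (Fin.last n)) hg
    let π : Equiv.Perm (critPreimages (genericMonic K d) (n + 1)) := σ.1 (Fin.last (n + 1))
    obtain ⟨h, hh⟩ := mem_range_galPerm hd
      (π * (galPerm (genericMonic K d) (n + 1) g)⁻¹) (fun x => by
        obtain ⟨v, rfl⟩ := (galPerm (genericMonic K d) (n + 1) g).surjective x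
        let w : critPreimages (genericMonic K d) n :=
          ⟨aeval (v : AlgebraicClosure (GenericField K d)) (genericMonic K d),
            aeval_mem_critPreimages_iff.2 v.2⟩
        have h1 := (σ.2 (Fin.last n) v w).2 rfl
        have h2 : (π * (galPerm (genericMonic K d) (n + 1) g)⁻¹)
            (galPerm (genericMonic K d) (n + 1) g v) = π v :=
          congrArg π (Equiv.symm_apply_apply _ v)
        rw [h2]
        refine h1.trans ?_
        rw [← hgn]
        exact (aeval_galMap g v).symm)
    refine ⟨h * g, treeAut_ext (exists_child hd) ?_⟩
    change galPerm (genericMonic K d) (n + 1) (h * g) = π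
    rw [map_mul, hh, inv_mul_cancel_right]

end Surjectivity

/-! ### Wreath products as automorphism groups of common-prefix relations -/

section RelAut

/-- The permutations of `W` that preserve each relation of a family. -/
def relAut {W : Type*} (E : ℕ → W → W → Prop) : Subgroup (Equiv.Perm W) where
  carrier := {π | ∀ j a b, E j (π a) (π b) ↔ E j a b}
  mul_mem' := fun {π ρ} hπ hρ j a b => (hπ j (ρ a) (ρ b)).trans (hρ j a b)
  one_mem' := fun _ _ _ => Iff.rfl
  inv_mem' := fun {π} hπ j a b => by
    have h := hπ j (π⁻¹ a) (π⁻¹ b)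
    have ha : π (π⁻¹ a) = a := π.apply_symm_apply a
    have hb : π (π⁻¹ b) = b := π.apply_symm_apply b
    rw [ha, hb] at h
    exact h.symm

theorem relAut_mulEquiv_of_equiv {W W' : Type*} {E : ℕ → W → W → Prop} {E' : ℕ → W' → W' → Prop}
    (e : W ≃ W') (h : ∀ j a b, E' j (e a) (e b) ↔ E j a b) :
    Nonempty (relAut E ≃* relAut E') := by
  have hsymm : ∀ j a b, E j (e.symm a) (e.symm b) ↔ E' j a b := fun j a b => by
    rw [← h, e.apply_symm_apply, e.apply_symm_apply]
  refine ⟨{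
    toFun := fun π => ⟨(e.symm.trans π.1).trans e, fun j a b => ?_⟩
    invFun := fun π => ⟨(e.trans π.1).trans e.symm, fun j a b => ?_⟩
    left_inv := fun π => by ext a; simp
    right_inv := fun π => by ext a; simp
    map_mul' := fun π ρ => by ext a; simp }⟩
  · exact (h _ _ _).trans ((π.2 _ _ _).trans (hsymm _ _ _))
  · exact (hsymm _ _ _).trans ((π.2 _ _ _).trans (h _ _ _))

/-- The family of relations on `m` copies of `W` whose first member is trivial, whose second
member is to be in the same copy if the first member of `E` is trivial, and so on. -/
def consRel (m : ℕ) {W : Type*} (E : ℕ → W → W → Prop) : ℕ → Fin m × W → Fin m × W → Prop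
  | 0, _, _ => True
  | j + 1, a, b => a.1 = b.1 ∧ E j a.2 b.2

variable {m : ℕ} {W : Type} {E : ℕ → W → W → Prop}

/-- The imprimitive action of the wreath product. -/
def wreathAction (m : ℕ) (E : ℕ → W → W → Prop) :
    SymWreath m (relAut E) →* Equiv.Perm (Fin m × W) where
  toFun g :=
    { toFun := fun a => (g.right a.1, (g.left (g.right a.1)).1 a.2)
      invFun := fun a => (g.right.symm a.1, (g.left a.1).1.symm a.2)
      left_inv := fun a => by simp
      right_inv := fun a => by simp }
  map_one' := by
    ext a <;> simp
  map_mul' g h := by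
    ext a
    · simp
    · have h1 : mulAutArrow g.right h.left (g.right (h.right a.1)) = h.left (h.right a.1) :=
        congrArg h.left (g.right.symm_apply_apply _)
      change ((g.left * mulAutArrow g.right h.left) (g.right (h.right a.1))).1 a.2 =
        (g.left (g.right (h.right a.1))).1 ((h.left (h.right a.1)).1 a.2)
      rw [Pi.mul_apply, h1]
      rfl

theorem wreathAction_injective [Nonempty W] : Function.Injective (wreathAction m E) := by
  obtain ⟨w⟩ := ‹Nonempty W›
  intro g h hgh
  have h1 : ∀ a, wreathAction m E g a = wreathAction m E h a := fun a => by rw [hgh]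
  have hr : g.right = h.right := Equiv.ext fun i => congrArg Prod.fst (h1 (i, w))
  refine SemidirectProduct.ext (funext fun i => ?_) hr
  ext v
  have h2 := congrArg Prod.snd (h1 (g.right.symm i, v))
  have h3 : g.right (g.right.symm i) = i := g.right.apply_symm_apply i
  change (g.left (g.right _)).1 v = (h.left (h.right _)).1 v at h2
  rw [← hr, h3] at h2
  exact h2

/-- As `E 0` is trivial, relation `1` of `consRel` says exactly "same copy". Preserving it yields a
permutation of the copies, and the later relations put the action between copies into `relAut E`. -/
theorem range_wreathAction [Nonempty W] (hE : ∀ a b, E 0 a b) :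
    (wreathAction m E).range = relAut (consRel m E) := by
  obtain ⟨w⟩ := ‹Nonempty W›
  apply le_antisymm
  · rintro _ ⟨g, rfl⟩ j a b
    cases j with
    | zero => exact Iff.rfl
    | succ j =>
      change (g.right a.1 = g.right b.1 ∧ E j ((g.left (g.right a.1)).1 a.2)
        ((g.left (g.right b.1)).1 b.2)) ↔ a.1 = b.1 ∧ E j a.2 b.2
      rw [g.right.injective.eq_iff]
      refine and_congr_right fun h => ?_
      rw [h]
      exact (g.left _).2 j _ _
  · intro π hπ
    have hfst : ∀ ρ ∈ relAut (consRel m E), ∀ a b, a.1 = b.1 → (ρ a).1 = (ρ b).1 :=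
      fun ρ hρ a b hab => ((hρ 1 a b).2 ⟨hab, hE _ _⟩).1
    have hπ' := inv_mem hπ
    let σ : Equiv.Perm (Fin m) :=
      { toFun := fun i => (π (i, w)).1
        invFun := fun i => (π⁻¹ (i, w)).1
        left_inv := fun i => by
          refine (hfst _ hπ' ((π (i, w)).1, w) (π (i, w)) rfl).trans ?_
          exact congrArg Prod.fst (π.symm_apply_apply (i, w))
        right_inv := fun i => by
          refine (hfst _ hπ ((π⁻¹ (i, w)).1, w) (π⁻¹ (i, w)) rfl).trans ?_
          exact congrArg Prod.fst (π.apply_symm_apply (i, w)) }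
    have hσ : ∀ a, (π a).1 = σ a.1 := fun a => hfst _ hπ a (a.1, w) rfl
    have hσ' : ∀ a, (π⁻¹ a).1 = σ.symm a.1 := fun a => hfst _ hπ' a (a.1, w) rfl
    let h : Fin m → relAut E := fun i =>
      ⟨{ toFun := fun v => (π (σ.symm i, v)).2
         invFun := fun v => (π⁻¹ (i, v)).2
         left_inv := fun v => by
          have h1 : (i, (π (σ.symm i, v)).2) = π (σ.symm i, v) :=
            Prod.ext (by rw [hσ, σ.apply_symm_apply]) rfl
          exact congrArg Prod.snd (π.symm_apply_eq.2 h1)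
         right_inv := fun v => by
          have h1 : (σ.symm i, (π⁻¹ (i, v)).2) = π⁻¹ (i, v) := Prod.ext (by rw [hσ']) rfl
          exact congrArg Prod.snd ((congrArg π h1).trans (π.apply_symm_apply _)) }, fun j a b => by
        have h1 := hπ (j + 1) (σ.symm i, a) (σ.symm i, b)
        simp only [consRel, hσ, true_and] at h1
        exact h1⟩
    refine ⟨⟨h, σ⟩, ?_⟩
    ext1 a
    refine Prod.ext (hσ a).symm ?_
    change (π (σ.symm (σ a.1), a.2)).2 = (π a).2
    rw [σ.symm_apply_apply]

theorem symWreath_mulEquiv_relAut [Nonempty W] (hE : ∀ a b, E 0 a b) :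
    Nonempty (SymWreath m (relAut E) ≃* relAut (consRel m E)) :=
  ⟨(MonoidHom.ofInjective wreathAction_injective).trans
    (MulEquiv.subgroupCongr (range_wreathAction hE))⟩

theorem symWreath_congr (m : ℕ) {H H' : Type} [Group H] [Group H'] (e : H ≃* H') :
    Nonempty (SymWreath m H ≃* SymWreath m H') :=
  ⟨SemidirectProduct.congr (MulEquiv.piCongrRight fun _ => e) (MulEquiv.refl _) fun _ => rfl⟩

/-- Agreement of the first `j` letters of two words. -/
def wordRel (d n j : ℕ) (w w' : Fin n → Fin d) : Prop :=
  ∀ i : Fin n, (i : ℕ) < j → w i = w' i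

theorem iterSymWreath_mulEquiv_relAut {d : ℕ} (hd : d ≠ 0) (n : ℕ) :
    Nonempty (IterSymWreath d n ≃* relAut (wordRel d n)) := by
  induction n with
  | zero =>
    have h1 : Unique (IterSymWreath d 0) := inferInstanceAs (Unique PUnit)
    have h2 : Unique (relAut (wordRel d 0)) :=
      ⟨⟨1⟩, fun π => Subtype.ext (Equiv.ext fun w => Subsingleton.elim _ _)⟩
    exact ⟨MulEquiv.ofUnique⟩
  | succ n ih =>
    have : NeZero d := ⟨hd⟩
    obtain ⟨e₁⟩ := ih
    obtain ⟨e₂⟩ := symWreath_congr d e₁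
    obtain ⟨e₃⟩ := symWreath_mulEquiv_relAut (m := d) (E := wordRel d n)
      (fun a b i hi => absurd hi (Nat.not_lt_zero _))
    obtain ⟨e₄⟩ := relAut_mulEquiv_of_equiv (E := consRel d (wordRel d n))
      (E' := wordRel d (n + 1)) (Fin.consEquiv fun _ => Fin d) (fun j a b => by
        cases j with
        | zero => simp [wordRel, consRel]
        | succ j => simp [wordRel, consRel, Fin.forall_fin_succ, Fin.consEquiv])
    exact ⟨(e₂.trans e₃).trans e₄⟩

/-- A permutation of a tower preserves its relations if and only if it descends to a permutation
of the base of the tower that preserves its relations. -/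
theorem mem_relAut_iff_exists_descent {X' X : Type*} {p : X' → X} (hp : Function.Surjective p)
    {R' : ℕ → X' → X' → Prop} {R : ℕ → X → X → Prop} {N : ℕ}
    (hle : ∀ j ≤ N, ∀ x y, R' j x y ↔ R j (p x) (p y)) (hgt : ∀ j > N, ∀ x y, R' j x y ↔ x = y)
    (hN : ∀ j ≥ N, ∀ x y, R j x y ↔ x = y) {π : Equiv.Perm X'} :
    π ∈ relAut R' ↔ ∃ π' ∈ relAut R, ∀ x, p (π x) = π' (p x) := by
  constructor
  · intro hπ
    have key : ∀ ρ ∈ relAut R', ∀ x y, p x = p y → p (ρ x) = p (ρ y) := by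
      intro ρ hρ x y hxy
      -- Downstairs relation `N` is equality, so upstairs it says "same image"; a permutation
      -- preserving it descends.
      rw [← hN N le_rfl, ← hle N le_rfl] at hxy ⊢
      exact (hρ N x y).2 hxy
    let s := Function.surjInv hp
    have hs : ∀ w, p (s w) = w := Function.surjInv_eq hp
    let π' : Equiv.Perm X :=
      { toFun := fun w => p (π (s w))
        invFun := fun w => p (π⁻¹ (s w))
        left_inv := fun w => by
          refine (key _ (inv_mem hπ) _ (π (s w)) (hs _)).trans ?_
          exact (congrArg p (π.symm_apply_apply (s w))).trans (hs w)
        right_inv := fun w => by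
          refine (key _ hπ _ (π⁻¹ (s w)) (hs _)).trans ?_
          exact (congrArg p (π.apply_symm_apply (s w))).trans (hs w) }
    have hπ' : ∀ x, p (π x) = π' (p x) := fun x => key _ hπ _ _ (hs _).symm
    refine ⟨π', fun j a b => ?_, hπ'⟩
    obtain ⟨x, rfl⟩ := hp a
    obtain ⟨y, rfl⟩ := hp b
    rcases le_total j N with hj | hj
    · rw [← hπ', ← hπ', ← hle j hj, ← hle j hj]
      exact hπ j x y
    · rw [hN j hj, hN j hj, π'.injective.eq_iff]
  · rintro ⟨π', hπ', h⟩ j x y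
    rcases le_or_gt j N with hj | hj
    · rw [hle j hj, hle j hj, h, h]
      exact hπ' j _ _
    · rw [hgt j hj, hgt j hj, π.injective.eq_iff]

theorem consRel_wordRel_iff_eq {m d n j : ℕ} (hj : n < j) (a b : Fin m × (Fin n → Fin d)) :
    consRel m (wordRel d n) j a b ↔ a = b := by
  obtain ⟨j, rfl⟩ : ∃ i, j = i + 1 := ⟨j - 1, by omega⟩
  rw [consRel, Prod.ext_iff, wordRel]
  refine and_congr_right fun _ => ⟨fun h => funext fun i => h i (by omega), fun h i _ => by rw [h]⟩

theorem consRel_wordRel_snoc {m d n j : ℕ} (hj : j ≤ n + 1) (a b : Fin m × (Fin n → Fin d))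
    (u v : Fin d) :
    consRel m (wordRel d (n + 1)) j (a.1, Fin.snoc (α := fun _ => Fin d) a.2 u)
      (b.1, Fin.snoc (α := fun _ => Fin d) b.2 v) ↔ consRel m (wordRel d n) j a b := by
  cases j with
  | zero => exact Iff.rfl
  | succ j =>
    refine and_congr_right fun _ => ⟨fun h i hi => ?_, fun h i => ?_⟩
    · simpa using h i.castSucc hi
    · cases i using Fin.lastCases with
      | last => intro hi; simp at hi; omega
      | cast i => intro hi; simpa using h i hi

end RelAut

/-! ### The action of tree automorphisms on the leaves -/

section Leaves

variable {F : Type*} [Field F] {f : F[X]}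

/-- The action of a tree automorphism on the leaves. -/
def leafPerm (f : F[X]) (n : ℕ) : treeAut f n →* Equiv.Perm (critPreimages f n) where
  toFun σ := σ.1 (Fin.last n)
  map_one' := rfl
  map_mul' _ _ := rfl

/-- The vertex below a given vertex of the tree. -/
def parent {n : ℕ} (x : critPreimages f (n + 1)) : critPreimages f n :=
  ⟨aeval (x : AlgebraicClosure F) f, aeval_mem_critPreimages_iff.2 x.2⟩

theorem mem_range_leafPerm_zero (π : Equiv.Perm (critPreimages f 0)) :
    π ∈ (leafPerm f 0).range :=
  ⟨⟨Fin.lastCases (motive := fun k : Fin 1 => Equiv.Perm (critPreimages f (k : ℕ))) π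
    fun i => i.elim0, fun k => k.elim0⟩, rfl⟩

theorem mem_range_leafPerm_succ {n : ℕ} (π : Equiv.Perm (critPreimages f (n + 1))) :
    π ∈ (leafPerm f (n + 1)).range ↔
      ∃ π' ∈ (leafPerm f n).range, ∀ x, parent (π x) = π' (parent x) := by
  constructor
  · rintro ⟨σ, rfl⟩
    refine ⟨_, ⟨⟨fun k => σ.1 k.castSucc, fun k => σ.2 k.castSucc⟩, rfl⟩, fun x => ?_⟩
    exact Subtype.ext ((σ.2 (Fin.last n) x (parent x)).2 rfl)
  · rintro ⟨_, ⟨σ, rfl⟩, h⟩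
    let τ : (k : Fin (n + 2)) → Equiv.Perm (critPreimages f (k : ℕ)) :=
      Fin.lastCases (motive := fun k : Fin (n + 2) => Equiv.Perm (critPreimages f (k : ℕ))) π
        fun k => σ.1 k
    have hlast : τ (Fin.last (n + 1)) = π := Fin.lastCases_last ..
    have hcast : ∀ k, τ (Fin.castSucc k) = σ.1 k := fun k => Fin.lastCases_castSucc ..
    refine ⟨⟨τ, fun k => ?_⟩, hlast⟩
    cases k using Fin.lastCases with
    | last =>
      intro v w
      have h1 : aeval (τ (Fin.last n).succ v : AlgebraicClosure F) f =
          ((σ.1 (Fin.last n)) (parent v) : AlgebraicClosure F) := by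
        have h2 : τ (Fin.last n).succ = π := hlast
        rw [h2]
        exact congrArg Subtype.val (h v)
      rw [h1, hcast]
      exact Subtype.val_injective.eq_iff.trans ((σ.1 (Fin.last n)).injective.eq_iff.trans
        Subtype.ext_iff)
    | cast k =>
      intro v w
      have h1 := σ.2 k v w
      have h2 : τ k.castSucc.succ = σ.1 k.succ := hcast k.succ
      rw [hcast, h2]
      exact h1

end Leaves

/-! ### Labelling leaves by words -/

section Labels

variable {K : Type*} [Field K] [CharZero K] {d : ℕ}

/-- The tree grows by letters appended at the end, whereas the wreath product splits off the first
letter. Common-prefix relations fit both recursions, which is why the groups are compared through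
them. The choice of bijections from the fibres to `Fin d` is arbitrary. -/
theorem exists_label (hd : 2 ≤ d) (n : ℕ) :
    ∃ l : critPreimages (genericMonic K d) n ≃ Fin (d - 1) × (Fin n → Fin d),
      (leafPerm (genericMonic K d) n).range =
        relAut (fun j x y => consRel (d - 1) (wordRel d n) j (l x) (l y)) := by
  induction n with
  | zero =>
    have h0 : Finite (critPreimages (genericMonic K d) 0) := finite_critPreimages (by omega) 0
    have hcard : Nat.card (critPreimages (genericMonic K d) 0) =
        Nat.card (Fin (d - 1) × (Fin 0 → Fin d)) := by
      rw [Nat.card_coe_set_eq, ncard_critPreimages hd]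
      simp
    obtain ⟨l⟩ := Finite.card_eq.1 hcard
    refine ⟨l, ?_⟩
    ext π
    refine ⟨fun _ j x y => ?_, fun _ => mem_range_leafPerm_zero π⟩
    cases j with
    | zero => exact Iff.rfl
    | succ j =>
      beta_reduce
      rw [consRel_wordRel_iff_eq (Nat.succ_pos j), consRel_wordRel_iff_eq (Nat.succ_pos j),
        l.injective.eq_iff, l.injective.eq_iff, π.injective.eq_iff]
  | succ n ih =>
    obtain ⟨l, hl⟩ := ih
    have hfib : ∀ w : critPreimages (genericMonic K d) n,
        Nonempty ({x : critPreimages (genericMonic K d) (n + 1) // parent x = w} ≃ Fin d) := by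
      intro w
      have h0 : Finite (critPreimages (genericMonic K d) (n + 1)) :=
        finite_critPreimages (by omega) (n + 1)
      refine Finite.card_eq.1 ?_
      rw [Nat.card_fin]
      refine Eq.trans ?_ (ncard_children hd w)
      rw [← Nat.card_coe_set_eq]
      exact Nat.card_congr (Equiv.subtypeEquivRight fun x => Subtype.ext_iff)
    let c := fun w => (hfib w).some
    let e : critPreimages (genericMonic K d) (n + 1) ≃ critPreimages (genericMonic K d) n × Fin d :=
      ((Equiv.sigmaFiberEquiv parent).symm.trans (Equiv.sigmaCongrRight c)).trans
        (Equiv.sigmaEquivProd _ _)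
    let l' : critPreimages (genericMonic K d) (n + 1) ≃ Fin (d - 1) × (Fin (n + 1) → Fin d) :=
      { toFun := fun x => ((l (e x).1).1,
          Fin.snoc (α := fun _ => Fin d) (l (e x).1).2 (e x).2)
        invFun := fun a => e.symm (l.symm (a.1, Fin.init a.2), a.2 (Fin.last n))
        left_inv := fun x => by simp
        right_inv := fun a => by simp }
    refine ⟨l', ?_⟩
    ext π
    rw [mem_range_leafPerm_succ, hl]
    -- A leaf of height `n` has `n + 1` letters, the critical point and `n` choices of preimage, so
    -- relation `n + 1` is equality below and "same parent" above.
    refine (mem_relAut_iff_exists_descent (N := n + 1) (fun w => ?_) (fun j hj x y => ?_)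
      (fun j hj x y => ?_) (fun j hj x y => ?_)).symm
    · obtain ⟨v, hv⟩ := exists_child hd n w
      exact ⟨v, Subtype.ext hv⟩
    · exact consRel_wordRel_snoc hj _ _ _ _
    · rw [consRel_wordRel_iff_eq hj, l'.injective.eq_iff]
    · rw [consRel_wordRel_iff_eq hj, l.injective.eq_iff]

theorem treeAut_mulEquiv_symWreath (hd : 2 ≤ d) (n : ℕ) :
    Nonempty (treeAut (genericMonic K d) n ≃* SymWreath (d - 1) (IterSymWreath d n)) := by
  have : NeZero d := ⟨by omega⟩
  obtain ⟨l, hl⟩ := exists_label (K := K) hd n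
  have hinj : Function.Injective (leafPerm (genericMonic K d) n) := fun σ τ h =>
    treeAut_ext (exists_child hd) h
  obtain ⟨e₁⟩ := relAut_mulEquiv_of_equiv (E' := consRel (d - 1) (wordRel d n)) l
    (fun j a b => Iff.rfl)
  obtain ⟨e₂⟩ := symWreath_mulEquiv_relAut (m := d - 1) (E := wordRel d n)
    (fun a b i hi => absurd hi (Nat.not_lt_zero _))
  obtain ⟨e₃⟩ := iterSymWreath_mulEquiv_relAut (d := d) (by omega) n
  obtain ⟨e₄⟩ := symWreath_congr (d - 1) e₃
  exact ⟨((((MonoidHom.ofInjective hinj).trans (MulEquiv.subgroupCongr hl)).trans e₁).trans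
    e₂.symm).trans e₄.symm⟩

end Labels

end

/-- For the generic monic polynomial `f` of degree `d ≥ 2` over a number field `K`: the arboreal
representation on the tree of backward orbits of the critical points is surjective; it induces an
isomorphism of `Gal(K_{s,t}((f' ∘ f^n)⁻¹(0)) / K_{s,t})` with the automorphism group of the tree;
and this Galois group is isomorphic to `S_{d-1}[[S_d]^n]`. -/
theorem theorem1p1 (K : Type*) [Field K] [NumberField K] (d : ℕ) (hd : 2 ≤ d) (n : ℕ) :
    Function.Surjective (arborealRep (genericMonic K d) n) ∧
    (∃ φ : Gal(critField (genericMonic K d) n / GenericField K d) ≃* treeAut (genericMonic K d) n,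
      ∀ (σ : Gal(critField (genericMonic K d) n / GenericField K d))
        (τ : Gal(AlgebraicClosure (GenericField K d) / GenericField K d)),
        (∀ x : critField (genericMonic K d) n,
          τ (x : AlgebraicClosure (GenericField K d)) = (σ x : AlgebraicClosure _)) →
        φ σ = arborealRep (genericMonic K d) n τ) ∧
    Nonempty (Gal(critField (genericMonic K d) n / GenericField K d) ≃*
      SymWreath (d - 1) (IterSymWreath d n)) := by
  have hsurj := arborealRep_surjective (K := K) hd n
  obtain ⟨φ, hφ⟩ := exists_mulEquiv_treeAut (exists_child hd) hsurj
  obtain ⟨e⟩ := treeAut_mulEquiv_symWreath (K := K) hd n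
  exact ⟨hsurj, ⟨φ, hφ⟩, ⟨φ.trans e⟩⟩
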